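/- Let $k$ be a field and let $\mathcal C$ be an additive, idempotent complete, $k$-linear ribbon category, with $k$-bilinear tensor product, whose tensor unit satisfies $\mathrm{End}(\mathbf 1)=k\,\mathrm{id}_{\mathbf 1}\cong k$. Write $c$ for the braiding, $\theta$ for the twist, $b_U:\mathbf 1\to U\otimes U^\vee$ and $d_U:U^\vee\otimes U\to\mathbf 1$ for the duality, $\tilde d_U=d_U\circ c_{U,U^\vee}\circ(\theta_U\otimes\mathrm{id}):U\otimes U^\vee\to\mathbf 1$ and $\tilde b_U=(\mathrm{id}\otimes\theta_U)\circ c_{U,U^\vee}\circ b_U:\mathbf 1\to U^\vee\otimes U$ for the second duality, and $\delta_U=(\mathrm{id}_{U^{\vee\vee}}\otimes d_U)\circ[(c_{U^\vee,U^{\vee\vee}}\circ b_{U^\vee})\otimes\theta_U]:U\to U^{\vee\vee}$ (associators and unitors are suppressed). A Jandl algebra $(A,\sigma)$ in $\mathcal C$ is a symmetric special Frobenius algebra $A=(A,m,\eta,\Delta,\varepsilon)$, normalized by $m\circ\Delta=\mathrm{id}_A$, with a morphism $\sigma:A\to A$ such that $\sigma\circ\eta=\eta$, $\sigma\circ m=m\circ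 c_{A,A}\circ(\sigma\otimes\sigma)$ and $\sigma\circ\sigma=\theta_A$. Here special means that $\varepsilon\circ\eta$ and $m\circ\Delta$ are nonzero multiples of $\mathrm{id}_{\mathbf 1}$ and $\mathrm{id}_A$, and symmetric means that $((\varepsilon\circ m)\otimes\mathrm{id}_{A^\vee})\circ(\mathrm{id}_A\otimes b_A)=(\mathrm{id}_{A^\vee}\otimes(\varepsilon\circ m))\circ(\tilde b_A\otimes\mathrm{id}_A)$. It is simple if $A$ is a simple object of the category of $A$-bimodules. An isomorphism $(A,\sigma)\cong(B,\tau)$ of Jandl algebras is an isomorphism $\varphi$ of Frobenius algebras with $\varphi\circ\sigma=\tau\circ\varphi$. Let $(A,\sigma)$ be a Jandl algebra and $(M,\rho)$ a left $A$-module. Then $M^\vee$ is a right $A$-module via the transpose of $\rho$, and it becomes a left $A$-module $M^\sigma$ with the action $$(\mathrm{id}_{M^\vee}\otimes\tilde d_M)\circ\bigl(\mathrm{id}\otimes[\rho\circ c_{M,A}\circ(\mathrm{id}_M\otimes\sigma)]\otimes\mathrm{id}\bigr)\circ(\tilde b_M\otimes\mathrm{id}_{A\otimes M^\vee}):A\otimes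 M^\vee\to M^\vee.$$ Let $g:M\to M^\sigma$ be an isomorphism of left $A$-modules with $g=\nu\,g^\vee\circ\delta_M$ for some $\nu\in k$. Let $M^\vee\otimes_A M$ be the retract of $M^\vee\otimes M$, with embedding $e$ and retraction $r$, that is the image of the idempotent given by letting the two factors of $\Delta\circ\eta$ act on $M^\vee$ and on $M$. It is an algebra with product $r\circ(\mathrm{id}\otimes\tilde d_M\otimes\mathrm{id})\circ(e\otimes e)$ and unit $r\circ\tilde b_M$. If this algebra carries a normalized symmetric special Frobenius structure (which is then unique), it is regarded as a Frobenius algebra with this structure. Put $$\sigma_g:=\nu\; r\circ(g\otimes g^{-1})\circ(\theta_M\otimes\mathrm{id}_{M^\vee})\circ c_{M^\vee,M}\circ e .$$ Write $(A,\sigma)\sim(B,\tau)$ if there are $M$, $g$ and $\nu$ as above such that $(M^\vee\otimes_A M,\sigma_g)$ is a Jandl algebra and is isomorphic to $(B,\tau)$. Then $\sim$ is an equivalence relation (reflexive, symmetric and transitive) on simple Jandl algebras in $\mathcal C$. It refines Morita equivalence: if $(A,\sigma)\sim(B,\tau)$, then there are an $A$-$B$-bimodule $P$ and a $B$-$A$-bimodule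 $P'$ with $P\otimes_B P'\cong A$ and $P'\otimes_A P\cong B$ as bimodules. -/

import Mathlib

open CategoryTheory CategoryTheory.Limits MonoidalCategory
open scoped MonObj ComonObj

universe w v u

/-- A ribbon category: a braided monoidal category in which every object `X` has a dual `Xᘁ`, with
coevaluation `η_ X Xᘁ : 𝟙_ C ⟶ X ⊗ Xᘁ` and evaluation `ε_ X Xᘁ : Xᘁ ⊗ X ⟶ 𝟙_ C`, together with a
natural twist that is compatible with the tensor product and with duals. -/
class RibbonCategory (C : Type u) [Category.{v} C] [MonoidalCategory C] [BraidedCategory C]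
    [RightRigidCategory C] where
  /-- the twist -/
  twist : ∀ X : C, X ≅ X
  twist_naturality : ∀ {X Y : C} (f : X ⟶ Y), f ≫ (twist Y).hom = (twist X).hom ≫ f
  twist_tensor : ∀ X Y : C, (twist (X ⊗ Y)).hom =
    ((twist X).hom ⊗ₘ (twist Y).hom) ≫ (β_ X Y).hom ≫ (β_ Y X).hom
  twist_dual : ∀ X : C, (twist (Xᘁ)).hom = ((twist X).hom)ᘁ

namespace Ribbon

section Duality

variable {C : Type u} [Category.{v} C] [MonoidalCategory C] [BraidedCategory C]
  [RightRigidCategory C] [RibbonCategory C]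

/-- The twist `θ_X`. -/
abbrev θ (X : C) : X ≅ X := RibbonCategory.twist X

/-- The evaluation `X ⊗ X^∨ ⟶ 1` of the second duality of a ribbon category,
`d_X ∘ c_{X,X^∨} ∘ (θ_X ⊗ id)`. -/
def evalR (X : C) : X ⊗ Xᘁ ⟶ 𝟙_ C :=
  (θ X).hom ▷ Xᘁ ≫ (β_ X Xᘁ).hom ≫ ε_ X Xᘁ

/-- The coevaluation `1 ⟶ X^∨ ⊗ X` of the second duality of a ribbon category,
`(id ⊗ θ_X) ∘ c_{X,X^∨} ∘ b_X`. -/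
def coevR (X : C) : 𝟙_ C ⟶ Xᘁ ⊗ X :=
  η_ X Xᘁ ≫ (β_ X Xᘁ).hom ≫ Xᘁ ◁ (θ X).hom

/-- The natural isomorphism `δ_X : X ⟶ X^∨^∨`,
`(id ⊗ d_X) ∘ ((c_{X^∨,X^∨^∨} ∘ b_{X^∨}) ⊗ θ_X)`. -/
def bidual (X : C) : X ⟶ (Xᘁ)ᘁ :=
  (λ_ X).inv ≫ ((η_ (Xᘁ) ((Xᘁ)ᘁ) ≫ (β_ (Xᘁ) ((Xᘁ)ᘁ)).hom) ⊗ₘ (θ X).hom) ≫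
    (α_ ((Xᘁ)ᘁ) (Xᘁ) X).hom ≫ (Xᘁ)ᘁ ◁ ε_ X (Xᘁ) ≫ (ρ_ ((Xᘁ)ᘁ)).hom

end Duality

section Algebra

variable {C : Type u} [Category.{v} C] [MonoidalCategory C]

/-- An algebra and coalgebra is Frobenius if its coproduct is a morphism of bimodules. -/
structure IsFrobenius (A : C) [MonObj A] [ComonObj A] : Prop where
  comul_mul_left : Δ[A] ▷ A ≫ (α_ A A A).hom ≫ A ◁ μ[A] = μ[A] ≫ Δ[A]
  comul_mul_right : A ◁ Δ[A] ≫ (α_ A A A).inv ≫ μ[A] ▷ A = μ[A] ≫ Δ[A]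

/-- The endomorphism `(ρ ⊗ ρ') ∘ (id ⊗ (Δ ∘ η) ⊗ id)` of `M ⊗ N`, for a right action `ρ` on `M` and
a left action `ρ'` on `N`. For a Frobenius algebra with `m ∘ Δ = id` it is an idempotent, and its
image is the tensor product of `M` and `N` over `A`. -/
def balance (A : C) [MonObj A] [ComonObj A] {M N : C} (actM : M ⊗ A ⟶ M) (actN : A ⊗ N ⟶ N) :
    M ⊗ N ⟶ M ⊗ N :=
  M ◁ (λ_ N).inv ≫ M ◁ ((η[A] ≫ Δ[A]) ▷ N) ≫ M ◁ (α_ A A N).hom ≫ (α_ M A (A ⊗ N)).inv ≫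
    (actM ⊗ₘ actN)

/-- `e` and `r` exhibit `T` as the tensor product of `M` and `N` over `A`, as a retract of `M ⊗ N`:
they split the idempotent `balance`. -/
structure IsTensorOver (A : C) [MonObj A] [ComonObj A] {M N : C} (actM : M ⊗ A ⟶ M)
    (actN : A ⊗ N ⟶ N) {T : C} (e : T ⟶ M ⊗ N) (r : M ⊗ N ⟶ T) : Prop where
  section_retraction : e ≫ r = 𝟙 T
  retraction_section : r ≫ e = balance A actM actN

/-- The `A`-`D`-bimodule `T` is isomorphic to `M ⊗_B N`, for an `A`-`B`-bimodule `M` and a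
`B`-`D`-bimodule `N`: it is a retract as above, with the actions induced from `M ⊗ N`. -/
def IsBimodTensor {A B D : Mon C} [ComonObj B.X] (M : Bimod A B) (N : Bimod B D)
    (T : Bimod A D) : Prop :=
  ∃ (e : T.X ⟶ M.X ⊗ N.X) (r : M.X ⊗ N.X ⟶ T.X),
    IsTensorOver B.X M.actRight N.actLeft e r ∧
    A.X ◁ r ≫ T.actLeft = (α_ A.X M.X N.X).inv ≫ M.actLeft ▷ N.X ≫ r ∧
    r ▷ D.X ≫ T.actRight = (α_ M.X N.X D.X).hom ≫ M.X ◁ N.actRight ≫ r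

/-- An algebra is simple if it is simple as a bimodule over itself: a monomorphism of bimodules into
it is an isomorphism if and only if it is nonzero. -/
def IsSimpleAlgebra [Preadditive C] (A : C) [MonObj A] : Prop :=
  ∀ (X : Bimod (Mon.mk A) (Mon.mk A)) (f : X ⟶ Bimod.regular (Mon.mk A)), Mono f →
    (IsIso f ↔ f.hom ≠ 0)

end Algebra

section Pairing

variable {C : Type u} [Category.{v} C] [MonoidalCategory C] [BraidedCategory C]
  [RightRigidCategory C]

/-- The morphism `Φ = ((ε ∘ m) ⊗ id) ∘ (id ⊗ b_A) : A ⟶ A^∨`. -/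
def frobMap (A : C) [MonObj A] [ComonObj A] : A ⟶ Aᘁ :=
  (ρ_ A).inv ≫ A ◁ η_ A Aᘁ ≫ (α_ A A (Aᘁ)).inv ≫ (μ[A] ≫ ε[A]) ▷ Aᘁ ≫ (λ_ (Aᘁ)).hom

/-- The morphism `Φ' : A ⟶ A^∨`, built in the same way from the other coevaluation. -/
def frobMap' [RibbonCategory C] (A : C) [MonObj A] [ComonObj A] : A ⟶ Aᘁ :=
  (λ_ A).inv ≫ coevR A ▷ A ≫ (α_ (Aᘁ) A A).hom ≫ Aᘁ ◁ (μ[A] ≫ ε[A]) ≫ (ρ_ (Aᘁ)).hom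

end Pairing

end Ribbon

open Ribbon

/-- A Jandl algebra: a symmetric special Frobenius algebra, with the coproduct normalized such that
`m ∘ Δ = id`, together with a reversion `rev`. -/
structure JandlAlgebra (k : Type w) [Field k] (C : Type u) [Category.{v} C] [Preadditive C]
    [Linear k C] [MonoidalCategory C] [BraidedCategory C] [RightRigidCategory C]
    [RibbonCategory C] where
  /-- the underlying object -/
  X : C
  [mon : MonObj X]
  [comon : ComonObj X]
  frobenius : IsFrobenius X
  special : ∃ a b : k, a ≠ 0 ∧ b ≠ 0 ∧ η[X] ≫ ε[X] = a • 𝟙 (𝟙_ C) ∧ Δ[X] ≫ μ[X] = b • 𝟙 X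
  normalized : Δ[X] ≫ μ[X] = 𝟙 X
  symmetric : frobMap X = frobMap' X
  /-- the reversion -/
  rev : X ⟶ X
  unit_rev : η[X] ≫ rev = η[X]
  mul_rev : μ[X] ≫ rev = (rev ⊗ₘ rev) ≫ (β_ X X).hom ≫ μ[X]
  rev_rev : rev ≫ rev = (θ X).hom

attribute [instance] JandlAlgebra.mon JandlAlgebra.comon

namespace JandlAlgebra

variable {k : Type w} [Field k] {C : Type u} [Category.{v} C] [Preadditive C] [Linear k C]
  [MonoidalCategory C] [BraidedCategory C] [RightRigidCategory C] [RibbonCategory C]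

/-- Isomorphism of Jandl algebras: an isomorphism of Frobenius algebras that intertwines the
reversions. -/
def IsIsomorphic (A B : JandlAlgebra k C) : Prop :=
  ∃ φ : A.X ≅ B.X, IsMonHom φ.hom ∧ IsComonHom φ.hom ∧ A.rev ≫ φ.hom = φ.hom ≫ B.rev

/-- A Jandl algebra is simple if its underlying algebra is. -/
def IsSimple (A : JandlAlgebra k C) : Prop := IsSimpleAlgebra A.X

/-- The right action of `A` on `M^∨`, for a left `A`-module `M`: the transpose of the left action,
`(d_M ⊗ id) ∘ (id ⊗ ρ ⊗ id) ∘ (id ⊗ id ⊗ b_M)`. -/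
def dualAct (A : JandlAlgebra k C) (M : C) [ModObj A.X M] : Mᘁ ⊗ A.X ⟶ Mᘁ :=
  (ρ_ (Mᘁ ⊗ A.X)).inv ≫ (Mᘁ ⊗ A.X) ◁ η_ M Mᘁ ≫ (α_ (Mᘁ ⊗ A.X) M (Mᘁ)).inv ≫
    (α_ (Mᘁ) A.X M).hom ▷ Mᘁ ≫ (Mᘁ ◁ γ[A.X, M]) ▷ Mᘁ ≫ ε_ M Mᘁ ▷ Mᘁ ≫ (λ_ (Mᘁ)).hom

/-- The left action of `A` on `M^∨` that makes it the left module `M^σ`: the transpose, with respect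
to the second duality, of the morphism `ρ ∘ c_{M,A} ∘ (id ⊗ σ) : M ⊗ A ⟶ M`. -/
def conjAct (A : JandlAlgebra k C) (M : C) [ModObj A.X M] : A.X ⊗ Mᘁ ⟶ Mᘁ :=
  (λ_ (A.X ⊗ Mᘁ)).inv ≫ coevR M ▷ (A.X ⊗ Mᘁ) ≫ (α_ (Mᘁ) M (A.X ⊗ Mᘁ)).hom ≫
    Mᘁ ◁ ((α_ M A.X (Mᘁ)).inv ≫ (M ◁ A.rev ≫ (β_ M A.X).hom ≫ γ[A.X, M]) ▷ Mᘁ ≫ evalR M) ≫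
      (ρ_ (Mᘁ)).hom

/-- `g` is an isomorphism of left modules `M ⟶ M^σ` with `g = ν g^∨ ∘ δ_M`. -/
structure IsReversalIso (A : JandlAlgebra k C) (M : C) [ModObj A.X M] (g : M ≅ Mᘁ) (ν : k) :
    Prop where
  isModHom : γ[A.X, M] ≫ g.hom = A.X ◁ g.hom ≫ A.conjAct M
  symm : g.hom = ν • (bidual M ≫ (g.hom)ᘁ)

/-- The Jandl algebra `Q` is `(M^∨ ⊗_A M, σ_g)`. Its object is the image of the idempotent on
`M^∨ ⊗ M`, with inclusion `e` and retraction `r`; its product contracts the two inner factors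
`M ⊗ M^∨`; its unit is the coevaluation; its reversion is
`ν r ∘ (g ⊗ g⁻¹) ∘ (θ_M ⊗ id) ∘ c_{M^∨,M} ∘ e`. The coproduct and the counit of a normalized
symmetric special Frobenius algebra are determined by its product and unit. -/
structure IsDualTensor (A : JandlAlgebra k C) (M : C) [ModObj A.X M] (g : M ≅ Mᘁ) (ν : k)
    (Q : JandlAlgebra k C) (e : Q.X ⟶ Mᘁ ⊗ M) (r : Mᘁ ⊗ M ⟶ Q.X) : Prop where
  isTensorOver : IsTensorOver A.X (A.dualAct M) γ[A.X, M] e r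
  unit_eq : η[Q.X] = coevR M ≫ r
  mul_eq : μ[Q.X] = (e ⊗ₘ e) ≫ (α_ (Mᘁ) M (Mᘁ ⊗ M)).hom ≫
    Mᘁ ◁ ((α_ M (Mᘁ) M).inv ≫ evalR M ▷ M ≫ (λ_ M).hom) ≫ r
  rev_eq : Q.rev = ν • (e ≫ (β_ (Mᘁ) M).hom ≫ (θ M).hom ▷ Mᘁ ≫ (g.hom ⊗ₘ g.inv) ≫ r)

/-- Equivalence of Jandl algebras: `B` is isomorphic to `(M^∨ ⊗_A M, σ_g)` for some `M` and `g`. -/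
def IsEquivalent (A B : JandlAlgebra k C) : Prop :=
  ∃ (M : C) (_ : ModObj A.X M) (g : M ≅ Mᘁ) (ν : k) (Q : JandlAlgebra k C)
    (e : Q.X ⟶ Mᘁ ⊗ M) (r : Mᘁ ⊗ M ⟶ Q.X),
    A.IsReversalIso M g ν ∧ A.IsDualTensor M g ν Q e r ∧ Q.IsIsomorphic B

/-- Morita equivalence of the underlying algebras: there are bimodules `M` and `N` with
`M ⊗_B N ≅ A` and `N ⊗_A M ≅ B` as bimodules. -/
def IsMoritaEquivalent (A B : JandlAlgebra k C) : Prop :=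
  ∃ (M : Bimod (Mon.mk A.X) (Mon.mk B.X)) (N : Bimod (Mon.mk B.X) (Mon.mk A.X)),
    IsBimodTensor (B := Mon.mk B.X) M N (Bimod.regular (Mon.mk A.X)) ∧
    IsBimodTensor (B := Mon.mk A.X) N M (Bimod.regular (Mon.mk B.X))

end JandlAlgebra

-- An equivalence is repackaged as a `Reversal`: a left `A`-module `M` with a nondegenerate form `b`
-- on `M ⊗ M` that is symmetric up to twist and a scalar `ν`, and that satisfies `b(xa, y) = b(x,
-- ay)` for the right action built from the left action, the braiding and `σ`. In addition `B` is
-- identified with `M ⊗_A M`, with product `[x ⊗ y][x' ⊗ y'] = [x ⊗ b(y, x') y']` and the twisted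
-- flip, times `ν`, as reversion. An isomorphism `g : M ≅ M^σ` corresponds to the form obtained from
-- the second evaluation and `g` (`IsEquivalent.nonempty_reversal`, `Reversal.isEquivalent`).
-- Element notation stands for string diagrams, with braidings and twists left out.
--
-- Write `κ = Δ ∘ η`. The `A`-valued pairing `⟨x, y⟩ = κ₁ b(κ₂ x, y)` makes `M` an `A`-`B`-bimodule
-- and a `B`-`A`-bimodule by `x[y ⊗ z] = ⟨x, y⟩z` and `[x ⊗ y]z = x⟨y, z⟩`. The form also induces a
-- functional on `B`; it is symmetric up to twist, hence represented by a central element `w`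
-- (`trace_symm`, `density_central`). With `q` the copairing of `b`, the maps `x ⊗ y ↦ ⟨xw, y⟩` and
-- `a ↦ aq` compose to the idempotent that cuts out `M ⊗_B M` (`retract_insert`). The opposite
-- composite is an idempotent bimodule endomorphism of `A`, so by simplicity it is zero or the
-- identity. Zero would force `b = 0` and then `B = 0`, which `ε ∘ η ≠ 0` excludes. Thus `M ⊗_B M ≅
-- A`: this is the Morita equivalence, and reading the same module from the side of `B` gives
-- symmetry (`Reversal.inverse`).
--
-- Reflexivity uses the regular module with the form `(x, y) ↦ ε(σ⁻¹(x) y)`. It relies on `ε ∘ σ =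
-- ε`, which is derived from the axioms (`rev_counit`). For transitivity, the module is `P = M ⊗_B
-- N`. The braiding identifies it with `N ⊗_B M` (`balance_cross_over`), so the two forms can be
-- nested inside each other, and the scalars multiply.

universe w₁ v₁ u₁

set_option linter.unusedSectionVars false

/-! ### String calculus on right-nested tensor products. -/

namespace Strand

variable {C : Type u₁} [Category.{v₁} C]

/-- With a generic tail attached, the end of a composite can be rewritten by the same lemmas as its
middle. -/
theorem hom_ext_of_comp {X Y : C} {f g : X ⟶ Y} (h : ∀ (W : C) (t : Y ⟶ W), f ≫ t = g ≫ t) :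
    f = g := by
  simpa using h Y (𝟙 Y)

variable [MonoidalCategory C]

/-! The lemma `atd_m_n` rewrites `m` consecutive factors of a composite, each whiskered on the left by
`d` objects, into `n` such factors; an identity counts as `n = 0`. -/

theorem at0_1_2 {Y0 Y1 V1 : C} {f1 : Y0 ⟶ Y1} {g1 : Y0 ⟶ V1} {g2 : V1 ⟶ Y1}
    (e : f1 = g1 ≫ g2) {W : C} (t : Y1 ⟶ W) :
    f1 ≫ t = g1 ≫ g2 ≫ t := by
  simpa using congrArg (·) e =≫ t

theorem at0_1_3 {Y0 Y1 V1 V2 : C} {f1 : Y0 ⟶ Y1} {g1 : Y0 ⟶ V1} {g2 : V1 ⟶ V2} {g3 : V2 ⟶ Y1}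
    (e : f1 = g1 ≫ g2 ≫ g3) {W : C} (t : Y1 ⟶ W) :
    f1 ≫ t = g1 ≫ g2 ≫ g3 ≫ t := by
  simpa using congrArg (·) e =≫ t

theorem at0_2_0 {Y0 Y1 : C} {f1 : Y0 ⟶ Y1} {f2 : Y1 ⟶ Y0}
    (e : f1 ≫ f2 = 𝟙 Y0) {W : C} (t : Y0 ⟶ W) :
    f1 ≫ f2 ≫ t = t := by
  simpa using congrArg (·) e =≫ t

theorem at0_2_1 {Y0 Y1 Y2 : C} {f1 : Y0 ⟶ Y1} {f2 : Y1 ⟶ Y2} {g1 : Y0 ⟶ Y2}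
    (e : f1 ≫ f2 = g1) {W : C} (t : Y2 ⟶ W) :
    f1 ≫ f2 ≫ t = g1 ≫ t := by
  simpa using congrArg (·) e =≫ t

theorem at0_2_2 {Y0 Y1 Y2 V1 : C} {f1 : Y0 ⟶ Y1} {f2 : Y1 ⟶ Y2} {g1 : Y0 ⟶ V1} {g2 : V1 ⟶ Y2}
    (e : f1 ≫ f2 = g1 ≫ g2) {W : C} (t : Y2 ⟶ W) :
    f1 ≫ f2 ≫ t = g1 ≫ g2 ≫ t := by
  simpa using congrArg (·) e =≫ t

theorem at0_2_3 {Y0 Y1 Y2 V1 V2 : C} {f1 : Y0 ⟶ Y1} {f2 : Y1 ⟶ Y2} {g1 : Y0 ⟶ V1} {g2 : V1 ⟶ V2} {g3 : V2 ⟶ Y2}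
    (e : f1 ≫ f2 = g1 ≫ g2 ≫ g3) {W : C} (t : Y2 ⟶ W) :
    f1 ≫ f2 ≫ t = g1 ≫ g2 ≫ g3 ≫ t := by
  simpa using congrArg (·) e =≫ t

theorem at0_2_4 {Y0 Y1 Y2 V1 V2 V3 : C} {f1 : Y0 ⟶ Y1} {f2 : Y1 ⟶ Y2} {g1 : Y0 ⟶ V1} {g2 : V1 ⟶ V2} {g3 : V2 ⟶ V3} {g4 : V3 ⟶ Y2}
    (e : f1 ≫ f2 = g1 ≫ g2 ≫ g3 ≫ g4) {W : C} (t : Y2 ⟶ W) :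
    f1 ≫ f2 ≫ t = g1 ≫ g2 ≫ g3 ≫ g4 ≫ t := by
  simpa using congrArg (·) e =≫ t

theorem at0_2_5 {Y0 Y1 Y2 V1 V2 V3 V4 : C} {f1 : Y0 ⟶ Y1} {f2 : Y1 ⟶ Y2} {g1 : Y0 ⟶ V1} {g2 : V1 ⟶ V2} {g3 : V2 ⟶ V3} {g4 : V3 ⟶ V4} {g5 : V4 ⟶ Y2}
    (e : f1 ≫ f2 = g1 ≫ g2 ≫ g3 ≫ g4 ≫ g5) {W : C} (t : Y2 ⟶ W) :
    f1 ≫ f2 ≫ t = g1 ≫ g2 ≫ g3 ≫ g4 ≫ g5 ≫ t := by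
  simpa using congrArg (·) e =≫ t

theorem at0_3_1 {Y0 Y1 Y2 Y3 : C} {f1 : Y0 ⟶ Y1} {f2 : Y1 ⟶ Y2} {f3 : Y2 ⟶ Y3} {g1 : Y0 ⟶ Y3}
    (e : f1 ≫ f2 ≫ f3 = g1) {W : C} (t : Y3 ⟶ W) :
    f1 ≫ f2 ≫ f3 ≫ t = g1 ≫ t := by
  simpa using congrArg (·) e =≫ t

theorem at0_3_2 {Y0 Y1 Y2 Y3 V1 : C} {f1 : Y0 ⟶ Y1} {f2 : Y1 ⟶ Y2} {f3 : Y2 ⟶ Y3} {g1 : Y0 ⟶ V1} {g2 : V1 ⟶ Y3}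
    (e : f1 ≫ f2 ≫ f3 = g1 ≫ g2) {W : C} (t : Y3 ⟶ W) :
    f1 ≫ f2 ≫ f3 ≫ t = g1 ≫ g2 ≫ t := by
  simpa using congrArg (·) e =≫ t

theorem at0_3_3 {Y0 Y1 Y2 Y3 V1 V2 : C} {f1 : Y0 ⟶ Y1} {f2 : Y1 ⟶ Y2} {f3 : Y2 ⟶ Y3} {g1 : Y0 ⟶ V1} {g2 : V1 ⟶ V2} {g3 : V2 ⟶ Y3}
    (e : f1 ≫ f2 ≫ f3 = g1 ≫ g2 ≫ g3) {W : C} (t : Y3 ⟶ W) :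
    f1 ≫ f2 ≫ f3 ≫ t = g1 ≫ g2 ≫ g3 ≫ t := by
  simpa using congrArg (·) e =≫ t

theorem at0_4_2 {Y0 Y1 Y2 Y3 Y4 V1 : C} {f1 : Y0 ⟶ Y1} {f2 : Y1 ⟶ Y2} {f3 : Y2 ⟶ Y3} {f4 : Y3 ⟶ Y4} {g1 : Y0 ⟶ V1} {g2 : V1 ⟶ Y4}
    (e : f1 ≫ f2 ≫ f3 ≫ f4 = g1 ≫ g2) {W : C} (t : Y4 ⟶ W) :
    f1 ≫ f2 ≫ f3 ≫ f4 ≫ t = g1 ≫ g2 ≫ t := by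
  simpa using congrArg (·) e =≫ t

theorem at0_5_2 {Y0 Y1 Y2 Y3 Y4 Y5 V1 : C} {f1 : Y0 ⟶ Y1} {f2 : Y1 ⟶ Y2} {f3 : Y2 ⟶ Y3} {f4 : Y3 ⟶ Y4} {f5 : Y4 ⟶ Y5} {g1 : Y0 ⟶ V1} {g2 : V1 ⟶ Y5}
    (e : f1 ≫ f2 ≫ f3 ≫ f4 ≫ f5 = g1 ≫ g2) {W : C} (t : Y5 ⟶ W) :
    f1 ≫ f2 ≫ f3 ≫ f4 ≫ f5 ≫ t = g1 ≫ g2 ≫ t := by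
  simpa using congrArg (·) e =≫ t

theorem at1_2_0 {X1 : C} {Y0 Y1 : C} {f1 : Y0 ⟶ Y1} {f2 : Y1 ⟶ Y0}
    (e : f1 ≫ f2 = 𝟙 Y0) {W : C} (t : X1 ⊗ Y0 ⟶ W) :
    X1 ◁ f1 ≫ X1 ◁ f2 ≫ t = t := by
  simpa using congrArg (X1 ◁ ·) e =≫ t

theorem at1_2_1 {X1 : C} {Y0 Y1 Y2 : C} {f1 : Y0 ⟶ Y1} {f2 : Y1 ⟶ Y2} {g1 : Y0 ⟶ Y2}
    (e : f1 ≫ f2 = g1) {W : C} (t : X1 ⊗ Y2 ⟶ W) :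
    X1 ◁ f1 ≫ X1 ◁ f2 ≫ t = X1 ◁ g1 ≫ t := by
  simpa using congrArg (X1 ◁ ·) e =≫ t

theorem at1_2_2 {X1 : C} {Y0 Y1 Y2 V1 : C} {f1 : Y0 ⟶ Y1} {f2 : Y1 ⟶ Y2} {g1 : Y0 ⟶ V1} {g2 : V1 ⟶ Y2}
    (e : f1 ≫ f2 = g1 ≫ g2) {W : C} (t : X1 ⊗ Y2 ⟶ W) :
    X1 ◁ f1 ≫ X1 ◁ f2 ≫ t = X1 ◁ g1 ≫ X1 ◁ g2 ≫ t := by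
  simpa using congrArg (X1 ◁ ·) e =≫ t

theorem at1_2_3 {X1 : C} {Y0 Y1 Y2 V1 V2 : C} {f1 : Y0 ⟶ Y1} {f2 : Y1 ⟶ Y2} {g1 : Y0 ⟶ V1} {g2 : V1 ⟶ V2} {g3 : V2 ⟶ Y2}
    (e : f1 ≫ f2 = g1 ≫ g2 ≫ g3) {W : C} (t : X1 ⊗ Y2 ⟶ W) :
    X1 ◁ f1 ≫ X1 ◁ f2 ≫ t = X1 ◁ g1 ≫ X1 ◁ g2 ≫ X1 ◁ g3 ≫ t := by
  simpa using congrArg (X1 ◁ ·) e =≫ t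

theorem at1_2_4 {X1 : C} {Y0 Y1 Y2 V1 V2 V3 : C} {f1 : Y0 ⟶ Y1} {f2 : Y1 ⟶ Y2} {g1 : Y0 ⟶ V1} {g2 : V1 ⟶ V2} {g3 : V2 ⟶ V3} {g4 : V3 ⟶ Y2}
    (e : f1 ≫ f2 = g1 ≫ g2 ≫ g3 ≫ g4) {W : C} (t : X1 ⊗ Y2 ⟶ W) :
    X1 ◁ f1 ≫ X1 ◁ f2 ≫ t = X1 ◁ g1 ≫ X1 ◁ g2 ≫ X1 ◁ g3 ≫ X1 ◁ g4 ≫ t := by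
  simpa using congrArg (X1 ◁ ·) e =≫ t

theorem at1_3_1 {X1 : C} {Y0 Y1 Y2 Y3 : C} {f1 : Y0 ⟶ Y1} {f2 : Y1 ⟶ Y2} {f3 : Y2 ⟶ Y3} {g1 : Y0 ⟶ Y3}
    (e : f1 ≫ f2 ≫ f3 = g1) {W : C} (t : X1 ⊗ Y3 ⟶ W) :
    X1 ◁ f1 ≫ X1 ◁ f2 ≫ X1 ◁ f3 ≫ t = X1 ◁ g1 ≫ t := by
  simpa using congrArg (X1 ◁ ·) e =≫ t

theorem at1_3_2 {X1 : C} {Y0 Y1 Y2 Y3 V1 : C} {f1 : Y0 ⟶ Y1} {f2 : Y1 ⟶ Y2} {f3 : Y2 ⟶ Y3} {g1 : Y0 ⟶ V1} {g2 : V1 ⟶ Y3}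
    (e : f1 ≫ f2 ≫ f3 = g1 ≫ g2) {W : C} (t : X1 ⊗ Y3 ⟶ W) :
    X1 ◁ f1 ≫ X1 ◁ f2 ≫ X1 ◁ f3 ≫ t = X1 ◁ g1 ≫ X1 ◁ g2 ≫ t := by
  simpa using congrArg (X1 ◁ ·) e =≫ t

theorem at1_3_3 {X1 : C} {Y0 Y1 Y2 Y3 V1 V2 : C} {f1 : Y0 ⟶ Y1} {f2 : Y1 ⟶ Y2} {f3 : Y2 ⟶ Y3} {g1 : Y0 ⟶ V1} {g2 : V1 ⟶ V2} {g3 : V2 ⟶ Y3}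
    (e : f1 ≫ f2 ≫ f3 = g1 ≫ g2 ≫ g3) {W : C} (t : X1 ⊗ Y3 ⟶ W) :
    X1 ◁ f1 ≫ X1 ◁ f2 ≫ X1 ◁ f3 ≫ t = X1 ◁ g1 ≫ X1 ◁ g2 ≫ X1 ◁ g3 ≫ t := by
  simpa using congrArg (X1 ◁ ·) e =≫ t

theorem at1_4_1 {X1 : C} {Y0 Y1 Y2 Y3 Y4 : C} {f1 : Y0 ⟶ Y1} {f2 : Y1 ⟶ Y2} {f3 : Y2 ⟶ Y3} {f4 : Y3 ⟶ Y4} {g1 : Y0 ⟶ Y4}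
    (e : f1 ≫ f2 ≫ f3 ≫ f4 = g1) {W : C} (t : X1 ⊗ Y4 ⟶ W) :
    X1 ◁ f1 ≫ X1 ◁ f2 ≫ X1 ◁ f3 ≫ X1 ◁ f4 ≫ t = X1 ◁ g1 ≫ t := by
  simpa using congrArg (X1 ◁ ·) e =≫ t

theorem at2_2_0 {X1 X2 : C} {Y0 Y1 : C} {f1 : Y0 ⟶ Y1} {f2 : Y1 ⟶ Y0}
    (e : f1 ≫ f2 = 𝟙 Y0) {W : C} (t : X1 ⊗ X2 ⊗ Y0 ⟶ W) :
    X1 ◁ X2 ◁ f1 ≫ X1 ◁ X2 ◁ f2 ≫ t = t := by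
  simpa using congrArg (X1 ◁ X2 ◁ ·) e =≫ t

theorem at2_2_1 {X1 X2 : C} {Y0 Y1 Y2 : C} {f1 : Y0 ⟶ Y1} {f2 : Y1 ⟶ Y2} {g1 : Y0 ⟶ Y2}
    (e : f1 ≫ f2 = g1) {W : C} (t : X1 ⊗ X2 ⊗ Y2 ⟶ W) :
    X1 ◁ X2 ◁ f1 ≫ X1 ◁ X2 ◁ f2 ≫ t = X1 ◁ X2 ◁ g1 ≫ t := by
  simpa using congrArg (X1 ◁ X2 ◁ ·) e =≫ t

theorem at2_2_2 {X1 X2 : C} {Y0 Y1 Y2 V1 : C} {f1 : Y0 ⟶ Y1} {f2 : Y1 ⟶ Y2} {g1 : Y0 ⟶ V1} {g2 : V1 ⟶ Y2}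
    (e : f1 ≫ f2 = g1 ≫ g2) {W : C} (t : X1 ⊗ X2 ⊗ Y2 ⟶ W) :
    X1 ◁ X2 ◁ f1 ≫ X1 ◁ X2 ◁ f2 ≫ t = X1 ◁ X2 ◁ g1 ≫ X1 ◁ X2 ◁ g2 ≫ t := by
  simpa using congrArg (X1 ◁ X2 ◁ ·) e =≫ t

theorem at2_2_3 {X1 X2 : C} {Y0 Y1 Y2 V1 V2 : C} {f1 : Y0 ⟶ Y1} {f2 : Y1 ⟶ Y2} {g1 : Y0 ⟶ V1} {g2 : V1 ⟶ V2} {g3 : V2 ⟶ Y2}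
    (e : f1 ≫ f2 = g1 ≫ g2 ≫ g3) {W : C} (t : X1 ⊗ X2 ⊗ Y2 ⟶ W) :
    X1 ◁ X2 ◁ f1 ≫ X1 ◁ X2 ◁ f2 ≫ t = X1 ◁ X2 ◁ g1 ≫ X1 ◁ X2 ◁ g2 ≫ X1 ◁ X2 ◁ g3 ≫ t := by
  simpa using congrArg (X1 ◁ X2 ◁ ·) e =≫ t

theorem at2_3_1 {X1 X2 : C} {Y0 Y1 Y2 Y3 : C} {f1 : Y0 ⟶ Y1} {f2 : Y1 ⟶ Y2} {f3 : Y2 ⟶ Y3} {g1 : Y0 ⟶ Y3}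
    (e : f1 ≫ f2 ≫ f3 = g1) {W : C} (t : X1 ⊗ X2 ⊗ Y3 ⟶ W) :
    X1 ◁ X2 ◁ f1 ≫ X1 ◁ X2 ◁ f2 ≫ X1 ◁ X2 ◁ f3 ≫ t = X1 ◁ X2 ◁ g1 ≫ t := by
  simpa using congrArg (X1 ◁ X2 ◁ ·) e =≫ t

/-- The morphism `f ▷ Z`, as an operation on the leftmost strands of a right-nested tensor
product. -/
def op11 {X Y : C} (f : X ⟶ Y) (Z : C) : X ⊗ Z ⟶ Y ⊗ Z := f ▷ Z

/-- The action of a morphism without input on a right-nested tensor product. -/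
def op01 {X : C} (f : 𝟙_ C ⟶ X) (Z : C) : Z ⟶ X ⊗ Z := (λ_ Z).inv ≫ f ▷ Z

/-- The action of a morphism without output on a right-nested tensor product. -/
def op10 {X : C} (f : X ⟶ 𝟙_ C) (Z : C) : X ⊗ Z ⟶ Z := f ▷ Z ≫ (λ_ Z).hom

/-- The action of a cup on a right-nested tensor product. -/
def op02 {A B : C} (f : 𝟙_ C ⟶ A ⊗ B) (Z : C) : Z ⟶ A ⊗ B ⊗ Z :=
  (λ_ Z).inv ≫ f ▷ Z ≫ (α_ A B Z).hom

/-- The action of a cap on a right-nested tensor product. -/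
def op20 {A B : C} (f : A ⊗ B ⟶ 𝟙_ C) (Z : C) : A ⊗ B ⊗ Z ⟶ Z :=
  (α_ A B Z).inv ≫ f ▷ Z ≫ (λ_ Z).hom

/-- The action of a morphism with two inputs on a right-nested tensor product. -/
def op21 {A B D : C} (f : A ⊗ B ⟶ D) (Z : C) : A ⊗ B ⊗ Z ⟶ D ⊗ Z :=
  (α_ A B Z).inv ≫ f ▷ Z

/-- The action of a morphism with two outputs on a right-nested tensor product. -/
def op12 {A B D : C} (f : D ⟶ A ⊗ B) (Z : C) : D ⊗ Z ⟶ A ⊗ B ⊗ Z :=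
  f ▷ Z ≫ (α_ A B Z).hom

/-- The action of a morphism with two inputs and two outputs on a right-nested tensor product. -/
def op22 {A B D E : C} (f : A ⊗ B ⟶ D ⊗ E) (Z : C) : A ⊗ B ⊗ Z ⟶ D ⊗ E ⊗ Z :=
  (α_ A B Z).inv ≫ f ▷ Z ≫ (α_ D E Z).hom

/-- The interchange law. As a `simp` rule its tailed form moves operations on the leftmost strands
to the front, which gives diagrams of independent operations a common order. -/
theorem op11_slide {A D : C} (f : A ⟶ D) {Z W : C} (g : Z ⟶ W) :
    A ◁ g ≫ op11 f W = op11 f Z ≫ D ◁ g := by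
  simpa [op11] using congrArg (fun t => 𝟙 _ ≫ t ≫ 𝟙 _) (whisker_exchange f g)

@[simp] theorem op11_slide0 {A D : C} (f : A ⟶ D) {Z W : C} (g : Z ⟶ W) {V : C}
    (t : D ⊗ W ⟶ V) :
    A ◁ g ≫ op11 f W ≫ t =
      op11 f Z ≫ D ◁ g ≫ t := by
  exact at0_2_2 (op11_slide f g) t

@[simp] theorem op11_slide1 {A D : C} (f : A ⟶ D) {X1 : C} {Z W : C} (g : Z ⟶ W) {V : C}
    (t : X1 ⊗ D ⊗ W ⟶ V) :
    X1 ◁ A ◁ g ≫ X1 ◁ op11 f W ≫ t =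
      X1 ◁ op11 f Z ≫ X1 ◁ D ◁ g ≫ t := by
  exact at1_2_2 (op11_slide f g) t

theorem op01_slide {D : C} (f : 𝟙_ C ⟶ D) {Z W : C} (g : Z ⟶ W) :
    g ≫ op01 f W = op01 f Z ≫ D ◁ g := by
  simpa [op01] using congrArg (fun t => (λ_ Z).inv ≫ t ≫ 𝟙 _) (whisker_exchange f g)

@[simp] theorem op01_slide0 {D : C} (f : 𝟙_ C ⟶ D) {Z W : C} (g : Z ⟶ W) {V : C}
    (t : D ⊗ W ⟶ V) :
    g ≫ op01 f W ≫ t =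
      op01 f Z ≫ D ◁ g ≫ t := by
  exact at0_2_2 (op01_slide f g) t

theorem op02_slide {D E : C} (f : 𝟙_ C ⟶ D ⊗ E) {Z W : C} (g : Z ⟶ W) :
    g ≫ op02 f W = op02 f Z ≫ D ◁ E ◁ g := by
  simpa [op02] using congrArg (fun t => (λ_ Z).inv ≫ t ≫ (α_ D E W).hom) (whisker_exchange f g)

@[simp] theorem op02_slide0 {D E : C} (f : 𝟙_ C ⟶ D ⊗ E) {Z W : C} (g : Z ⟶ W) {V : C}
    (t : D ⊗ E ⊗ W ⟶ V) :
    g ≫ op02 f W ≫ t =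
      op02 f Z ≫ D ◁ E ◁ g ≫ t := by
  exact at0_2_2 (op02_slide f g) t

theorem op20_slide {A B : C} (f : A ⊗ B ⟶ 𝟙_ C) {Z W : C} (g : Z ⟶ W) :
    A ◁ B ◁ g ≫ op20 f W = op20 f Z ≫ g := by
  simpa [op20] using congrArg (fun t => (α_ A B Z).inv ≫ t ≫ (λ_ W).hom) (whisker_exchange f g)

@[simp] theorem op20_slide0 {A B : C} (f : A ⊗ B ⟶ 𝟙_ C) {Z W : C} (g : Z ⟶ W) {V : C}
    (t : W ⟶ V) :
    A ◁ B ◁ g ≫ op20 f W ≫ t =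
      op20 f Z ≫ g ≫ t := by
  exact at0_2_2 (op20_slide f g) t

@[simp] theorem op20_slide1 {A B : C} (f : A ⊗ B ⟶ 𝟙_ C) {X1 : C} {Z W : C} (g : Z ⟶ W) {V : C}
    (t : X1 ⊗ W ⟶ V) :
    X1 ◁ A ◁ B ◁ g ≫ X1 ◁ op20 f W ≫ t =
      X1 ◁ op20 f Z ≫ X1 ◁ g ≫ t := by
  exact at1_2_2 (op20_slide f g) t

theorem op21_slide {A B D : C} (f : A ⊗ B ⟶ D) {Z W : C} (g : Z ⟶ W) :
    A ◁ B ◁ g ≫ op21 f W = op21 f Z ≫ D ◁ g := by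
  simpa [op21] using congrArg (fun t => (α_ A B Z).inv ≫ t ≫ 𝟙 _) (whisker_exchange f g)

@[simp] theorem op21_slide0 {A B D : C} (f : A ⊗ B ⟶ D) {Z W : C} (g : Z ⟶ W) {V : C}
    (t : D ⊗ W ⟶ V) :
    A ◁ B ◁ g ≫ op21 f W ≫ t =
      op21 f Z ≫ D ◁ g ≫ t := by
  exact at0_2_2 (op21_slide f g) t

@[simp] theorem op21_slide1 {A B D : C} (f : A ⊗ B ⟶ D) {X1 : C} {Z W : C} (g : Z ⟶ W) {V : C}
    (t : X1 ⊗ D ⊗ W ⟶ V) :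
    X1 ◁ A ◁ B ◁ g ≫ X1 ◁ op21 f W ≫ t =
      X1 ◁ op21 f Z ≫ X1 ◁ D ◁ g ≫ t := by
  exact at1_2_2 (op21_slide f g) t

theorem op12_slide {A D E : C} (f : A ⟶ D ⊗ E) {Z W : C} (g : Z ⟶ W) :
    A ◁ g ≫ op12 f W = op12 f Z ≫ D ◁ E ◁ g := by
  simpa [op12] using congrArg (fun t => 𝟙 _ ≫ t ≫ (α_ D E W).hom) (whisker_exchange f g)

@[simp] theorem op12_slide0 {A D E : C} (f : A ⟶ D ⊗ E) {Z W : C} (g : Z ⟶ W) {V : C}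
    (t : D ⊗ E ⊗ W ⟶ V) :
    A ◁ g ≫ op12 f W ≫ t =
      op12 f Z ≫ D ◁ E ◁ g ≫ t := by
  exact at0_2_2 (op12_slide f g) t

theorem op22_slide {A B D E : C} (f : A ⊗ B ⟶ D ⊗ E) {Z W : C} (g : Z ⟶ W) :
    A ◁ B ◁ g ≫ op22 f W = op22 f Z ≫ D ◁ E ◁ g := by
  simpa [op22] using congrArg (fun t => (α_ A B Z).inv ≫ t ≫ (α_ D E W).hom) (whisker_exchange f g)

@[simp] theorem op22_slide0 {A B D E : C} (f : A ⊗ B ⟶ D ⊗ E) {Z W : C} (g : Z ⟶ W) {V : C}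
    (t : D ⊗ E ⊗ W ⟶ V) :
    A ◁ B ◁ g ≫ op22 f W ≫ t =
      op22 f Z ≫ D ◁ E ◁ g ≫ t := by
  exact at0_2_2 (op22_slide f g) t

theorem op11_comp {X Y V : C} (f : X ⟶ Y) (g : Y ⟶ V) (Z : C) :
    op11 (f ≫ g) Z = op11 f Z ≫ op11 g Z := by
  simp [op11]

theorem op11_id (X Z : C) : op11 (𝟙 X) Z = 𝟙 (X ⊗ Z) := by
  simp [op11]

/-- The braiding of the two leftmost strands. -/
abbrev bra [BraidedCategory C] (X Y Z : C) : X ⊗ Y ⊗ Z ⟶ Y ⊗ X ⊗ Z := op22 (β_ X Y).hom Z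

/-- The inverse braiding of the two leftmost strands. -/
abbrev ibra [BraidedCategory C] (X Y Z : C) : X ⊗ Y ⊗ Z ⟶ Y ⊗ X ⊗ Z := op22 (β_ Y X).inv Z

/-! ### Naturality of the braiding, strand by strand. -/

section Braided

variable [BraidedCategory C]

theorem bra_ibra (X Y Z : C) : bra X Y Z ≫ ibra Y X Z = 𝟙 _ := by
  simp [op22]

theorem ibra_bra (X Y Z : C) : ibra X Y Z ≫ bra Y X Z = 𝟙 _ := by
  simp [op22]

theorem bra_op11_left {A D : C} (f : A ⟶ D) (X Z : C) :
    X ◁ op11 f Z ≫ bra X D Z =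
      bra X A Z ≫ op11 f (X ⊗ Z) := by
  have h := congrArg (fun t => ((α_ X A Z).inv) ≫ t ▷ Z ≫ ((α_ D X Z).hom)) (BraidedCategory.braiding_naturality_right X f)
  simpa [op11, op22, -BraidedCategory.braiding_naturality_right,
    -BraidedCategory.braiding_naturality_left] using h

theorem bra_op11_right {A D : C} (f : A ⟶ D) (X Z : C) :
    op11 f (X ⊗ Z) ≫ bra D X Z =
      bra A X Z ≫ X ◁ op11 f Z := by
  have h := congrArg (fun t => ((α_ A X Z).inv) ≫ t ▷ Z ≫ ((α_ X D Z).hom)) (BraidedCategory.braiding_naturality_left f X)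
  simpa [op11, op22, -BraidedCategory.braiding_naturality_right,
    -BraidedCategory.braiding_naturality_left] using h

theorem bra_op01_left {D : C} (f : 𝟙_ C ⟶ D) (X Z : C) :
    X ◁ op01 f Z ≫ bra X D Z =
      op01 f (X ⊗ Z) := by
  have h := congrArg (fun t => ((ρ_ X).inv ▷ Z) ≫ t ▷ Z ≫ ((α_ D X Z).hom)) (BraidedCategory.braiding_naturality_right X f)
  simpa [op01, op22, -BraidedCategory.braiding_naturality_right,
    -BraidedCategory.braiding_naturality_left] using h

theorem bra_op01_right {D : C} (f : 𝟙_ C ⟶ D) (X Z : C) :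
    op01 f (X ⊗ Z) ≫ bra D X Z =
      X ◁ op01 f Z := by
  have h := congrArg (fun t => ((λ_ X).inv ▷ Z) ≫ t ▷ Z ≫ ((α_ X D Z).hom)) (BraidedCategory.braiding_naturality_left f X)
  simpa [op01, op22, -BraidedCategory.braiding_naturality_right,
    -BraidedCategory.braiding_naturality_left] using h

/-- Naturality of the braiding, with the crossing past `D ⊗ E` split by the hexagon identity into
two elementary crossings. -/
theorem bra_op02_left {D E : C} (f : 𝟙_ C ⟶ D ⊗ E) (X Z : C) :
    X ◁ op02 f Z ≫ bra X D (E ⊗ Z) ≫ D ◁ bra X E Z =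
      op02 f (X ⊗ Z) := by
  have h := congrArg (fun t => ((ρ_ X).inv ▷ Z) ≫ t ▷ Z ≫ ((α_ (D ⊗ E) X Z).hom ≫ (α_ D E (X ⊗ Z)).hom)) (BraidedCategory.braiding_naturality_right X f)
  simpa [op02, op22, -BraidedCategory.braiding_naturality_right,
    -BraidedCategory.braiding_naturality_left] using h

theorem bra_op02_right {D E : C} (f : 𝟙_ C ⟶ D ⊗ E) (X Z : C) :
    op02 f (X ⊗ Z) ≫ D ◁ bra E X Z ≫ bra D X (E ⊗ Z) =
      X ◁ op02 f Z := by
  have h := congrArg (fun t => ((λ_ X).inv ▷ Z) ≫ t ▷ Z ≫ ((α_ X (D ⊗ E) Z).hom ≫ X ◁ (α_ D E Z).hom)) (BraidedCategory.braiding_naturality_left f X)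
  simpa [op02, op22, -BraidedCategory.braiding_naturality_right,
    -BraidedCategory.braiding_naturality_left] using h

theorem bra_op20_left {A B : C} (f : A ⊗ B ⟶ 𝟙_ C) (X Z : C) :
    X ◁ op20 f Z =
      bra X A (B ⊗ Z) ≫ A ◁ bra X B Z ≫ op20 f (X ⊗ Z) := by
  have h := congrArg (fun t => (X ◁ (α_ A B Z).inv ≫ (α_ X (A ⊗ B) Z).inv) ≫ t ▷ Z ≫ ((λ_ X).hom ▷ Z)) (BraidedCategory.braiding_naturality_right X f)
  simpa [op20, op22, -BraidedCategory.braiding_naturality_right,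
    -BraidedCategory.braiding_naturality_left] using h

theorem bra_op20_right {A B : C} (f : A ⊗ B ⟶ 𝟙_ C) (X Z : C) :
    op20 f (X ⊗ Z) =
      A ◁ bra B X Z ≫ bra A X (B ⊗ Z) ≫ X ◁ op20 f Z := by
  have h := congrArg (fun t => ((α_ A B (X ⊗ Z)).inv ≫ (α_ (A ⊗ B) X Z).inv) ≫ t ▷ Z ≫ ((ρ_ X).hom ▷ Z)) (BraidedCategory.braiding_naturality_left f X)
  simpa [op20, op22, -BraidedCategory.braiding_naturality_right,
    -BraidedCategory.braiding_naturality_left] using h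

theorem bra_op21_left {A B D : C} (f : A ⊗ B ⟶ D) (X Z : C) :
    X ◁ op21 f Z ≫ bra X D Z =
      bra X A (B ⊗ Z) ≫ A ◁ bra X B Z ≫ op21 f (X ⊗ Z) := by
  have h := congrArg (fun t => (X ◁ (α_ A B Z).inv ≫ (α_ X (A ⊗ B) Z).inv) ≫ t ▷ Z ≫ ((α_ D X Z).hom)) (BraidedCategory.braiding_naturality_right X f)
  simpa [op21, op22, -BraidedCategory.braiding_naturality_right,
    -BraidedCategory.braiding_naturality_left] using h

theorem bra_op21_right {A B D : C} (f : A ⊗ B ⟶ D) (X Z : C) :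
    op21 f (X ⊗ Z) ≫ bra D X Z =
      A ◁ bra B X Z ≫ bra A X (B ⊗ Z) ≫ X ◁ op21 f Z := by
  have h := congrArg (fun t => ((α_ A B (X ⊗ Z)).inv ≫ (α_ (A ⊗ B) X Z).inv) ≫ t ▷ Z ≫ ((α_ X D Z).hom)) (BraidedCategory.braiding_naturality_left f X)
  simpa [op21, op22, -BraidedCategory.braiding_naturality_right,
    -BraidedCategory.braiding_naturality_left] using h

theorem bra_op12_left {A D E : C} (f : A ⟶ D ⊗ E) (X Z : C) :
    X ◁ op12 f Z ≫ bra X D (E ⊗ Z) ≫ D ◁ bra X E Z =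
      bra X A Z ≫ op12 f (X ⊗ Z) := by
  have h := congrArg (fun t => ((α_ X A Z).inv) ≫ t ▷ Z ≫ ((α_ (D ⊗ E) X Z).hom ≫ (α_ D E (X ⊗ Z)).hom)) (BraidedCategory.braiding_naturality_right X f)
  simpa [op12, op22, -BraidedCategory.braiding_naturality_right,
    -BraidedCategory.braiding_naturality_left] using h

theorem bra_op12_right {A D E : C} (f : A ⟶ D ⊗ E) (X Z : C) :
    op12 f (X ⊗ Z) ≫ D ◁ bra E X Z ≫ bra D X (E ⊗ Z) =
      bra A X Z ≫ X ◁ op12 f Z := by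
  have h := congrArg (fun t => ((α_ A X Z).inv) ≫ t ▷ Z ≫ ((α_ X (D ⊗ E) Z).hom ≫ X ◁ (α_ D E Z).hom)) (BraidedCategory.braiding_naturality_left f X)
  simpa [op12, op22, -BraidedCategory.braiding_naturality_right,
    -BraidedCategory.braiding_naturality_left] using h

theorem bra_op22_left {A B D E : C} (f : A ⊗ B ⟶ D ⊗ E) (X Z : C) :
    X ◁ op22 f Z ≫ bra X D (E ⊗ Z) ≫ D ◁ bra X E Z =
      bra X A (B ⊗ Z) ≫ A ◁ bra X B Z ≫ op22 f (X ⊗ Z) := by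
  have h := congrArg (fun t => (X ◁ (α_ A B Z).inv ≫ (α_ X (A ⊗ B) Z).inv) ≫ t ▷ Z ≫ ((α_ (D ⊗ E) X Z).hom ≫ (α_ D E (X ⊗ Z)).hom)) (BraidedCategory.braiding_naturality_right X f)
  simpa [op22, op22, -BraidedCategory.braiding_naturality_right,
    -BraidedCategory.braiding_naturality_left] using h

/-- The inverse braiding is itself a braiding, so its rules are those above for `reverseBraiding`.
-/
theorem ibra_op11_left {A D : C} (f : A ⟶ D) (X Z : C) :
    X ◁ op11 f Z ≫ ibra X D Z =
      ibra X A Z ≫ op11 f (X ⊗ Z) := by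
  exact @bra_op11_left C _ _ (reverseBraiding C) _ _ f X Z

theorem ibra_op02_left {D E : C} (f : 𝟙_ C ⟶ D ⊗ E) (X Z : C) :
    X ◁ op02 f Z ≫ ibra X D (E ⊗ Z) ≫ D ◁ ibra X E Z =
      op02 f (X ⊗ Z) := by
  exact @bra_op02_left C _ _ (reverseBraiding C) _ _ f X Z

theorem ibra_op20_left {A B : C} (f : A ⊗ B ⟶ 𝟙_ C) (X Z : C) :
    X ◁ op20 f Z =
      ibra X A (B ⊗ Z) ≫ A ◁ ibra X B Z ≫ op20 f (X ⊗ Z) := by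
  exact @bra_op20_left C _ _ (reverseBraiding C) _ _ f X Z

theorem ibra_op20_right {A B : C} (f : A ⊗ B ⟶ 𝟙_ C) (X Z : C) :
    op20 f (X ⊗ Z) =
      A ◁ ibra B X Z ≫ ibra A X (B ⊗ Z) ≫ X ◁ op20 f Z := by
  exact @bra_op20_right C _ _ (reverseBraiding C) _ _ f X Z

theorem ibra_op21_right {A B D : C} (f : A ⊗ B ⟶ D) (X Z : C) :
    op21 f (X ⊗ Z) ≫ ibra D X Z =
      A ◁ ibra B X Z ≫ ibra A X (B ⊗ Z) ≫ X ◁ op21 f Z := by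
  exact @bra_op21_right C _ _ (reverseBraiding C) _ _ _ f X Z

theorem ibra_op12_left {A D E : C} (f : A ⟶ D ⊗ E) (X Z : C) :
    X ◁ op12 f Z ≫ ibra X D (E ⊗ Z) ≫ D ◁ ibra X E Z =
      ibra X A Z ≫ op12 f (X ⊗ Z) := by
  exact @bra_op12_left C _ _ (reverseBraiding C) _ _ _ f X Z

theorem ibra_op22_left {A B D E : C} (f : A ⊗ B ⟶ D ⊗ E) (X Z : C) :
    X ◁ op22 f Z ≫ ibra X D (E ⊗ Z) ≫ D ◁ ibra X E Z =
      ibra X A (B ⊗ Z) ≫ A ◁ ibra X B Z ≫ op22 f (X ⊗ Z) := by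
  exact @bra_op22_left C _ _ (reverseBraiding C) _ _ _ _ f X Z

end Braided

end Strand

/-! ### Faithfulness and functoriality of the strand operations. -/

namespace Strand

section Monoidal

variable {C : Type u₁} [Category.{v₁} C] [MonoidalCategory C]

/-- Taking the remaining strands to be the unit loses nothing up to unitors, so diagram identities
descend to the morphisms themselves. -/
theorem op20_ext {A B : C} {f g : A ⊗ B ⟶ 𝟙_ C} (h : op20 f (𝟙_ C) = op20 g (𝟙_ C)) : f = g := by
  simpa [op20, whiskerRight_id, -id_whiskerLeft] using h

theorem op02_ext {A B : C} {f g : 𝟙_ C ⟶ A ⊗ B} (h : op02 f (𝟙_ C) = op02 g (𝟙_ C)) : f = g := by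
  simpa [op02] using h

theorem op01_ext {A : C} {f g : 𝟙_ C ⟶ A} (h : op01 f (𝟙_ C) = op01 g (𝟙_ C)) : f = g := by
  simpa [op01] using h

theorem op10_ext {A : C} {f g : A ⟶ 𝟙_ C} (h : op10 f (𝟙_ C) = op10 g (𝟙_ C)) : f = g := by
  simpa [op10] using h

theorem op11_ext {A B : C} {f g : A ⟶ B} (h : op11 f (𝟙_ C) = op11 g (𝟙_ C)) : f = g := by
  simpa [op11] using h

theorem op21_ext {A B D : C} {f g : A ⊗ B ⟶ D} (h : op21 f (𝟙_ C) = op21 g (𝟙_ C)) : f = g := by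
  simpa [op21] using h

theorem op22_ext {A B D E : C} {f g : A ⊗ B ⟶ D ⊗ E} (h : op22 f (𝟙_ C) = op22 g (𝟙_ C)) :
    f = g := by
  simpa [op22] using h

theorem op22_comp {A B D E F G : C} (f : A ⊗ B ⟶ D ⊗ E) (g : D ⊗ E ⟶ F ⊗ G) (Z : C) :
    op22 (f ≫ g) Z = op22 f Z ≫ op22 g Z := by
  simp [op22]

theorem op22_comp_12 {A B D E F : C} (f : A ⊗ B ⟶ D) (g : D ⟶ E ⊗ F) (Z : C) :
    op22 (f ≫ g) Z = op21 f Z ≫ op12 g Z := by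
  simp [op22, op21, op12]

theorem op20_comp {A B D E : C} (f : A ⊗ B ⟶ D ⊗ E) (g : D ⊗ E ⟶ 𝟙_ C) (Z : C) :
    op20 (f ≫ g) Z = op22 f Z ≫ op20 g Z := by
  simp [op22, op20]

theorem op20_comp_10 {A B D : C} (f : A ⊗ B ⟶ D) (g : D ⟶ 𝟙_ C) (Z : C) :
    op20 (f ≫ g) Z = op21 f Z ≫ op10 g Z := by
  simp [op21, op20, op10]

theorem op10_comp {A D : C} (f : A ⟶ D) (g : D ⟶ 𝟙_ C) (Z : C) :
    op10 (f ≫ g) Z = op11 f Z ≫ op10 g Z := by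
  simp [op11, op10]

theorem op10_comp_20 {A D E : C} (f : A ⟶ D ⊗ E) (g : D ⊗ E ⟶ 𝟙_ C) (Z : C) :
    op10 (f ≫ g) Z = op12 f Z ≫ op20 g Z := by
  simp [op12, op10, op20]

theorem op01_comp {A D : C} (f : 𝟙_ C ⟶ A) (g : A ⟶ D) (Z : C) :
    op01 (f ≫ g) Z = op01 f Z ≫ op11 g Z := by
  simp [op11, op01]

theorem op01_comp_21 {A B D : C} (f : 𝟙_ C ⟶ A ⊗ B) (g : A ⊗ B ⟶ D) (Z : C) :
    op01 (f ≫ g) Z = op02 f Z ≫ op21 g Z := by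
  simp [op21, op01, op02]

theorem op02_comp {A B D E : C} (f : 𝟙_ C ⟶ A ⊗ B) (g : A ⊗ B ⟶ D ⊗ E) (Z : C) :
    op02 (f ≫ g) Z = op02 f Z ≫ op22 g Z := by
  simp [op22, op02]

theorem op02_comp_12 {A B D : C} (f : 𝟙_ C ⟶ D) (g : D ⟶ A ⊗ B) (Z : C) :
    op02 (f ≫ g) Z = op01 f Z ≫ op12 g Z := by
  simp [op12, op02, op01]

theorem op21_comp {A B D E F : C} (f : A ⊗ B ⟶ D ⊗ E) (g : D ⊗ E ⟶ F) (Z : C) :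
    op21 (f ≫ g) Z = op22 f Z ≫ op21 g Z := by
  simp [op22, op21]

theorem op21_comp_11 {A B D E : C} (f : A ⊗ B ⟶ D) (g : D ⟶ E) (Z : C) :
    op21 (f ≫ g) Z = op21 f Z ≫ op11 g Z := by
  simp [op11, op21]

theorem op12_comp {A B D E F : C} (f : F ⟶ A ⊗ B) (g : A ⊗ B ⟶ D ⊗ E) (Z : C) :
    op12 (f ≫ g) Z = op12 f Z ≫ op22 g Z := by
  simp [op22, op12]

theorem op12_comp_11 {A B D E : C} (f : D ⟶ E) (g : E ⟶ A ⊗ B) (Z : C) :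
    op12 (f ≫ g) Z = op11 f Z ≫ op12 g Z := by
  simp [op11, op12]

theorem op11_comp_21 {A B D E : C} (f : D ⟶ A ⊗ B) (g : A ⊗ B ⟶ E) (Z : C) :
    op11 (f ≫ g) Z = op12 f Z ≫ op21 g Z := by
  simp [op11, op12, op21]

theorem op22_whiskerRight {A D : C} (f : A ⟶ D) (B Z : C) :
    op22 (f ▷ B) Z = op11 f (B ⊗ Z) := by
  simp [op22, op11]

theorem op22_whiskerLeft {B D : C} (A : C) (f : B ⟶ D) (Z : C) :
    op22 (A ◁ f) Z = A ◁ op11 f Z := by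
  simp [op22, op11]

theorem op22_tensorHom {A B D E : C} (f : A ⟶ D) (g : B ⟶ E) (Z : C) :
    op22 (f ⊗ₘ g) Z = op11 f (B ⊗ Z) ≫ D ◁ op11 g Z := by
  rw [MonoidalCategory.tensorHom_def, op22_comp, op22_whiskerRight, op22_whiskerLeft]

theorem op11_bend {M N P : C} (b : M ⊗ N ⟶ 𝟙_ C) (q : 𝟙_ C ⟶ N ⊗ P) (Z : C) :
    op11 ((ρ_ M).inv ≫ M ◁ q ≫ (α_ M N P).inv ≫ b ▷ P ≫ (λ_ P).hom) Z =
      M ◁ op02 q Z ≫ op20 b (P ⊗ Z) := by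
  simp [op11, op02, op20]

/-- `b : M ⊗ N ⟶ 𝟙` and `q : 𝟙 ⟶ N ⊗ M` satisfy the zigzag identities, stated as operations on
right-nested tensor products. -/
structure Zigzag {M N : C} (b : M ⊗ N ⟶ 𝟙_ C) (q : 𝟙_ C ⟶ N ⊗ M) : Prop where
  left (Z : C) : M ◁ op02 q Z ≫ op20 b (M ⊗ Z) = 𝟙 (M ⊗ Z)
  right (Z : C) : op02 q (N ⊗ Z) ≫ N ◁ op20 b Z = 𝟙 (N ⊗ Z)

theorem zigzag_of_exactPairing (X Y : C) [ExactPairing X Y] : Zigzag (ε_ X Y) (η_ X Y) where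
  left Z := by
    have h := congrArg (fun t => (ρ_ Y).inv ▷ Z ≫ t ▷ Z ≫ (λ_ Y).hom ▷ Z)
      (ExactPairing.coevaluation_evaluation X Y)
    simpa [op02, op20, -ExactPairing.coevaluation_evaluation] using h
  right Z := by
    have h := congrArg (fun t => (λ_ X).inv ▷ Z ≫ t ▷ Z ≫ (ρ_ X).hom ▷ Z)
      (ExactPairing.evaluation_coevaluation X Y)
    simpa [op02, op20, -ExactPairing.evaluation_coevaluation] using h

section Linear

variable {k : Type w₁} [Field k] [Preadditive C] [Linear k C] [MonoidalPreadditive C]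
  [MonoidalLinear k C]

theorem op11_smul (a : k) {A B : C} (f : A ⟶ B) (Z : C) : op11 (a • f) Z = a • op11 f Z := by
  simp [op11]

theorem op20_smul (a : k) {A B : C} (f : A ⊗ B ⟶ 𝟙_ C) (Z : C) :
    op20 (a • f) Z = a • op20 f Z := by
  simp [op20]

end Linear

end Monoidal

/-! ### Twists on products, caps and cups. -/

section Ribbon

open Ribbon

variable {C : Type u₁} [Category.{v₁} C] [MonoidalCategory C] [BraidedCategory C]

/-- The Yang–Baxter relation, as naturality of the braiding with respect to a braiding. -/
theorem bra_slide_bra (X Y V Z : C) :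
    bra X Y (V ⊗ Z) ≫ Y ◁ bra X V Z ≫ bra Y V (X ⊗ Z) =
      X ◁ bra Y V Z ≫ bra X V (Y ⊗ Z) ≫ V ◁ bra X Y Z :=
  (bra_op22_left (β_ Y V).hom X Z).symm

variable [RightRigidCategory C] [RibbonCategory C]

/-- The double braiding of the unit with itself is trivial, so naturality along the unitor gives `θ
= θ²`, and `θ` is invertible. -/
theorem twist_unit : (θ (𝟙_ C)).hom = 𝟙 (𝟙_ C) := by
  have h := RibbonCategory.twist_naturality (λ_ (𝟙_ C)).hom
  rw [RibbonCategory.twist_tensor] at h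
  have h2 : (λ_ (𝟙_ C)).hom ≫ (θ (𝟙_ C)).hom =
      (λ_ (𝟙_ C)).hom ≫ (θ (𝟙_ C)).hom ≫ (θ (𝟙_ C)).hom := by
    rw [h]
    simp [MonoidalCategory.tensorHom_def, ← unitors_equal, ← unitors_inv_equal]
  have h3 : (θ (𝟙_ C)).hom ≫ 𝟙 _ = (θ (𝟙_ C)).hom ≫ (θ (𝟙_ C)).hom := by
    rw [Category.comp_id]; exact (cancel_epi _).1 h2
  exact ((cancel_epi _).1 h3).symm

/-- The twist of the leftmost strand. -/
abbrev tw (X Z : C) : X ⊗ Z ⟶ X ⊗ Z := op11 (θ X).hom Z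

/-- The inverse twist of the leftmost strand. -/
abbrev itw (X Z : C) : X ⊗ Z ⟶ X ⊗ Z := op11 (θ X).inv Z

theorem tw_itw (X Z : C) : tw X Z ≫ itw X Z = 𝟙 _ := by
  simp [op11]

theorem itw_tw (X Z : C) : itw X Z ≫ tw X Z = 𝟙 _ := by
  simp [op11]

theorem op22_twist (X Y Z : C) : op22 (θ (X ⊗ Y)).hom Z =
    tw X (Y ⊗ Z) ≫ X ◁ tw Y Z ≫ bra X Y Z ≫ bra Y X Z := by
  rw [RibbonCategory.twist_tensor, op22_comp, op22_comp, op22_tensorHom, Category.assoc]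

theorem op21_tw {A B D : C} (f : A ⊗ B ⟶ D) (Z : C) :
    op21 f Z ≫ tw D Z = tw A (B ⊗ Z) ≫ A ◁ tw B Z ≫ bra A B Z ≫ bra B A Z ≫ op21 f Z := by
  rw [tw, ← op21_comp_11, RibbonCategory.twist_naturality, op21_comp, op22_twist]
  simp only [Category.assoc]

theorem op12_tw {A B D : C} (f : D ⟶ A ⊗ B) (Z : C) :
    op12 f Z ≫ tw A (B ⊗ Z) ≫ A ◁ tw B Z ≫ bra A B Z ≫ bra B A Z = tw D Z ≫ op12 f Z := by
  rw [tw, ← op12_comp_11, ← RibbonCategory.twist_naturality, op12_comp, op22_twist]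

/-- The twist of `A ⊗ B` slides through `f` to the unit, where it disappears. -/
theorem op20_tw {A B : C} (f : A ⊗ B ⟶ 𝟙_ C) (Z : C) :
    tw A (B ⊗ Z) ≫ A ◁ tw B Z ≫ bra A B Z ≫ bra B A Z ≫ op20 f Z = op20 f Z := by
  have h := RibbonCategory.twist_naturality f
  rw [show RibbonCategory.twist (𝟙_ C) = θ (𝟙_ C) from rfl, twist_unit, Category.comp_id] at h
  conv_rhs => rw [h, op20_comp, op22_twist]
  simp only [Category.assoc]

theorem op02_tw {A B : C} (f : 𝟙_ C ⟶ A ⊗ B) (Z : C) :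
    op02 f Z ≫ tw A (B ⊗ Z) ≫ A ◁ tw B Z ≫ bra A B Z ≫ bra B A Z = op02 f Z := by
  have h := RibbonCategory.twist_naturality f
  rw [show RibbonCategory.twist (𝟙_ C) = θ (𝟙_ C) from rfl, twist_unit, Category.id_comp] at h
  conv_rhs => rw [← h, op02_comp, op22_twist]

/-- Any pairing is the evaluation of `N` precomposed with some `g : M ⟶ Nᘁ`. The twist is natural
along `g`, and `θ` on the dual is the transpose of `θ`. Nondegeneracy is not needed. -/
theorem twist_cap {M N : C} (b : M ⊗ N ⟶ 𝟙_ C) :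
    (θ M).hom ▷ N ≫ b = M ◁ (θ N).hom ≫ b := by
  let g : M ⟶ Nᘁ := (ρ_ M).inv ≫ M ◁ η_ N (Nᘁ) ≫ (α_ M N (Nᘁ)).inv ≫ b ▷ (Nᘁ) ≫ (λ_ _).hom
  have hb : b = g ▷ N ≫ ε_ N (Nᘁ) := by
    apply op20_ext
    apply hom_ext_of_comp
    intro W t
    rw [op20_comp, op22_whiskerRight]
    rw [op11_bend]
    simp only [Category.assoc]
    rw [← op20_slide0, at1_2_0 ((zigzag_of_exactPairing N (Nᘁ)).right _)]
  have h2 : (θ (Nᘁ)).hom ▷ N ≫ ε_ N (Nᘁ) = Nᘁ ◁ (θ N).hom ≫ ε_ N (Nᘁ) := by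
    rw [show (θ (Nᘁ)).hom = ((θ N).hom)ᘁ from RibbonCategory.twist_dual N,
      rightAdjointMate_comp_evaluation]
  rw [hb, ← comp_whiskerRight_assoc, ← RibbonCategory.twist_naturality, comp_whiskerRight_assoc,
    h2, whisker_exchange_assoc]

theorem twist_cup {M N : C} (q : 𝟙_ C ⟶ M ⊗ N) :
    q ≫ (θ M).hom ▷ N = q ≫ M ◁ (θ N).hom := by
  let g : Mᘁ ⟶ N := (ρ_ (Mᘁ)).inv ≫ Mᘁ ◁ q ≫ (α_ (Mᘁ) M N).inv ≫ ε_ M (Mᘁ) ▷ N ≫ (λ_ _).hom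
  have hb : q = η_ M (Mᘁ) ≫ M ◁ g := by
    apply op02_ext
    apply hom_ext_of_comp
    intro W t
    rw [op02_comp, op22_whiskerLeft]
    rw [op11_bend]
    simp only [Category.assoc, MonoidalCategory.whiskerLeft_comp]
    rw [← op02_slide0, at0_2_0 ((zigzag_of_exactPairing M (Mᘁ)).right _)]
  have h2 : η_ M (Mᘁ) ≫ (θ M).hom ▷ (Mᘁ) = η_ M (Mᘁ) ≫ M ◁ (θ (Mᘁ)).hom := by
    rw [show (θ (Mᘁ)).hom = ((θ M).hom)ᘁ from RibbonCategory.twist_dual M,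
      coevaluation_comp_rightAdjointMate]
  rw [hb, Category.assoc, whisker_exchange, reassoc_of% h2, Category.assoc,
    ← MonoidalCategory.whiskerLeft_comp, ← MonoidalCategory.whiskerLeft_comp]
  rw [RibbonCategory.twist_naturality]

theorem tw_op20 {M N : C} (b : M ⊗ N ⟶ 𝟙_ C) (Z : C) :
    tw M (N ⊗ Z) ≫ op20 b Z = M ◁ tw N Z ≫ op20 b Z := by
  rw [tw, ← op22_whiskerRight, ← op20_comp, twist_cap, op20_comp, op22_whiskerLeft]

theorem itw_op20 {M N : C} (b : M ⊗ N ⟶ 𝟙_ C) (Z : C) :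
    itw M (N ⊗ Z) ≫ op20 b Z = M ◁ itw N Z ≫ op20 b Z := by
  have h : itw M (N ⊗ Z) ≫ M ◁ itw N Z ≫ tw M (N ⊗ Z) ≫ op20 b Z = M ◁ itw N Z ≫ op20 b Z := by
    rw [op11_slide0, at0_2_0 (itw_tw _ _)]
  rw [← h, tw_op20, at1_2_0 (itw_tw _ _)]

theorem op02_tw_left {M N : C} (q : 𝟙_ C ⟶ M ⊗ N) (Z : C) :
    op02 q Z ≫ tw M (N ⊗ Z) = op02 q Z ≫ M ◁ tw N Z := by
  rw [tw, ← op22_whiskerRight, ← op02_comp, twist_cup, op02_comp, op22_whiskerLeft]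

end Ribbon

end Strand

/-! ### Nondegenerate pairings and symmetric forms. -/

namespace Strand

section Zigzag

variable {C : Type u₁} [Category.{v₁} C] [MonoidalCategory C]

/-- Nondegeneracy as a cancellation rule: the copairing recovers `f` from its contraction with `M`.
-/
theorem Zigzag.ext_left {M N : C} {b : M ⊗ N ⟶ 𝟙_ C} {q : 𝟙_ C ⟶ N ⊗ M} (h : Zigzag b q)
    {Z W : C} {f g : W ⟶ N ⊗ Z} (e : M ◁ f ≫ op20 b Z = M ◁ g ≫ op20 b Z) : f = g := by
  have key : ∀ f : W ⟶ N ⊗ Z, f = op02 q W ≫ N ◁ (M ◁ f ≫ op20 b Z) := by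
    intro f
    rw [MonoidalCategory.whiskerLeft_comp, ← Category.assoc, ← op02_slide, Category.assoc,
      h.right, Category.comp_id]
  rw [key f, key g, e]

theorem Zigzag.cup_unique {M N : C} {b : M ⊗ N ⟶ 𝟙_ C} {q : 𝟙_ C ⟶ N ⊗ M} (h : Zigzag b q)
    {Z : C} {f : Z ⟶ N ⊗ M ⊗ Z} (e : M ◁ f ≫ op20 b (M ⊗ Z) = 𝟙 _) : f = op02 q Z :=
  h.ext_left (e.trans (h.left Z).symm)

theorem Zigzag.adjoint {M N : C} {b : M ⊗ N ⟶ 𝟙_ C} {q : 𝟙_ C ⟶ N ⊗ M} (h : Zigzag b q)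
    {f : M ⟶ M} {g : N ⟶ N}
    (e : ∀ Z, op11 f (N ⊗ Z) ≫ op20 b Z = M ◁ op11 g Z ≫ op20 b Z) (Z : C) :
    op02 q Z ≫ op11 g (M ⊗ Z) = op02 q Z ≫ N ◁ op11 f Z := by
  apply h.ext_left
  apply hom_ext_of_comp
  intro W t
  simp only [MonoidalCategory.whiskerLeft_comp, Category.assoc]
  rw [at0_2_2 (e _).symm, op11_slide0, at0_2_0 (h.left _), op20_slide0, at0_2_0 (h.left _)]

end Zigzag

section Form

variable {k : Type w₁} [Field k] {C : Type u₁} [Category.{v₁} C] [Preadditive C] [Linear k C]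
  [MonoidalCategory C] [MonoidalPreadditive C] [MonoidalLinear k C] [BraidedCategory C]
  [RightRigidCategory C] [RibbonCategory C]

open Ribbon

/-- A form is `ν`-symmetric if exchanging its arguments, with a twist, multiplies it by `ν`. -/
def IsSymm (ν : k) {M : C} (b : M ⊗ M ⟶ 𝟙_ C) : Prop :=
  b = ν • ((θ M).hom ▷ M ≫ (β_ M M).hom ≫ b)

variable {ν : k} {M : C} {b : M ⊗ M ⟶ 𝟙_ C}

theorem IsSymm.op20_eq (h : IsSymm ν b) (Z : C) :
    op20 b Z = ν • (tw M (M ⊗ Z) ≫ bra M M Z ≫ op20 b Z) := by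
  conv_lhs => rw [show b = _ from h]
  rw [op20_smul, op20_comp, op20_comp, op22_whiskerRight]

theorem IsSymm.ibra_cap (h : IsSymm ν b) (Z : C) :
    ibra M M Z ≫ op20 b Z = ν • (M ◁ tw M Z ≫ op20 b Z) := by
  conv_lhs => rw [h.op20_eq]
  rw [Linear.comp_smul]
  congr 1
  rw [at0_2_2 (ibra_op11_left (θ M).hom M Z).symm, at0_2_0 (ibra_bra M M Z)]

theorem IsSymm.bra_cap (h : IsSymm ν b) (Z : C) :
    ν • (bra M M Z ≫ op20 b Z) = itw M (M ⊗ Z) ≫ op20 b Z := by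
  conv_rhs => rw [h.op20_eq, Linear.comp_smul, at0_2_0 (itw_tw _ _)]

/-- Two applications of symmetry produce the full twist of `M ⊗ M`, which the cap absorbs. This
replaces `ν² = 1`, which need not hold when `b = 0`. -/
theorem IsSymm.smul_smul_cap (h : IsSymm ν b) (Z : C) : ν • ν • op20 b Z = op20 b Z := by
  have e : ν • ν • (tw M (M ⊗ Z) ≫ M ◁ tw M Z ≫ bra M M Z ≫ bra M M Z ≫ op20 b Z) =
      ν • (tw M (M ⊗ Z) ≫ bra M M Z ≫ op20 b Z) := by
    simp only [← Linear.comp_smul, h.bra_cap]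
    rw [at0_2_2 (bra_op11_left (θ M).inv M Z).symm, at1_2_0 (tw_itw _ _), ← h.bra_cap]
    simp only [Linear.comp_smul]
  rw [op20_tw] at e
  rw [e, ← h.op20_eq]

theorem IsSymm.cross_cap (h : IsSymm ν b) (Y Z : C) :
    ν • (M ◁ bra Y M Z ≫ M ◁ tw M (Y ⊗ Z) ≫ op20 b (Y ⊗ Z)) =
      ibra M Y (M ⊗ Z) ≫ Y ◁ ibra M M Z ≫ Y ◁ op20 b Z := by
  rw [bra_op20_left b Y Z, at0_3_3 (bra_op22_left (β_ M M).inv Y Z),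
    at0_2_0 (ibra_bra _ _ _), h.ibra_cap, Linear.comp_smul]

/-- The flipped and twisted copairing satisfies the same zigzag identity, and the copairing is
determined by it. -/
theorem IsSymm.cup_eq (h : IsSymm ν b) {q : 𝟙_ C ⟶ M ⊗ M} (hz : Zigzag b q) (Z : C) :
    op02 q Z = ν • (op02 q Z ≫ bra M M Z ≫ tw M (M ⊗ Z)) := by
  symm
  apply hz.cup_unique
  simp only [MonoidalLinear.whiskerLeft_smul, Linear.smul_comp, MonoidalCategory.whiskerLeft_comp,
    Category.assoc]
  rw [← Linear.comp_smul, h.cross_cap, at0_3_1 (ibra_op02_left q M Z), hz.right]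

end Form

end Strand

/-! ### Frobenius calculus of a Jandl algebra, and the second duality. -/

section

namespace JandlAlgebra

open Strand Ribbon

variable {k : Type w₁} [Field k] {C : Type u₁} [Category.{v₁} C] [Preadditive C] [Linear k C]
  [MonoidalCategory C] [BraidedCategory C]
  [RightRigidCategory C] [RibbonCategory C] (A : JandlAlgebra k C)

/-- The copairing `Δ ∘ η` of the Frobenius form. -/
def cup : 𝟙_ C ⟶ A.X ⊗ A.X := η[A.X] ≫ Δ[A.X]

/-- The Frobenius form `ε ∘ m`. -/
def cap : A.X ⊗ A.X ⟶ 𝟙_ C := μ[A.X] ≫ ε[A.X]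

/-- The inverse of the reversion. -/
def revInv : A.X ⟶ A.X := A.rev ≫ (θ A.X).inv

theorem rev_revInv : A.rev ≫ A.revInv = 𝟙 _ := by
  rw [revInv, ← Category.assoc, A.rev_rev, Iso.hom_inv_id]

theorem revInv_rev : A.revInv ≫ A.rev = 𝟙 _ := by
  have h : (θ A.X).inv ≫ A.rev = A.rev ≫ (θ A.X).inv := by
    rw [Iso.inv_comp_eq, ← Category.assoc, Iso.eq_comp_inv, RibbonCategory.twist_naturality]
  rw [revInv, Category.assoc, h, ← Category.assoc, A.rev_rev, Iso.hom_inv_id]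

theorem one_mul (Z : C) : op01 η[A.X] (A.X ⊗ Z) ≫ op21 μ[A.X] Z = 𝟙 _ := by
  have h := congrArg (fun t => (λ_ A.X).inv ▷ Z ≫ t ▷ Z) (MonObj.one_mul A.X)
  simpa [op01, op21, -MonObj.one_mul] using h

theorem mul_one (Z : C) : A.X ◁ op01 η[A.X] Z ≫ op21 μ[A.X] Z = 𝟙 _ := by
  have h := congrArg (fun t => (ρ_ A.X).inv ▷ Z ≫ t ▷ Z) (MonObj.mul_one A.X)
  simpa [op01, op21, -MonObj.mul_one] using h

theorem mul_assoc (Z : C) : op21 μ[A.X] (A.X ⊗ Z) ≫ op21 μ[A.X] Z =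
    A.X ◁ op21 μ[A.X] Z ≫ op21 μ[A.X] Z := by
  have h := congrArg (fun t => A.X ◁ (α_ A.X A.X Z).inv ≫ (α_ A.X (A.X ⊗ A.X) Z).inv ≫
    (α_ A.X A.X A.X).inv ▷ Z ≫ t ▷ Z) (MonObj.mul_assoc A.X)
  simpa [op21, -MonObj.mul_assoc] using h

theorem counit_left (Z : C) : op12 Δ[A.X] Z ≫ op10 ε[A.X] (A.X ⊗ Z) = 𝟙 _ := by
  have h := congrArg (fun t => t ▷ Z ≫ (λ_ A.X).hom ▷ Z) (ComonObj.counit_comul A.X)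
  simpa [op12, op10, -ComonObj.counit_comul] using h

theorem counit_right (Z : C) : op12 Δ[A.X] Z ≫ A.X ◁ op10 ε[A.X] Z = 𝟙 _ := by
  have h := congrArg (fun t => t ▷ Z ≫ (ρ_ A.X).hom ▷ Z) (ComonObj.comul_counit A.X)
  simpa [op12, op10, -ComonObj.comul_counit] using h

theorem comul_mul_left (Z : C) : op12 Δ[A.X] (A.X ⊗ Z) ≫ A.X ◁ op21 μ[A.X] Z =
    op21 μ[A.X] Z ≫ op12 Δ[A.X] Z := by
  have h := congrArg (fun t => (α_ _ _ _).inv ≫ t ▷ Z ≫ (α_ _ _ _).hom)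
    A.frobenius.comul_mul_left
  simpa [op21, op12] using h

theorem comul_mul_right (Z : C) : A.X ◁ op12 Δ[A.X] Z ≫ op21 μ[A.X] (A.X ⊗ Z) =
    op21 μ[A.X] Z ≫ op12 Δ[A.X] Z := by
  have h := congrArg (fun t => (α_ _ _ _).inv ≫ t ▷ Z ≫ (α_ _ _ _).hom)
    A.frobenius.comul_mul_right
  simpa [op21, op12] using h

theorem op02_cup (Z : C) : op02 A.cup Z = op01 η[A.X] Z ≫ op12 Δ[A.X] Z := op02_comp_12 _ _ _

theorem op20_cap (Z : C) : op20 A.cap Z = op21 μ[A.X] Z ≫ op10 ε[A.X] Z := op20_comp_10 _ _ _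

theorem cup_mul_left (Z : C) :
    op02 A.cup (A.X ⊗ Z) ≫ A.X ◁ op21 μ[A.X] Z = op12 Δ[A.X] Z := by
  rw [op02_cup, Category.assoc, A.comul_mul_left, ← Category.assoc, A.one_mul, Category.id_comp]

theorem cup_mul_right (Z : C) :
    A.X ◁ op02 A.cup Z ≫ op21 μ[A.X] (A.X ⊗ Z) = op12 Δ[A.X] Z := by
  rw [op02_cup, MonoidalCategory.whiskerLeft_comp, Category.assoc, A.comul_mul_right,
    ← Category.assoc, A.mul_one, Category.id_comp]

/-- The copairing is central. -/
theorem cup_central (Z : C) : A.X ◁ op02 A.cup Z ≫ op21 μ[A.X] (A.X ⊗ Z) =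
    op02 A.cup (A.X ⊗ Z) ≫ A.X ◁ op21 μ[A.X] Z :=
  (A.cup_mul_right Z).trans (A.cup_mul_left Z).symm

/-- The normalization `m ∘ Δ = id` makes `κ₁κ₂ = 1`. With centrality, `κ` is a separability
idempotent, which makes the balancing operators idempotent. -/
theorem cup_mul (Z : C) : op02 A.cup Z ≫ op21 μ[A.X] Z = op01 η[A.X] Z := by
  rw [← op01_comp_21, cup, Category.assoc, A.normalized, Category.comp_id]

theorem zigzag : Zigzag A.cap A.cup where
  left Z := by
    rw [op20_cap, ← Category.assoc, A.cup_mul_right, A.counit_left]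
  right Z := by
    rw [op20_cap, MonoidalCategory.whiskerLeft_comp, ← Category.assoc, A.cup_mul_left,
      A.counit_right]

theorem op11_frobMap (Z : C) : op11 (frobMap A.X) Z =
    A.X ◁ op02 (η_ A.X (A.Xᘁ)) Z ≫ op20 A.cap (A.Xᘁ ⊗ Z) :=
  op11_bend _ _ _

theorem op11_frobMap' (Z : C) : op11 (frobMap' A.X) Z =
    op02 (coevR A.X) (A.X ⊗ Z) ≫ A.Xᘁ ◁ op20 A.cap Z := by
  simp [op11, frobMap', op02, op20, cap]

theorem op11_rev_rev (Z : C) : op11 A.rev Z ≫ op11 A.rev Z = tw A.X Z := by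
  rw [← op11_comp, A.rev_rev]

theorem op11_rev_revInv (Z : C) : op11 A.rev Z ≫ op11 A.revInv Z = 𝟙 _ := by
  rw [← op11_comp, A.rev_revInv, op11_id]

theorem op11_revInv_rev (Z : C) : op11 A.revInv Z ≫ op11 A.rev Z = 𝟙 _ := by
  rw [← op11_comp, A.revInv_rev, op11_id]

theorem op21_mul_rev (Z : C) : op21 μ[A.X] Z ≫ op11 A.rev Z =
    op11 A.rev (A.X ⊗ Z) ≫ A.X ◁ op11 A.rev Z ≫ bra A.X A.X Z ≫ op21 μ[A.X] Z := by
  rw [← op21_comp_11, A.mul_rev, op21_comp, op21_comp, op22_tensorHom, Category.assoc]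

theorem op01_unit_rev (Z : C) : op01 η[A.X] Z ≫ op11 A.rev Z = op01 η[A.X] Z := by
  rw [← op01_comp, A.unit_rev]

end JandlAlgebra

namespace Strand

open Ribbon

variable {C : Type u₁} [Category.{v₁} C] [MonoidalCategory C] [BraidedCategory C]
  [RightRigidCategory C] [RibbonCategory C]

theorem op20_evalR (M Z : C) :
    op20 (evalR M) Z = tw M (Mᘁ ⊗ Z) ≫ bra M (Mᘁ) Z ≫ op20 (ε_ M (Mᘁ)) Z := by
  rw [evalR, op20_comp, op20_comp, op22_whiskerRight]

theorem op02_coevR (M Z : C) :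
    op02 (coevR M) Z = op02 (η_ M (Mᘁ)) Z ≫ bra M (Mᘁ) Z ≫ Mᘁ ◁ tw M Z := by
  rw [coevR, op02_comp, op22_comp, op22_whiskerLeft]

/-- The coevaluation absorbs the full twist of `M ⊗ Mᘁ`, so braiding and twist may be traded for
their inverses. -/
theorem op02_coevR' (M Z : C) :
    op02 (coevR M) Z = op02 (η_ M (Mᘁ)) Z ≫ ibra M (Mᘁ) Z ≫ Mᘁ ◁ itw M Z := by
  have h := op02_tw (η_ M (Mᘁ)) Z =≫ (ibra M (Mᘁ) Z ≫ Mᘁ ◁ itw M Z)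
  simp only [Category.assoc] at h
  rw [← h, at0_2_0 (bra_ibra _ _ _), at0_2_2 (op11_slide (θ M).hom (tw (Mᘁ) Z)).symm,
    at0_2_2 (op02_tw_left _ _).symm, at0_2_2 (bra_op11_right _ _ _), op02_coevR,
    at0_2_2 (bra_op11_right _ _ _),
    ← MonoidalCategory.whiskerLeft_comp, tw_itw, MonoidalCategory.whiskerLeft_id, Category.comp_id]

theorem ibra_bra_cap {M N : C} (b : N ⊗ M ⟶ 𝟙_ C) (Y Z : C) :
    M ◁ ibra Y N Z ≫ bra M N (Y ⊗ Z) ≫ op20 b (Y ⊗ Z) =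
      bra M Y (N ⊗ Z) ≫ Y ◁ bra M N Z ≫ Y ◁ op20 b Z := by
  rw [ibra_op20_left b Y Z, at0_3_3 (bra_op22_left (β_ N Y).inv M Z).symm,
    at1_2_0 (bra_ibra M Y Z)]

theorem cup_ibra_bra {A B : C} (q : 𝟙_ C ⟶ A ⊗ B) (Y Z : C) :
    op02 q (Y ⊗ Z) ≫ ibra A B (Y ⊗ Z) ≫ B ◁ bra A Y Z =
      Y ◁ op02 q Z ≫ Y ◁ ibra A B Z ≫ ibra Y B (A ⊗ Z) := by
  rw [← ibra_op02_left q Y Z]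
  simp only [Category.assoc]
  rw [at0_3_3 (ibra_op22_left (β_ B A).inv Y Z).symm,
    ← MonoidalCategory.whiskerLeft_comp, ibra_bra]
  simp

/-- The cap is unfolded with the braiding and the cup with its inverse, so that the crossings cancel
and the first duality remains. -/
theorem zigzag_right (M : C) : Zigzag (evalR M) (coevR M) where
  left Z := by
    apply hom_ext_of_comp
    intro W t
    rw [op20_evalR, op02_coevR']
    simp only [MonoidalCategory.whiskerLeft_comp, Category.assoc]
    simp only [op11_slide0, op22_slide0, op20_slide0]
    rw [at0_3_3 (ibra_bra_cap (ε_ M (Mᘁ)) M Z), at0_3_1 (bra_op02_left (η_ M (Mᘁ)) M Z),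
      at0_2_0 ((zigzag_of_exactPairing M (Mᘁ)).right Z), at0_2_0 (tw_itw _ _), Category.id_comp]
  right Z := by
    apply hom_ext_of_comp
    intro W t
    rw [op20_evalR, op02_coevR']
    simp only [MonoidalCategory.whiskerLeft_comp, Category.assoc]
    rw [at1_2_0 (itw_tw _ _), at0_3_3 (cup_ibra_bra _ _ _),
      at0_3_1 (ibra_op20_right (ε_ M (Mᘁ)) (Mᘁ) Z).symm,
      at0_2_0 ((zigzag_of_exactPairing M (Mᘁ)).left _), Category.id_comp]

end Strand

end

/-! ### Symmetry of the Frobenius form and invariance of the counit. -/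

section

namespace JandlAlgebra

open Strand Ribbon

variable {k : Type w₁} [Field k] {C : Type u₁} [Category.{v₁} C] [Preadditive C] [Linear k C]
  [MonoidalCategory C] [BraidedCategory C]
  [RightRigidCategory C] [RibbonCategory C] (A : JandlAlgebra k C)

theorem frobMap_cap (Z : C) :
    op11 (frobMap A.X) (A.X ⊗ Z) ≫ op20 (ε_ A.X (A.Xᘁ)) Z = op20 A.cap Z := by
  apply hom_ext_of_comp
  intro W t
  rw [op11_frobMap]
  simp only [Category.assoc]
  rw [at0_2_2 (op20_slide A.cap (op20 (ε_ A.X (A.Xᘁ)) Z)).symm,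
    at1_2_0 ((zigzag_of_exactPairing A.X (A.Xᘁ)).right Z)]

theorem frobMap'_cap (Z : C) :
    A.X ◁ op11 (frobMap' A.X) Z ≫ op20 (evalR A.X) Z = op20 A.cap Z := by
  apply hom_ext_of_comp
  intro W t
  rw [op11_frobMap']
  simp only [Category.assoc, MonoidalCategory.whiskerLeft_comp, op20_slide0]
  rw [at0_2_0 ((zigzag_right A.X).left _)]

/-- Both Frobenius maps recover `ε ∘ m`, one through each evaluation. Their equality compares the
two evaluations, which differ by a crossing and a twist. -/
theorem bra_cap' (Z : C) : tw A.X (A.X ⊗ Z) ≫ bra A.X A.X Z ≫ op20 A.cap Z = op20 A.cap Z := by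
  conv_rhs => rw [← A.frobMap'_cap, op20_evalR, ← A.symmetric]
  rw [at0_2_2 (op11_slide (θ A.X).hom (op11 (frobMap A.X) Z)),
    at0_2_2 (bra_op11_left (frobMap A.X) A.X Z), A.frobMap_cap]

theorem isSymm_cap : IsSymm (1 : k) A.cap := by
  apply op20_ext
  rw [one_smul, op20_comp, op20_comp, op22_whiskerRight, A.bra_cap']

theorem cap_assoc (Z : C) : op21 μ[A.X] (A.X ⊗ Z) ≫ op20 A.cap Z =
    A.X ◁ op21 μ[A.X] Z ≫ op20 A.cap Z := by
  rw [op20_cap, at0_2_2 (A.mul_assoc Z)]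

theorem op01_tw (f : 𝟙_ C ⟶ A.X) (Z : C) : op01 f Z ≫ tw A.X Z = op01 f Z := by
  rw [tw, ← op01_comp, RibbonCategory.twist_naturality,
    show RibbonCategory.twist (𝟙_ C) = θ (𝟙_ C) from rfl, twist_unit, Category.id_comp]

theorem op11_itw {X Y : C} (f : X ⟶ Y) (Z : C) : op11 f Z ≫ itw Y Z = itw X Z ≫ op11 f Z := by
  rw [itw, itw, ← op11_comp, ← op11_comp]
  congr 1
  rw [Iso.comp_inv_eq, Category.assoc, RibbonCategory.twist_naturality, Iso.inv_hom_id_assoc]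

theorem bra_cap_itw (Z : C) : bra A.X A.X Z ≫ op20 A.cap Z = itw A.X (A.X ⊗ Z) ≫ op20 A.cap Z := by
  conv_rhs => rw [← A.bra_cap', at0_2_0 (itw_tw _ _)]

section Trace

variable (t : A.X ⟶ 𝟙_ C)

/-- The element that represents the functional `t` with respect to the Frobenius form. -/
def density : 𝟙_ C ⟶ A.X := A.cup ≫ A.X ◁ t ≫ (ρ_ A.X).hom

theorem op01_density (Z : C) : op01 (A.density t) Z = op02 A.cup Z ≫ A.X ◁ op10 t Z := by
  simp [density, op01, op02, op10]

theorem density_cap (Z : C) : A.X ◁ op01 (A.density t) Z ≫ op20 A.cap Z = op10 t Z := by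
  apply hom_ext_of_comp
  intro W s
  rw [op01_density]
  simp only [Category.assoc, MonoidalCategory.whiskerLeft_comp, op20_slide0]
  rw [at0_2_0 (A.zigzag.left _)]

theorem cap_density (Z : C) : op01 (A.density t) (A.X ⊗ Z) ≫ op20 A.cap Z = op10 t Z := by
  rw [← A.bra_cap', at0_2_1 (A.op01_tw _ _), at0_2_1 (bra_op01_right (A.density t) A.X Z),
    A.density_cap]

/-- Pairing both products with a test element turns them, by associativity and symmetry of `ε ∘ m`,
into the two sides of `ht`. Nondegeneracy then cancels the test element. -/
theorem density_central
    (ht : ∀ Z, tw A.X (A.X ⊗ Z) ≫ bra A.X A.X Z ≫ op21 μ[A.X] Z ≫ op10 t Z =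
      op21 μ[A.X] Z ≫ op10 t Z) (Z : C) :
    op01 (A.density t) (A.X ⊗ Z) ≫ op21 μ[A.X] Z =
      A.X ◁ op01 (A.density t) Z ≫ op21 μ[A.X] Z := by
  apply A.zigzag.ext_left
  apply hom_ext_of_comp
  intro W s
  simp only [Category.assoc, MonoidalCategory.whiskerLeft_comp]
  conv_rhs => rw [at0_2_2 (A.cap_assoc Z).symm, op21_slide0, at0_2_1 (A.density_cap t Z)]
  rw [at0_1_3 (A.bra_cap' Z).symm]
  simp only [op11_slide0]
  rw [at0_2_3 (bra_op21_left μ[A.X] A.X Z), at0_2_1 (bra_op01_left (A.density t) A.X _),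
    at0_2_2 (A.cap_assoc Z), at0_2_2 (op01_slide (A.density t) (bra A.X A.X Z)).symm,
    at0_2_2 (op01_slide (A.density t) (op21 μ[A.X] Z)).symm, at0_2_1 (A.cap_density t Z),
    at0_4_2 (ht Z)]

end Trace

theorem rev_cap (Z : C) : op21 μ[A.X] Z ≫ op11 A.rev Z ≫ op10 ε[A.X] Z =
    op11 A.revInv (A.X ⊗ Z) ≫ A.X ◁ op11 A.rev Z ≫ op20 A.cap Z := by
  rw [at0_2_4 (A.op21_mul_rev Z), ← A.op20_cap]
  rw [A.bra_cap_itw, at0_2_2 (op11_slide (θ A.X).inv (op11 A.rev Z)), revInv, op11_comp, Category.assoc]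

theorem op11_revInv (Z : C) : op11 A.revInv Z = op11 A.rev Z ≫ itw A.X Z := op11_comp _ _ _

variable [MonoidalPreadditive C] [MonoidalLinear k C]

theorem cup_bra (Z : C) : op02 A.cup Z ≫ bra A.X A.X Z = op02 A.cup Z ≫ itw A.X (A.X ⊗ Z) := by
  conv_rhs => rw [A.isSymm_cap.cup_eq A.zigzag, one_smul, Category.assoc, Category.assoc, tw_itw,
    Category.comp_id]

theorem cup_rev_mul (Z : C) : op02 A.cup Z ≫ op11 A.revInv (A.X ⊗ Z) ≫ A.X ◁ op11 A.rev Z ≫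
    op21 μ[A.X] Z = op01 η[A.X] Z := by
  rw [← A.op01_unit_rev, ← A.cup_mul, Category.assoc, A.op21_mul_rev,
    at0_2_2 (op11_slide A.rev (op11 A.rev Z)).symm, at0_2_2 (bra_op11_right A.rev A.X Z),
    at0_2_2 (bra_op11_left A.rev A.X Z), at0_2_2 (A.cup_bra Z), op11_revInv]
  simp only [Category.assoc]
  rw [at0_2_2 (op11_itw A.rev _)]

theorem rev_counit_symm (Z : C) : tw A.X (A.X ⊗ Z) ≫ bra A.X A.X Z ≫ op21 μ[A.X] Z ≫
    op10 (A.rev ≫ ε[A.X]) Z = op21 μ[A.X] Z ≫ op10 (A.rev ≫ ε[A.X]) Z := by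
  rw [op10_comp, A.rev_cap, at0_2_2 (bra_op11_left A.revInv A.X Z).symm,
    at0_2_2 (bra_op11_right A.rev A.X Z).symm, A.bra_cap_itw, at0_2_2 (op11_itw A.rev _),
    at0_2_2 (op11_slide (θ A.X).hom (op11 A.revInv Z)).symm,
    at0_2_0 (tw_itw _ _), op11_revInv, op11_revInv, MonoidalCategory.whiskerLeft_comp,
    Category.assoc, Category.assoc, op11_slide0, op11_slide0,
    at0_2_2 (op11_slide (θ A.X).inv (op11 A.rev Z)).symm, itw_op20]

/-- Let `z` represent `ε ∘ σ`. Twisting the two legs of `κ` by `σ⁻¹` and `σ` and inserting `z`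
returns `κ`. Multiplying the legs together then forces `z = 1`. -/
theorem density_rev : A.density (A.rev ≫ ε[A.X]) = η[A.X] := by
  -- `σ⁻¹(κ₁)z ⊗ σ(κ₂)` is again the copairing: contracted with `x` it gives `εσ(xσ⁻¹(κ₁)) σ(κ₂)`,
  -- and this is `σσ⁻¹(x) = x`.
  have h : ∀ Z, op02 A.cup Z ≫ op11 A.revInv (A.X ⊗ Z) ≫ A.X ◁ op01 (A.density (A.rev ≫ ε[A.X])) _
      ≫ op21 μ[A.X] _ ≫ A.X ◁ op11 A.rev Z = op02 A.cup Z := by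
    intro Z
    apply A.zigzag.cup_unique
    apply hom_ext_of_comp
    intro W s
    simp only [Category.assoc, MonoidalCategory.whiskerLeft_comp, op20_slide0]
    rw [at0_2_2 (A.cap_assoc _).symm, op21_slide0, at0_2_1 (A.density_cap _ _), op10_comp,
      Category.assoc, at0_3_3 (A.rev_cap _), op11_slide0, at1_2_0 (A.op11_revInv_rev _),
      op11_slide0, at0_2_0 (A.zigzag.left _), at0_2_0 (A.op11_revInv_rev _), Category.id_comp]
  apply op01_ext
  apply hom_ext_of_comp
  intro W s
  -- Since `z` is central, the product of the legs is `z σ⁻¹(κ₁)σ(κ₂) = z`, whereas `κ₁κ₂ = 1`.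
  have h2 := h (𝟙_ C) =≫ (op21 μ[A.X] (𝟙_ C) ≫ s)
  simp only [Category.assoc] at h2
  rw [at0_2_1 (A.cup_mul _), at0_2_2 (A.density_central _ A.rev_counit_symm _).symm,
    at0_2_2 (op21_slide μ[A.X] (op11 A.rev _)).symm, at0_2_2 (A.mul_assoc _), op01_slide0,
    op01_slide0, at1_4_1 (A.cup_rev_mul _), at0_2_0 (A.mul_one _)] at h2
  exact h2

theorem rev_counit : A.rev ≫ ε[A.X] = ε[A.X] := by
  apply op10_ext
  rw [← A.density_cap, A.density_rev, op20_cap, ← Category.assoc, A.mul_one, Category.id_comp]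

theorem rev_adjoint (Z : C) :
    op11 A.rev (A.X ⊗ Z) ≫ op20 A.cap Z = A.X ◁ op11 A.rev Z ≫ op20 A.cap Z := by
  have h := A.rev_cap Z
  rw [← op10_comp, A.rev_counit, ← A.op20_cap] at h
  conv_lhs => rw [h, at0_2_0 (A.op11_rev_revInv _)]

theorem cup_rev (Z : C) :
    op02 A.cup Z ≫ op11 A.rev (A.X ⊗ Z) = op02 A.cup Z ≫ A.X ◁ op11 A.rev Z :=
  A.zigzag.adjoint A.rev_adjoint Z

end JandlAlgebra

end

/-! ### Reversals and the bimodule structures on their module. -/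

section

open Strand Ribbon

variable {k : Type w₁} [Field k] {C : Type u₁} [Category.{v₁} C] [Preadditive C] [Linear k C]
  [MonoidalCategory C] [BraidedCategory C] [RightRigidCategory C] [RibbonCategory C]

namespace JandlAlgebra

/-- The right action `ρ ∘ c ∘ (id ⊗ σ)` on a left module of a Jandl algebra. -/
def rightAct (A : JandlAlgebra k C) {M : C} (act : A.X ⊗ M ⟶ M) : M ⊗ A.X ⟶ M :=
  M ◁ A.rev ≫ (β_ M A.X).hom ≫ act

theorem op21_rightAct (A : JandlAlgebra k C) {M : C} (act : A.X ⊗ M ⟶ M) (Z : C) :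
    op21 (A.rightAct act) Z = M ◁ op11 A.rev Z ≫ bra M A.X Z ≫ op21 act Z := by
  rw [rightAct, op21_comp, op21_comp, op22_whiskerLeft]

end JandlAlgebra

/-- A left `A`-module `M` with a nondegenerate balanced symmetric form, together with an
identification of `B` with the Jandl algebra `M ⊗_A M` of the form. -/
structure Reversal (A B : JandlAlgebra k C) where
  /-- the module -/
  M : C
  /-- the action -/
  act : A.X ⊗ M ⟶ M
  /-- the form -/
  form : M ⊗ M ⟶ 𝟙_ C
  /-- the copairing of the form -/
  coform : 𝟙_ C ⟶ M ⊗ M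
  /-- the sign of the form -/
  ν : k
  /-- the inclusion of `B` -/
  incl : B.X ⟶ M ⊗ M
  /-- the projection to `B` -/
  proj : M ⊗ M ⟶ B.X
  one_act (Z : C) : op01 η[A.X] (M ⊗ Z) ≫ op21 act Z = 𝟙 _
  mul_act (Z : C) : op21 μ[A.X] (M ⊗ Z) ≫ op21 act Z = A.X ◁ op21 act Z ≫ op21 act Z
  zigzag : Zigzag form coform
  symm : IsSymm ν form
  balanced (Z : C) : op21 (A.rightAct act) (M ⊗ Z) ≫ op20 form Z = M ◁ op21 act Z ≫ op20 form Z
  incl_proj (Z : C) : op12 incl Z ≫ op21 proj Z = 𝟙 _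
  proj_incl (Z : C) : op21 proj Z ≫ op12 incl Z =
    M ◁ op02 A.cup (M ⊗ Z) ≫ op21 (A.rightAct act) (A.X ⊗ M ⊗ Z) ≫ M ◁ op21 act Z
  unit (Z : C) : op01 η[B.X] Z = op02 coform Z ≫ op21 proj Z
  mul (Z : C) : op21 μ[B.X] Z = op12 incl (B.X ⊗ Z) ≫ M ◁ M ◁ op12 incl Z ≫
    M ◁ op20 form (M ⊗ Z) ≫ op21 proj Z
  rev (Z : C) : op11 B.rev Z =
    ν • (op12 incl Z ≫ bra M M Z ≫ tw M (M ⊗ Z) ≫ op21 proj Z)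

namespace Reversal

variable {A B : JandlAlgebra k C} (R : Reversal A B)

/-- The right action of `A`. -/
def ract : R.M ⊗ A.X ⟶ R.M := A.rightAct R.act

theorem op21_ract (Z : C) :
    op21 R.ract Z = R.M ◁ op11 A.rev Z ≫ bra R.M A.X Z ≫ op21 R.act Z :=
  A.op21_rightAct R.act Z

theorem form_balanced (Z : C) :
    op21 R.ract (R.M ⊗ Z) ≫ op20 R.form Z = R.M ◁ op21 R.act Z ≫ op20 R.form Z :=
  R.balanced Z

theorem balance_eq (Z : C) : op21 R.proj Z ≫ op12 R.incl Z =
    R.M ◁ op02 A.cup (R.M ⊗ Z) ≫ op21 R.ract (A.X ⊗ R.M ⊗ Z) ≫ R.M ◁ op21 R.act Z :=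
  R.proj_incl Z

theorem ract_one (Z : C) : R.M ◁ op01 η[A.X] Z ≫ op21 R.ract Z = 𝟙 _ := by
  rw [op21_ract, at1_2_1 (A.op01_unit_rev Z), at0_2_1 (bra_op01_left η[A.X] R.M Z), R.one_act]

theorem ract_ract (Z : C) : op21 R.ract (A.X ⊗ Z) ≫ op21 R.ract Z =
    R.M ◁ op21 μ[A.X] Z ≫ op21 R.ract Z := by
  apply hom_ext_of_comp
  intro W s
  simp only [op21_ract, Category.assoc]
  conv_rhs => rw [at1_2_4 (A.op21_mul_rev Z), at0_2_3 (bra_op21_left μ[A.X] R.M Z),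
    at0_3_3 (bra_slide_bra R.M A.X A.X Z).symm, at0_2_2 (R.mul_act Z)]
  rw [at0_2_2 (op21_slide R.act (op11 A.rev Z)).symm, at0_2_3 (bra_op21_right R.act A.X Z),
    at0_2_2 (op22_slide (β_ R.M A.X).hom (op11 A.rev Z)).symm]

theorem act_coform (Z : C) : A.X ◁ op02 R.coform Z ≫ op21 R.act (R.M ⊗ Z) =
    op02 R.coform (A.X ⊗ Z) ≫ R.M ◁ op21 R.ract Z := by
  apply R.zigzag.ext_left
  apply hom_ext_of_comp
  intro W s
  simp only [MonoidalCategory.whiskerLeft_comp, Category.assoc]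
  rw [at0_2_2 (R.form_balanced _).symm, op21_slide0, at0_2_0 (R.zigzag.left _), op20_slide0,
    at0_2_0 (R.zigzag.left _)]

/-- Moving the action across the balanced form applies `σ` a second time, and `σ² = θ` leaves only a
twist. -/
theorem form_ract (Z : C) : R.M ◁ op21 R.ract Z ≫ op20 R.form Z =
    R.M ◁ bra R.M A.X Z ≫ bra R.M A.X (R.M ⊗ Z) ≫ tw A.X (R.M ⊗ R.M ⊗ Z) ≫
      op21 R.act (R.M ⊗ Z) ≫ op20 R.form Z := by
  apply hom_ext_of_comp
  intro W s
  rw [op21_ract]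
  simp only [MonoidalCategory.whiskerLeft_comp, Category.assoc]
  rw [at0_2_2 (R.form_balanced _).symm, op21_ract]
  simp only [Category.assoc]
  rw [at1_2_2 (bra_op11_left A.rev R.M Z), at1_2_1 (A.op11_rev_rev _),
    at0_2_2 (bra_op11_left (θ A.X).hom R.M (R.M ⊗ Z))]

/-- The `A`-valued pairing `(x, y) ↦ κ₁ b(κ₂ x, y)` on `M`, where `κ` is the copairing of `A`. -/
def pair : R.M ⊗ R.M ⟶ A.X :=
  (λ_ (R.M ⊗ R.M)).inv ≫ A.cup ▷ (R.M ⊗ R.M) ≫ (α_ A.X A.X (R.M ⊗ R.M)).hom ≫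
    A.X ◁ ((α_ A.X R.M R.M).inv ≫ R.act ▷ R.M ≫ R.form) ≫ (ρ_ A.X).hom

theorem op21_pair (Z : C) : op21 R.pair Z = op02 A.cup (R.M ⊗ R.M ⊗ Z) ≫
    A.X ◁ op21 R.act (R.M ⊗ Z) ≫ A.X ◁ op20 R.form Z := by
  simp only [op21, op02, op20, pair]
  monoidal

end Reversal

variable [MonoidalPreadditive C] [MonoidalLinear k C]

theorem JandlAlgebra.cup_tw_bra (A : JandlAlgebra k C) (Z : C) :
    op02 A.cup Z ≫ tw A.X (A.X ⊗ Z) ≫ bra A.X A.X Z = op02 A.cup Z := by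
  rw [bra_op11_right, at0_2_2 (A.cup_bra Z), (op11_slide (θ A.X).inv (tw A.X Z)).symm,
    at0_2_2 (op02_tw_left _ _).symm, tw_itw, Category.comp_id]

theorem bra_cup_left' {D E : C} (f : 𝟙_ C ⟶ D ⊗ E) (X Z : C) :
    X ◁ op02 f Z ≫ bra X D (E ⊗ Z) = op02 f (X ⊗ Z) ≫ D ◁ ibra E X Z := by
  rw [← bra_op02_left f X Z]
  simp only [Category.assoc]
  rw [← MonoidalCategory.whiskerLeft_comp, bra_ibra]
  simp

namespace Reversal

variable {A B : JandlAlgebra k C} (R : Reversal A B)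

/-- The second description `⟨x, y⟩ = b(x, yκ₁)κ₂`: `form_ract` leaves a twisted crossing on `κ`,
which the symmetry of `κ` absorbs. It makes right linearity visible, as the definition does for left
linearity. -/
theorem op21_pair' (Z : C) : op21 R.pair Z = R.M ◁ R.M ◁ op02 A.cup Z ≫
    R.M ◁ op21 R.ract (A.X ⊗ Z) ≫ op20 R.form (A.X ⊗ Z) := by
  apply hom_ext_of_comp
  intro W s
  simp only [Category.assoc]
  rw [at0_2_5 (R.form_ract _), at1_2_2 (bra_cup_left' A.cup R.M Z),
    at0_2_2 (op22_slide (β_ R.M A.X).hom (ibra A.X R.M Z)),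
    at0_2_2 (bra_cup_left' A.cup R.M _)]
  simp only [op11_slide0, op21_slide0]
  rw [op21_pair]
  simp only [Category.assoc]
  rw [at0_1_3 (A.cup_tw_bra _).symm, at0_1_3 (bra_op20_right R.form A.X Z),
    at1_2_0 (ibra_bra A.X R.M Z), at0_2_3 (bra_op21_right R.act A.X _),
    at1_2_0 (ibra_bra A.X R.M _)]

theorem pair_act_left (Z : C) : op21 R.act (R.M ⊗ Z) ≫ op21 R.pair Z =
    A.X ◁ op21 R.pair Z ≫ op21 μ[A.X] Z := by
  apply hom_ext_of_comp
  intro W s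
  simp only [op21_pair, MonoidalCategory.whiskerLeft_comp, Category.assoc]
  rw [at0_2_2 (op02_slide A.cup (op21 R.act (R.M ⊗ Z))), at1_2_2 (R.mul_act _).symm,
    at0_2_2 (A.cup_central _).symm]
  simp only [op21_slide0]

theorem pair_ract (Z : C) : R.M ◁ op21 R.ract Z ≫ op21 R.pair Z =
    op21 R.pair (A.X ⊗ Z) ≫ op21 μ[A.X] Z := by
  apply hom_ext_of_comp
  intro W s
  simp only [op21_pair', Category.assoc]
  rw [at1_2_2 (op21_slide R.ract (op02 A.cup Z)).symm, at1_2_2 (R.ract_ract _),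
    at2_2_2 (A.cup_central _)]
  simp only [op21_slide1, op20_slide0]

/-- The idempotent on `M ⊗ M` turns contraction with `b` into `x ⊗ y ⊗ z ↦ ⟨x, y⟩z`, the source of
the right action of `B`. -/
theorem proj_incl_form (Z : C) : R.M ◁ op21 R.proj Z ≫ R.M ◁ op12 R.incl Z ≫
    op20 R.form (R.M ⊗ Z) = op21 R.pair (R.M ⊗ Z) ≫ op21 R.act Z := by
  apply hom_ext_of_comp
  intro W s
  simp only [op21_pair', Category.assoc]
  rw [at1_2_3 (R.balance_eq Z)]
  simp only [op20_slide0]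

theorem proj_incl_form' (Z : C) : op21 R.proj (R.M ⊗ Z) ≫ op12 R.incl (R.M ⊗ Z) ≫
    R.M ◁ op20 R.form Z = R.M ◁ op21 R.pair Z ≫ op21 R.ract Z := by
  apply hom_ext_of_comp
  intro W s
  simp only [op21_pair, Category.assoc, MonoidalCategory.whiskerLeft_comp]
  rw [at0_2_3 (R.balance_eq _)]
  simp only [op21_slide0]

/-- The right action of `B` on `M`. -/
def rmul : R.M ⊗ B.X ⟶ R.M :=
  R.M ◁ R.incl ≫ (α_ R.M R.M R.M).inv ≫ R.form ▷ R.M ≫ (λ_ R.M).hom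

/-- The left action of `B` on `M`. -/
def lmul : B.X ⊗ R.M ⟶ R.M :=
  R.incl ▷ R.M ≫ (α_ R.M R.M R.M).hom ≫ R.M ◁ R.form ≫ (ρ_ R.M).hom

theorem op21_rmul (Z : C) :
    op21 R.rmul Z = R.M ◁ op12 R.incl Z ≫ op20 R.form (R.M ⊗ Z) := by
  simp [op21, op12, op20, rmul]

theorem op21_lmul (Z : C) :
    op21 R.lmul Z = op12 R.incl (R.M ⊗ Z) ≫ R.M ◁ op20 R.form Z := by
  simp [op21, op12, op20, lmul]

theorem op21_rmul' (Z : C) :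
    op21 R.rmul Z = R.M ◁ op12 R.incl Z ≫ op21 R.pair (R.M ⊗ Z) ≫ op21 R.act Z := by
  rw [← R.proj_incl_form, at1_2_0 (R.incl_proj Z), op21_rmul]

theorem op21_lmul' (Z : C) :
    op21 R.lmul Z = op12 R.incl (R.M ⊗ Z) ≫ R.M ◁ op21 R.pair Z ≫ op21 R.ract Z := by
  rw [← R.proj_incl_form', at0_2_0 (R.incl_proj _), op21_lmul]

theorem act_rmul (Z : C) : op21 R.act (B.X ⊗ Z) ≫ op21 R.rmul Z =
    A.X ◁ op21 R.rmul Z ≫ op21 R.act Z := by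
  apply hom_ext_of_comp
  intro W s
  simp only [op21_rmul', Category.assoc, MonoidalCategory.whiskerLeft_comp]
  rw [at0_2_2 (op21_slide R.act (op12 R.incl Z)).symm, at0_2_2 (R.pair_act_left _),
    at0_2_2 (R.mul_act Z)]

theorem lmul_ract (Z : C) : op21 R.lmul (A.X ⊗ Z) ≫ op21 R.ract Z =
    B.X ◁ op21 R.ract Z ≫ op21 R.lmul Z := by
  apply hom_ext_of_comp
  intro W s
  simp only [op21_lmul', Category.assoc]
  rw [at0_2_2 (R.ract_ract Z), at1_2_2 (R.pair_ract _).symm]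
  simp only [op12_slide0]

theorem rmul_balance (Z : C) :
    R.M ◁ op21 R.rmul Z ≫ op21 R.proj Z ≫ op12 R.incl Z =
      op21 R.proj (B.X ⊗ Z) ≫ op12 R.incl (B.X ⊗ Z) ≫ R.M ◁ op21 R.rmul Z := by
  apply hom_ext_of_comp
  intro W s
  simp only [Category.assoc]
  rw [at0_2_3 (R.balance_eq _), at0_2_3 (R.balance_eq _), at1_2_2 (R.act_rmul Z),
    at1_2_2 (op02_slide A.cup (op21 R.rmul Z))]
  simp only [op21_slide0]

theorem lmul_balance (Z : C) :
    op21 R.lmul (R.M ⊗ Z) ≫ op21 R.proj Z ≫ op12 R.incl Z =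
      B.X ◁ op21 R.proj Z ≫ B.X ◁ op12 R.incl Z ≫ op21 R.lmul (R.M ⊗ Z) := by
  apply hom_ext_of_comp
  intro W s
  simp only [Category.assoc]
  rw [at0_2_3 (R.balance_eq _), at1_2_3 (R.balance_eq _),
    at0_2_2 (op21_slide R.lmul (op02 A.cup (R.M ⊗ Z))).symm, at0_2_2 (R.lmul_ract _)]
  simp only [op21_slide0]

/-- Right multiplication by `B` is `A`-linear and commutes with the idempotent on `M ⊗ M`, so the
projection in the product of `B` is redundant. -/
theorem mul_incl (Z : C) : op21 μ[B.X] Z ≫ op12 R.incl Z =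
    op12 R.incl (B.X ⊗ Z) ≫ R.M ◁ op21 R.rmul Z := by
  apply hom_ext_of_comp
  intro W s
  rw [R.mul, ← MonoidalCategory.whiskerLeft_comp_assoc R.M, ← R.op21_rmul]
  simp only [Category.assoc]
  rw [at0_3_3 (R.rmul_balance Z), at0_2_0 (R.incl_proj _)]

theorem incl_ext {X Y : C} {f g : X ⟶ B.X ⊗ Y} (h : f ≫ op12 R.incl Y = g ≫ op12 R.incl Y) :
    f = g := by
  have := h =≫ op21 R.proj Y
  simpa only [Category.assoc, R.incl_proj, Category.comp_id] using this

/-- With `q` the copairing of the form, `x · 1 = ⟨x, q₁⟩q₂ = κ₁ b(κ₂x, q₁)q₂ = κ₁κ₂x = x`. -/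
theorem rmul_one (Z : C) : R.M ◁ op01 η[B.X] Z ≫ op21 R.rmul Z = 𝟙 _ := by
  apply hom_ext_of_comp
  intro W s
  rw [op21_rmul, R.unit]
  simp only [MonoidalCategory.whiskerLeft_comp, Category.assoc]
  rw [at0_3_2 (R.proj_incl_form Z), op21_pair]
  simp only [Category.assoc]
  rw [at0_2_2 (op02_slide A.cup (R.M ◁ op02 R.coform Z)), at1_2_2 (op21_slide R.act _),
    at1_2_0 (R.zigzag.left Z), at0_2_2 (R.mul_act Z).symm, at0_2_1 (A.cup_mul _),
    at0_2_0 (R.one_act Z), Category.id_comp]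

theorem lmul_one (Z : C) : op01 η[B.X] (R.M ⊗ Z) ≫ op21 R.lmul Z = 𝟙 _ := by
  apply hom_ext_of_comp
  intro W s
  rw [op21_lmul, R.unit]
  simp only [Category.assoc]
  rw [at0_3_2 (R.proj_incl_form' Z), op21_pair']
  simp only [MonoidalCategory.whiskerLeft_comp, Category.assoc]
  rw [← at0_2_2 (op02_slide R.coform (R.M ◁ op02 A.cup Z)), ← at0_2_2 (op02_slide R.coform _),
    at0_2_0 (R.zigzag.right _), at0_2_2 (R.ract_ract Z), at1_2_1 (A.cup_mul _),
    at0_2_0 (R.ract_one Z), Category.id_comp]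

theorem rmul_mul (Z : C) : op21 R.rmul (B.X ⊗ Z) ≫ op21 R.rmul Z =
    R.M ◁ op21 μ[B.X] Z ≫ op21 R.rmul Z := by
  apply hom_ext_of_comp
  intro W s
  conv_rhs => rw [op21_rmul]
  simp only [Category.assoc]
  rw [at1_2_2 (R.mul_incl Z)]
  simp only [op20_slide0]
  rw [op21_rmul]
  simp only [Category.assoc]

theorem lmul_mul (Z : C) : op21 μ[B.X] (R.M ⊗ Z) ≫ op21 R.lmul Z =
    B.X ◁ op21 R.lmul Z ≫ op21 R.lmul Z := by
  apply hom_ext_of_comp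
  intro W s
  conv_lhs => rw [op21_lmul]
  simp only [Category.assoc]
  rw [at0_2_2 (R.mul_incl _)]
  simp only [op21_lmul, op21_rmul, MonoidalCategory.whiskerLeft_comp, Category.assoc, op12_slide0]
  rw [at1_2_2 (op20_slide R.form (op20 R.form Z))]

theorem lmul_proj (Z : C) : op21 R.lmul (R.M ⊗ Z) ≫ op21 R.proj Z =
    B.X ◁ op21 R.proj Z ≫ op21 μ[B.X] Z := by
  apply R.incl_ext
  apply hom_ext_of_comp
  intro W s
  simp only [Category.assoc]
  rw [at0_3_3 (R.lmul_balance Z), at0_2_2 (R.mul_incl Z), op21_rmul, op21_lmul]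
  simp only [MonoidalCategory.whiskerLeft_comp, Category.assoc, op12_slide0]

theorem rmul_proj (Z : C) : R.M ◁ op21 R.rmul Z ≫ op21 R.proj Z =
    op21 R.proj (B.X ⊗ Z) ≫ op21 μ[B.X] Z := by
  apply R.incl_ext
  apply hom_ext_of_comp
  intro W s
  simp only [Category.assoc]
  rw [at0_3_3 (R.rmul_balance Z), at0_2_2 (R.mul_incl Z)]

theorem rmul_form (Z : C) : op21 R.rmul (R.M ⊗ Z) ≫ op20 R.form Z =
    R.M ◁ op21 R.lmul Z ≫ op20 R.form Z := by
  apply hom_ext_of_comp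
  intro W s
  simp only [op21_rmul, op21_lmul, MonoidalCategory.whiskerLeft_comp, Category.assoc]
  rw [at0_2_2 (op20_slide R.form (op20 R.form Z))]

theorem incl_eq_right (Z : C) :
    op12 R.incl Z = op02 R.coform (B.X ⊗ Z) ≫ R.M ◁ op21 R.rmul Z := by
  rw [op21_rmul, MonoidalCategory.whiskerLeft_comp, ← at0_2_2 (op02_slide R.coform (op12 R.incl Z)),
    R.zigzag.right, Category.comp_id]

theorem incl_eq_left (Z : C) :
    op12 R.incl Z = B.X ◁ op02 R.coform Z ≫ op21 R.lmul (R.M ⊗ Z) := by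
  rw [op21_lmul, at0_2_2 (op12_slide R.incl (op02 R.coform Z)),
    ← MonoidalCategory.whiskerLeft_comp, R.zigzag.left, MonoidalCategory.whiskerLeft_id,
    Category.comp_id]

/-- The flip exchanges the left and right actions, which leaves `σ` on the wrong leg of `κ`;
self-adjointness of `σ` (`cup_rev`) moves it to the other. -/
theorem balance_cross (Z : C) :
    op21 R.proj Z ≫ op12 R.incl Z ≫ bra R.M R.M Z ≫ tw R.M (R.M ⊗ Z) =
      bra R.M R.M Z ≫ tw R.M (R.M ⊗ Z) ≫ op21 R.proj Z ≫ op12 R.incl Z := by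
  apply hom_ext_of_comp
  intro W s
  simp only [Category.assoc]
  rw [at0_2_3 (R.balance_eq Z), at0_2_3 (R.balance_eq Z)]
  simp only [op21_ract, Category.assoc]
  conv_lhs => rw [at0_2_3 (bra_op21_left R.act R.M Z), at0_2_5 (op21_tw R.act _),
    at0_2_3 (bra_op21_right R.act A.X _), at1_2_3 (bra_op21_right R.act R.M Z),
    at0_2_2 (bra_op11_left A.rev R.M _), at0_2_2 (op11_slide A.rev (bra R.M A.X _)).symm,
    at0_3_1 (bra_op02_left A.cup R.M _), at0_2_2 (bra_op11_right A.rev A.X _),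
    at0_2_2 (A.cup_bra _)]
  simp only [op11_slide0]
  rw [at0_2_0 (itw_tw _ _)]
  rw [at1_2_2 (op11_slide A.rev (bra R.M R.M Z)).symm, at1_2_2 (bra_op11_right A.rev R.M _),
    at0_2_2 (bra_op11_left (θ R.M).hom A.X _)]
  simp only [op22_slide0]
  rw [at0_2_2 (op02_slide A.cup (bra R.M R.M Z)).symm, at0_3_1 (bra_op02_right A.cup R.M _)]
  conv_rhs => rw [at1_2_2 (A.cup_rev _)]
  simp only [op22_slide0, op21_slide0, op11_slide0]

theorem rev_incl (Z : C) : op11 B.rev Z ≫ op12 R.incl Z =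
    R.ν • (op12 R.incl Z ≫ bra R.M R.M Z ≫ tw R.M (R.M ⊗ Z)) := by
  rw [R.rev, Linear.smul_comp]
  simp only [Category.assoc]
  rw [← R.balance_cross Z, at0_2_0 (R.incl_proj Z)]

/-- `σ` flips the two legs of an element of `B`, and the symmetry of the form undoes the flip in the
contraction. Hence the two `B`-actions determine each other. -/
theorem rev_rmul (Z : C) : R.M ◁ op11 B.rev Z ≫ op21 R.rmul Z = ibra R.M B.X Z ≫ op21 R.lmul Z := by
  have h := R.symm.cross_cap R.M Z
  rw [op21_rmul, op21_lmul, at1_2_1 (R.rev_incl Z), MonoidalLinear.whiskerLeft_smul,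
    Linear.smul_comp, MonoidalCategory.whiskerLeft_comp, MonoidalCategory.whiskerLeft_comp,
    Category.assoc, Category.assoc, ← Linear.comp_smul, h, at0_3_2 (ibra_op12_left R.incl R.M Z)]

end Reversal

end

/-! ### The trace on the second algebra, and the comparison of `M ⊗_B M` with `A`. -/

section

open Strand Ribbon

variable {k : Type w₁} [Field k] {C : Type u₁} [Category.{v₁} C] [Preadditive C] [Linear k C]
  [MonoidalCategory C] [BraidedCategory C] [RightRigidCategory C] [RibbonCategory C]
  [MonoidalPreadditive C] [MonoidalLinear k C]

namespace Reversal

variable {A B : JandlAlgebra k C} (R : Reversal A B)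

theorem mul_incl' (Z : C) : op21 μ[B.X] Z ≫ op12 R.incl Z =
    B.X ◁ op12 R.incl Z ≫ op21 R.lmul (R.M ⊗ Z) := by
  rw [R.mul_incl, op21_rmul, op21_lmul, MonoidalCategory.whiskerLeft_comp,
    at0_2_2 (op12_slide R.incl (op12 R.incl Z))]

/-- The functional on `B` induced by the form. -/
def trace : B.X ⟶ 𝟙_ C := R.incl ≫ R.form

theorem op10_trace (Z : C) : op10 R.trace Z = op12 R.incl Z ≫ op20 R.form Z := op10_comp_20 _ _ _

theorem rmul_form_right (Z : C) : R.M ◁ op21 R.rmul Z ≫ op20 R.form Z =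
    R.ν • (tw R.M (R.M ⊗ B.X ⊗ Z) ≫ bra R.M R.M (B.X ⊗ Z) ≫ R.M ◁ bra R.M B.X Z ≫
      R.M ◁ op21 R.lmul Z ≫ op20 R.form Z) := by
  conv_lhs => rw [R.symm.op20_eq]
  rw [Linear.comp_smul, op11_slide0, at0_2_3 (bra_op21_left R.rmul R.M Z), R.rmul_form]

theorem lmul_form_right (Z : C) : R.M ◁ op21 R.lmul Z ≫ op20 R.form Z =
    R.ν • (tw R.M (B.X ⊗ R.M ⊗ Z) ≫ bra R.M B.X (R.M ⊗ Z) ≫ B.X ◁ bra R.M R.M Z ≫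
      op21 R.lmul (R.M ⊗ Z) ≫ op20 R.form Z) := by
  conv_lhs => rw [R.symm.op20_eq]
  rw [Linear.comp_smul, op11_slide0, at0_2_3 (bra_op21_left R.lmul R.M Z)]

/-- The symmetry of the form is used twice, and `ν²` disappears against the form. -/
theorem rmul_form_cyclic (Z : C) : R.M ◁ op21 R.rmul Z ≫ op20 R.form Z =
    tw R.M (R.M ⊗ B.X ⊗ Z) ≫ R.M ◁ tw R.M (B.X ⊗ Z) ≫ bra R.M R.M (B.X ⊗ Z) ≫
      bra R.M R.M (B.X ⊗ Z) ≫ R.M ◁ bra R.M B.X Z ≫ bra R.M B.X (R.M ⊗ Z) ≫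
      op21 R.lmul (R.M ⊗ Z) ≫ op20 R.form Z := by
  rw [R.rmul_form_right, R.lmul_form_right]
  simp only [← Linear.comp_smul]
  rw [R.symm.smul_smul_cap, op11_slide0, at0_2_2 (bra_op11_left (θ R.M).hom R.M _).symm,
    at0_3_3 (bra_slide_bra R.M R.M B.X Z).symm]

theorem trace_symm (Z : C) : tw B.X (B.X ⊗ Z) ≫ bra B.X B.X Z ≫ op21 μ[B.X] Z ≫ op10 R.trace Z =
    op21 μ[B.X] Z ≫ op10 R.trace Z := by
  simp only [op10_trace]
  conv_rhs => rw [at0_2_2 (R.mul_incl Z), R.rmul_form_cyclic]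
  rw [at0_2_2 (R.mul_incl' Z), at0_2_3 (bra_op12_right R.incl B.X Z).symm,
    at0_5_2 (op12_tw R.incl _)]

/-- A balanced form absorbs the idempotent that defines `M ⊗_A M`. -/
theorem proj_trace (Z : C) : op21 R.proj Z ≫ op10 R.trace Z = op20 R.form Z := by
  apply hom_ext_of_comp
  intro W s
  rw [op10_trace]
  simp only [Category.assoc]
  rw [at0_2_3 (R.balance_eq Z), at0_2_2 (op21_slide R.ract (op21 R.act Z)).symm,
    at0_2_2 (R.form_balanced Z), at1_2_2 (R.mul_act Z).symm, at1_2_1 (A.cup_mul _),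
    at1_2_0 (R.one_act Z)]

theorem lmul_form (Z : C) : op21 R.lmul (R.M ⊗ Z) ≫ op20 R.form Z =
    B.X ◁ op21 R.proj Z ≫ op21 μ[B.X] Z ≫ op10 R.trace Z := by
  rw [← R.proj_trace, at0_2_2 (R.lmul_proj Z)]

/-- The element of `B` that represents the trace. -/
def weight : 𝟙_ C ⟶ B.X := B.density R.trace

theorem weight_cap (Z : C) : B.X ◁ op01 R.weight Z ≫ op20 B.cap Z = op10 R.trace Z :=
  B.density_cap R.trace Z

theorem weight_central (Z : C) : op01 R.weight (B.X ⊗ Z) ≫ op21 μ[B.X] Z =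
    B.X ◁ op01 R.weight Z ≫ op21 μ[B.X] Z :=
  B.density_central R.trace R.trace_symm Z

/-- The right action of the weight. -/
def wact : R.M ⟶ R.M := (ρ_ R.M).inv ≫ R.M ◁ R.weight ≫ R.rmul

theorem op11_wact (Z : C) : op11 R.wact Z = R.M ◁ op01 R.weight Z ≫ op21 R.rmul Z := by
  simp [op11, op01, op21, wact]

/-- The morphism `(x, y) ↦ κ₁ b(κ₂ x w, y)` that identifies `M ⊗_B M` with `A`. -/
def retract : R.M ⊗ R.M ⟶ A.X := R.wact ▷ R.M ≫ R.pair

/-- The morphism `a ↦ a q`, where `q` is the copairing of the form. -/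
def insert : A.X ⟶ R.M ⊗ R.M :=
  (ρ_ A.X).inv ≫ A.X ◁ R.coform ≫ (α_ A.X R.M R.M).inv ≫ R.act ▷ R.M

theorem op21_retract (Z : C) : op21 R.retract Z = op11 R.wact (R.M ⊗ Z) ≫ op21 R.pair Z := by
  rw [retract, op21_comp, op22_whiskerRight]

theorem op12_insert (Z : C) :
    op12 R.insert Z = A.X ◁ op02 R.coform Z ≫ op21 R.act (R.M ⊗ Z) := by
  simp [op12, op02, op21, insert]

theorem op12_insert' (Z : C) :
    op12 R.insert Z = op02 R.coform (A.X ⊗ Z) ≫ R.M ◁ op21 R.ract Z := by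
  rw [op12_insert, act_coform]

theorem act_wact (Z : C) : op21 R.act Z ≫ op11 R.wact Z = A.X ◁ op11 R.wact Z ≫ op21 R.act Z := by
  apply hom_ext_of_comp
  intro W s
  simp only [op11_wact, Category.assoc, MonoidalCategory.whiskerLeft_comp]
  rw [at0_2_2 (op21_slide R.act (op01 R.weight Z)).symm, at0_2_2 (R.act_rmul Z)]

theorem rmul_wact (Z : C) :
    op21 R.rmul Z ≫ op11 R.wact Z = op11 R.wact (B.X ⊗ Z) ≫ op21 R.rmul Z := by
  apply hom_ext_of_comp
  intro W s
  simp only [op11_wact, Category.assoc]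
  rw [at0_2_2 (op21_slide R.rmul (op01 R.weight Z)).symm, at0_2_2 (R.rmul_mul Z),
    at1_2_2 (R.weight_central Z).symm]

theorem act_retract (Z : C) : op21 R.act (R.M ⊗ Z) ≫ op21 R.retract Z =
    A.X ◁ op21 R.retract Z ≫ op21 μ[A.X] Z := by
  rw [op21_retract, MonoidalCategory.whiskerLeft_comp, at0_2_2 (R.act_wact _), R.pair_act_left,
    Category.assoc]

theorem ract_retract (Z : C) : R.M ◁ op21 R.ract Z ≫ op21 R.retract Z =
    op21 R.retract (A.X ⊗ Z) ≫ op21 μ[A.X] Z := by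
  rw [op21_retract, op21_retract, op11_slide0, R.pair_ract, Category.assoc]

theorem mul_insert (Z : C) : op21 μ[A.X] Z ≫ op12 R.insert Z =
    A.X ◁ op12 R.insert Z ≫ op21 R.act (R.M ⊗ Z) := by
  rw [op12_insert, MonoidalCategory.whiskerLeft_comp, Category.assoc, ← R.mul_act,
    at0_2_2 (op21_slide μ[A.X] (op02 R.coform Z))]

theorem mul_insert' (Z : C) : op21 μ[A.X] Z ≫ op12 R.insert Z =
    op12 R.insert (A.X ⊗ Z) ≫ R.M ◁ op21 R.ract Z := by
  rw [op12_insert', op12_insert', Category.assoc, ← MonoidalCategory.whiskerLeft_comp, R.ract_ract,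
    MonoidalCategory.whiskerLeft_comp, at0_2_2 (op02_slide R.coform (op21 μ[A.X] Z))]

theorem pair_balanced (Z : C) : op21 R.rmul (R.M ⊗ Z) ≫ op21 R.pair Z =
    R.M ◁ op21 R.lmul Z ≫ op21 R.pair Z := by
  apply hom_ext_of_comp
  intro W s
  simp only [op21_pair, Category.assoc]
  rw [at0_2_2 (op02_slide A.cup (op21 R.rmul (R.M ⊗ Z))), at1_2_2 (R.act_rmul _).symm,
    at1_2_2 (R.rmul_form Z)]
  rw [at0_2_2 (op02_slide A.cup (R.M ◁ op21 R.lmul Z))]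
  rw [at1_2_2 (op21_slide R.act (op21 R.lmul Z))]

/-- The idempotent on `M ⊗ M` with image `M ⊗_B M` factors through `A`. -/
theorem retract_insert (Z : C) : op21 R.retract Z ≫ op12 R.insert Z =
    R.M ◁ op02 B.cup (R.M ⊗ Z) ≫ op21 R.rmul (B.X ⊗ R.M ⊗ Z) ≫ R.M ◁ op21 R.lmul Z := by
  -- With `κ` the copairing of `B`, this is `κ₁ ⊗ κ₂y = [y ⊗ q₁]w ⊗ q₂`. Pairing the first leg with
  -- `β` gives `b(βy, q₁)q₂ = βy` on the right. Acting on `x` and moving the central `w` next to `x`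
  -- yields `⟨xw, y⟩q`.
  have h : op02 B.cup (R.M ⊗ Z) ≫ B.X ◁ op21 R.lmul Z =
      R.M ◁ op02 R.coform Z ≫ op21 R.proj (R.M ⊗ Z) ≫ B.X ◁ op01 R.weight (R.M ⊗ Z) ≫
        op21 μ[B.X] (R.M ⊗ Z) := by
    apply B.zigzag.ext_left
    apply hom_ext_of_comp
    intro W s
    simp only [MonoidalCategory.whiskerLeft_comp, Category.assoc]
    rw [at0_2_2 (op20_slide B.cap (op21 R.lmul Z)), at0_2_0 (B.zigzag.left _),
      at0_2_2 (B.cap_assoc _).symm, at0_2_2 (op21_slide μ[B.X] (op01 R.weight (R.M ⊗ Z))),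
      at0_2_1 (R.weight_cap _), at0_3_2 (R.lmul_form _).symm,
      at0_2_2 (op21_slide R.lmul (op02 R.coform Z)), at0_2_0 (R.zigzag.left Z)]
  apply hom_ext_of_comp
  intro W s
  simp only [Category.assoc]
  rw [at0_2_2 (op21_slide R.rmul (op21 R.lmul Z)).symm, at1_2_4 h,
    at1_2_2 (R.weight_central _).symm, at0_2_2 (R.rmul_mul _).symm,
    at0_2_1 (R.op11_wact _).symm, op11_slide0, op21_rmul, Category.assoc,
    at0_3_2 (R.proj_incl_form _), op21_retract, op12_insert]
  simp only [op11_slide0, op21_slide0, Category.assoc]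

theorem balance_retract (Z : C) : R.M ◁ op02 B.cup (R.M ⊗ Z) ≫ op21 R.rmul (B.X ⊗ R.M ⊗ Z) ≫
    R.M ◁ op21 R.lmul Z ≫ op21 R.retract Z = op21 R.retract Z := by
  apply hom_ext_of_comp
  intro W s
  simp only [op21_retract, Category.assoc]
  simp only [op11_slide0]
  rw [at0_2_2 (R.rmul_wact _), at0_2_2 (R.pair_balanced _).symm, op11_slide0,
    at0_2_2 (R.rmul_mul _), at1_2_1 (B.cup_mul _), at0_2_0 (R.rmul_one _)]

theorem insert_retract_idem (Z : C) : op12 R.insert Z ≫ op21 R.retract Z ≫ op12 R.insert Z ≫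
    op21 R.retract Z = op12 R.insert Z ≫ op21 R.retract Z := by
  rw [at0_2_3 (R.retract_insert Z), R.balance_retract]

end Reversal

end

/-! ### Reading a reversal backwards. -/

section

open Strand Ribbon

variable {k : Type w₁} [Field k] {C : Type u₁} [Category.{v₁} C] [Preadditive C] [Linear k C]
  [MonoidalCategory C] [BraidedCategory C] [RightRigidCategory C] [RibbonCategory C]
  [MonoidalPreadditive C] [MonoidalLinear k C]

namespace Reversal

variable {A B : JandlAlgebra k C} (R : Reversal A B)

/-- Converting `lmul` back into a right action applies the reversion twice in all, so `rmul` returns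
only up to conjugation by the twist of `M`. -/
theorem rightAct_lmul (Z : C) : op21 (B.rightAct R.lmul) Z =
    itw R.M (B.X ⊗ Z) ≫ op21 R.rmul Z ≫ tw R.M Z := by
  rw [B.op21_rightAct, op21_tw, at0_2_0 (itw_tw _ _), ← B.op11_rev_rev,
    MonoidalCategory.whiskerLeft_comp, Category.assoc]
  conv_rhs => rw [at0_2_2 (bra_op11_left B.rev R.M Z),
    at0_2_2 (bra_op11_right B.rev R.M Z), R.rev_rmul, at0_2_0 (bra_ibra _ _ _)]

theorem op12_insert_rev (Z : C) : R.ν • (op12 R.insert Z ≫ tw R.M (R.M ⊗ Z) ≫ bra R.M R.M Z) =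
    op11 A.rev Z ≫ op12 R.insert Z := by
  have h : R.ν • (op02 R.coform (A.X ⊗ Z) ≫ tw R.M (R.M ⊗ A.X ⊗ Z) ≫ bra R.M R.M (A.X ⊗ Z)) =
      op02 R.coform (A.X ⊗ Z) := by
    rw [at0_2_2 (op02_tw_left _ _), bra_op11_left, ← R.symm.cup_eq R.zigzag]
  rw [op12_insert, Category.assoc, at0_2_5 (op21_tw R.act _), bra_op21_right R.act R.M Z,
    at0_3_3 (bra_slide_bra R.M A.X R.M Z), op11_slide0, at0_2_2 (bra_op11_left (θ R.M).hom A.X _),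
    at0_2_2 (op11_slide (θ R.M).hom (bra A.X R.M Z)).symm,
    at0_3_1 (bra_op02_left R.coform A.X Z), at0_1_2 (A.op11_rev_rev Z).symm, R.act_coform]
  conv_rhs => rw [← h, Linear.smul_comp, Linear.comp_smul]
  simp only [Category.assoc, op21_ract, MonoidalCategory.whiskerLeft_comp]
  rw [at0_2_2 (op02_slide R.coform (op11 A.rev Z))]
  simp only [op11_slide0, op22_slide0]

/-- If the idempotent `insert ≫ retract` is the identity, then the reversal can be read backwards. -/
def inverse (h : R.insert ≫ R.retract = 𝟙 _) : Reversal B A where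
  M := R.M
  act := R.lmul
  -- The inverse twist compensates the conjugation in `rightAct_lmul`, so that the form is balanced
  -- over `B`; the remaining data are twisted accordingly.
  form := (θ R.M).inv ▷ R.M ≫ R.form
  coform := R.coform ≫ (θ R.M).hom ▷ R.M
  ν := R.ν
  incl := R.insert ≫ (θ R.M).hom ▷ R.M
  proj := (θ R.M).inv ▷ R.M ≫ R.retract
  one_act := R.lmul_one
  mul_act := R.lmul_mul
  zigzag := by
    constructor
    · intro Z
      apply hom_ext_of_comp
      intro W s
      rw [op20_comp, op02_comp, op22_whiskerRight, op22_whiskerRight]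
      simp only [MonoidalCategory.whiskerLeft_comp, Category.assoc]
      rw [at0_2_2 (itw_op20 R.form _), at1_2_0 (tw_itw _ _), at0_2_0 (R.zigzag.left _),
        Category.id_comp]
    · intro Z
      apply hom_ext_of_comp
      intro W s
      rw [op20_comp, op02_comp, op22_whiskerRight, op22_whiskerRight]
      simp only [MonoidalCategory.whiskerLeft_comp, Category.assoc]
      rw [at0_2_2 (op02_tw_left _ _), at1_2_0 (tw_itw _ _), at0_2_0 (R.zigzag.right _),
        Category.id_comp]
  symm := by
    apply op20_ext
    simp only [op20_smul, op20_comp, op22_whiskerRight]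
    conv_rhs => rw [itw_op20, at0_2_2 (bra_op11_right (θ R.M).inv R.M (𝟙_ C)).symm,
      at0_2_0 (tw_itw _ _)]
    rw [R.symm.bra_cap]
  balanced Z := by
    apply hom_ext_of_comp
    intro W s
    simp only [R.rightAct_lmul, op20_comp, op22_whiskerRight, Category.assoc]
    rw [at0_2_0 (tw_itw _ _), at0_2_2 (R.rmul_form Z)]
    simp only [op11_slide0]
  incl_proj Z := by
    have e : op12 R.insert Z ≫ op21 R.retract Z = 𝟙 _ := by rw [← op11_comp_21, h, op11_id]
    rw [op12_comp, op21_comp, op22_whiskerRight, op22_whiskerRight, Category.assoc,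
      at0_2_0 (tw_itw _ _), e]
  proj_incl Z := by
    apply hom_ext_of_comp
    intro W s
    simp only [op12_comp, op21_comp, op22_whiskerRight, R.rightAct_lmul, Category.assoc]
    rw [at0_2_3 (R.retract_insert Z)]
    simp only [op11_slide0]
  unit Z := by
    have e : op12 R.insert Z ≫ op21 R.retract Z = 𝟙 _ := by rw [← op11_comp_21, h, op11_id]
    rw [op02_comp, op21_comp, op22_whiskerRight, op22_whiskerRight, Category.assoc,
      at0_2_0 (tw_itw _ _)]
    have e2 := op01 η[A.X] Z ≫= e
    rw [Category.comp_id, op12_insert, Category.assoc, at0_2_2 (op01_slide η[A.X] (op02 R.coform Z)).symm,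
      at0_2_0 (R.one_act _)] at e2
    exact e2.symm
  mul Z := by
    have e : op12 R.insert Z ≫ op21 R.retract Z = 𝟙 _ := by rw [← op11_comp_21, h, op11_id]
    have h2 : R.M ◁ op12 R.insert Z ≫ op20 R.form (R.M ⊗ Z) = op21 R.ract Z := by
      rw [op12_insert, MonoidalCategory.whiskerLeft_comp, Category.assoc, ← R.form_balanced,
        at0_2_2 (op21_slide R.ract (op02 R.coform Z)), R.zigzag.left, Category.comp_id]
    simp only [op12_comp, op21_comp, op20_comp, op22_whiskerRight, Category.assoc,
      MonoidalCategory.whiskerLeft_comp]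
    rw [at1_2_2 (itw_op20 R.form _)]
    simp only [op11_slide0]
    rw [at0_2_0 (tw_itw _ _), at2_2_0 (tw_itw _ _), at1_2_1 h2,
      at0_2_2 (R.mul_insert' Z).symm, e, Category.comp_id]
  rev Z := by
    have e : op12 R.insert Z ≫ op21 R.retract Z = 𝟙 _ := by rw [← op11_comp_21, h, op11_id]
    rw [op12_comp, op21_comp, op22_whiskerRight, op22_whiskerRight, Category.assoc,
      at0_2_0 (tw_itw _ _)]
    have e2 := R.op12_insert_rev Z =≫ op21 R.retract Z
    rw [Linear.smul_comp, Category.assoc, Category.assoc, Category.assoc, e, Category.comp_id] at e2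
    exact e2.symm

end Reversal

end

/-! ### Simplicity and Morita equivalence. -/

section

open Strand Ribbon

variable {k : Type w₁} [Field k] {C : Type u₁} [Category.{v₁} C] [Preadditive C] [Linear k C]
  [MonoidalCategory C] [BraidedCategory C] [RightRigidCategory C] [RibbonCategory C]

namespace Strand

theorem whisker_comp_eq_of_op21_left {A M N T : C} {aM : A ⊗ M ⟶ M} {aT : A ⊗ T ⟶ T}
    {r : M ⊗ N ⟶ T}
    (h : op21 aM (N ⊗ 𝟙_ C) ≫ op21 r (𝟙_ C) = A ◁ op21 r (𝟙_ C) ≫ op21 aT (𝟙_ C)) :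
    A ◁ r ≫ aT = (α_ A M N).inv ≫ aM ▷ N ≫ r := by
  have h2 := congrArg (fun t => A ◁ M ◁ (ρ_ N).inv ≫ t ≫ (ρ_ T).hom) h
  simp only [op21] at h2
  calc _ = _ := by monoidal
    _ = _ := h2.symm
    _ = _ := by monoidal

theorem whisker_comp_eq_of_op21_right {A M N T : C} {aN : N ⊗ A ⟶ N} {aT : T ⊗ A ⟶ T}
    {r : M ⊗ N ⟶ T}
    (h : M ◁ op21 aN (𝟙_ C) ≫ op21 r (𝟙_ C) = op21 r (A ⊗ 𝟙_ C) ≫ op21 aT (𝟙_ C)) :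
    r ▷ A ≫ aT = (α_ M N A).hom ≫ M ◁ aN ≫ r := by
  have h2 := congrArg (fun t => (α_ M N A).hom ≫ M ◁ N ◁ (ρ_ A).inv ≫ t ≫ (ρ_ T).hom) h
  simp only [op21] at h2
  calc _ = _ := by monoidal
    _ = _ := h2.symm
    _ = _ := by monoidal

theorem op22_balance (A : C) [MonObj A] [ComonObj A] {M N : C} (aM : M ⊗ A ⟶ M) (aN : A ⊗ N ⟶ N)
    (Z : C) : op22 (balance A aM aN) Z =
      M ◁ op02 (η[A] ≫ Δ[A]) (N ⊗ Z) ≫ op21 aM (A ⊗ N ⊗ Z) ≫ M ◁ op21 aN Z := by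
  simp only [op22, op02, op21, balance, MonoidalCategory.tensorHom_def]
  monoidal

theorem isTensorOver_of_op {A : C} [MonObj A] [ComonObj A] {M N T : C} {aM : M ⊗ A ⟶ M}
    {aN : A ⊗ N ⟶ N} {e : T ⟶ M ⊗ N} {r : M ⊗ N ⟶ T} (h : ∀ Z, op12 e Z ≫ op21 r Z = 𝟙 _)
    (h' : ∀ Z, op21 r Z ≫ op12 e Z =
      M ◁ op02 (η[A] ≫ Δ[A]) (N ⊗ Z) ≫ op21 aM (A ⊗ N ⊗ Z) ≫ M ◁ op21 aN Z) :
    IsTensorOver A aM aN e r where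
  section_retraction := by
    apply op11_ext
    rw [op11_comp_21, h, op11_id]
  retraction_section := by
    apply op22_ext
    rw [op22_comp_12, h', op22_balance]

end Strand

/-- The bimodule on an object with commuting left and right actions. -/
def bimodOfActions (A B : C) [MonObj A] [MonObj B] {M : C} (l : A ⊗ M ⟶ M) (r : M ⊗ B ⟶ M)
    (one_l : ∀ Z, op01 η[A] (M ⊗ Z) ≫ op21 l Z = 𝟙 _)
    (mul_l : ∀ Z, op21 μ[A] (M ⊗ Z) ≫ op21 l Z = A ◁ op21 l Z ≫ op21 l Z)
    (r_one : ∀ Z, M ◁ op01 η[B] Z ≫ op21 r Z = 𝟙 _)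
    (r_mul : ∀ Z, op21 r (B ⊗ Z) ≫ op21 r Z = M ◁ op21 μ[B] Z ≫ op21 r Z)
    (comm : ∀ Z, op21 l (B ⊗ Z) ≫ op21 r Z = A ◁ op21 r Z ≫ op21 l Z) :
    Bimod (Mon.mk A) (Mon.mk B) where
  X := M
  actLeft := l
  one_actLeft := by
    have h := congrArg (fun t => (λ_ M).hom ≫ (ρ_ M).inv ≫ t ≫ (ρ_ M).hom) (one_l (𝟙_ C))
    simp only [op01, op21] at h
    calc _ = _ := by monoidal
      _ = _ := h
      _ = _ := by monoidal
  left_assoc := by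
    have h := congrArg (fun t => (α_ A A M).hom ≫ A ◁ A ◁ (ρ_ M).inv ≫ t ≫ (ρ_ M).hom)
      (mul_l (𝟙_ C))
    simp only [op21] at h
    calc _ = _ := by monoidal
      _ = _ := h
      _ = _ := by monoidal
  actRight := r
  actRight_one := by
    have h := congrArg (fun t => t ≫ (ρ_ M).hom) (r_one (𝟙_ C))
    simp only [op01, op21] at h
    calc _ = _ := by monoidal
      _ = _ := h
      _ = _ := by monoidal
  right_assoc := by
    have h := congrArg (fun t => M ◁ B ◁ (ρ_ B).inv ≫ t ≫ (ρ_ M).hom) (r_mul (𝟙_ C))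
    simp only [op21] at h
    calc _ = _ := by monoidal
      _ = _ := h.symm
      _ = _ := by monoidal
  middle_assoc := by
    have h := congrArg (fun t => (α_ A M B).hom ≫ A ◁ M ◁ (ρ_ B).inv ≫ t ≫ (ρ_ M).hom)
      (comm (𝟙_ C))
    simp only [op21] at h
    calc _ = _ := by monoidal
      _ = _ := h
      _ = _ := by monoidal

section Simple

variable [IsIdempotentComplete C]

/-- The image of a bilinear idempotent is a sub-bimodule of `A`. Its inclusion is a split
monomorphism, so by simplicity it is zero or invertible. -/
theorem isSimpleAlgebra_idempotent {A : C} [MonObj A] (hA : IsSimpleAlgebra A)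
    (f : A ⟶ A) (hf : f ≫ f = f) (hl : A ◁ f ≫ μ[A] = μ[A] ≫ f) (hr : f ▷ A ≫ μ[A] = μ[A] ≫ f) :
    f = 0 ∨ f = 𝟙 A := by
  obtain ⟨Y, i, p, hip, hpi⟩ := IsIdempotentComplete.idempotents_split A f hf
  have hil : A ◁ i ≫ μ[A] = (A ◁ i ≫ μ[A] ≫ p) ≫ i := by
    have hi : i = i ≫ f := by rw [← hpi, reassoc_of% hip]
    simp only [Category.assoc, hpi]
    rw [← hl, ← MonoidalCategory.whiskerLeft_comp_assoc, ← hi]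
  have hir : i ▷ A ≫ μ[A] = (i ▷ A ≫ μ[A] ≫ p) ≫ i := by
    have hi : i = i ≫ f := by rw [← hpi, reassoc_of% hip]
    simp only [Category.assoc, hpi]
    rw [← hr, ← MonoidalCategory.comp_whiskerRight_assoc, ← hi]
  have hm : Mono i := (SplitMono.mk p hip).mono
  let l := A ◁ i ≫ μ[A] ≫ p
  let r := i ▷ A ≫ μ[A] ≫ p
  have hl' : l ≫ i = A ◁ i ≫ μ[A] := hil.symm
  have hr' : r ≫ i = i ▷ A ≫ μ[A] := hir.symm
  let X : Bimod (Mon.mk A) (Mon.mk A) :=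
    { X := Y
      actLeft := l
      one_actLeft := by
        rw [← cancel_mono i]
        simp only [Category.assoc, hl']
        rw [← whisker_exchange_assoc]
        simp
      left_assoc := by
        rw [← cancel_mono i]
        simp only [Category.assoc, hl']
        rw [← MonoidalCategory.whiskerLeft_comp_assoc, hl', ← whisker_exchange_assoc]
        simp [MonObj.mul_assoc]
      actRight := r
      actRight_one := by
        rw [← cancel_mono i]
        simp only [Category.assoc, hr']
        rw [whisker_exchange_assoc]
        simp
      right_assoc := by
        rw [← cancel_mono i]
        simp only [Category.assoc, hr']
        rw [← MonoidalCategory.comp_whiskerRight_assoc, hr', whisker_exchange_assoc]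
        simp [MonObj.mul_assoc]
      middle_assoc := by
        rw [← cancel_mono i]
        simp only [Category.assoc, hl', hr']
        rw [← MonoidalCategory.comp_whiskerRight_assoc, hl',
          ← MonoidalCategory.whiskerLeft_comp_assoc, hr']
        simp [MonObj.mul_assoc] }
  let g : X ⟶ Bimod.regular (Mon.mk A) := { hom := i, left_act_hom := hl', right_act_hom := hr' }
  have hg : Mono g := by
    constructor
    intro Z a b hab
    apply Bimod.hom_ext
    rw [← cancel_mono i]
    exact congrArg Bimod.Hom.hom hab
  by_cases h0 : i = 0
  · left
    rw [← hpi, h0, comp_zero]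
  · right
    have : IsIso g := (hA X g hg).2 h0
    obtain ⟨q, hq⟩ : ∃ q : A ⟶ Y, q ≫ i = 𝟙 A :=
      ⟨(inv g).hom, congrArg Bimod.Hom.hom (IsIso.inv_hom_id g)⟩
    have hqp : q = p := by
      rw [← Category.comp_id q, ← hip, ← Category.assoc, hq, Category.id_comp]
    rw [← hpi, ← hqp, hq]

end Simple

namespace Reversal

variable [MonoidalPreadditive C] [MonoidalLinear k C]
variable {A B : JandlAlgebra k C} (R : Reversal A B)

/-- The form is balanced over `B` and absorbs the idempotent of `M ⊗_B M`, so it vanishes with it.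
The zigzag identity then kills `M`, and `B` is a retract of `M ⊗ M`. -/
theorem eq_zero_of_retract_insert (h : R.retract ≫ R.insert = 0) : 𝟙 B.X = 0 := by
  have h1 : ∀ Z, op20 R.form Z = 0 := by
    intro Z
    have e := R.retract_insert Z =≫ op20 R.form Z
    simp only [Category.assoc] at e
    rw [← R.rmul_form, at0_2_2 (R.rmul_mul _), at1_2_1 (B.cup_mul _), at0_2_0 (R.rmul_one _),
      ← Category.assoc, ← op22_comp_12, h] at e
    rw [← e]
    simp [op22]
  apply op11_ext
  rw [op11_id, ← R.incl_proj, ← Category.comp_id (op12 R.incl _), ← MonoidalCategory.whiskerLeft_id,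
    ← R.zigzag.left, h1]
  simp [op11]

theorem insert_retract_of_simple [IsIdempotentComplete C] (hA : A.IsSimple) (hB : 𝟙 B.X ≠ 0) :
    R.insert ≫ R.retract = 𝟙 A.X := by
  have h := isSimpleAlgebra_idempotent hA (R.insert ≫ R.retract) ?_ ?_ ?_
  · rcases h with h | h
    · exfalso
      apply hB
      apply R.eq_zero_of_retract_insert
      apply op22_ext
      -- `retract` absorbs the idempotent `retract ≫ insert`, so it vanishes as soon as `insert ≫
      -- retract` does.
      have e := R.balance_retract (𝟙_ C)
      rw [at0_3_2 (R.retract_insert _).symm, ← op11_comp_21, h] at e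
      rw [op22_comp_12, ← e]
      simp [op22, op11]
    · exact h
  · apply op11_ext
    rw [op11_comp, op11_comp_21, Category.assoc, R.insert_retract_idem]
  · apply op21_ext
    rw [op21_comp, op22_whiskerLeft, op21_comp_11, op11_comp_21, MonoidalCategory.whiskerLeft_comp,
      Category.assoc, ← R.act_retract, ← at0_2_2 (R.mul_insert _)]
  · apply op21_ext
    rw [op21_comp, op22_whiskerRight, op21_comp_11, op11_comp_21, op11_comp_21,
      Category.assoc, ← R.ract_retract, ← at0_2_2 (R.mul_insert' _)]

end Reversal

namespace JandlAlgebra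

theorem id_ne_zero (hunit : Function.Injective fun a : k => a • 𝟙 (𝟙_ C)) (B : JandlAlgebra k C) :
    𝟙 B.X ≠ 0 := by
  intro h
  obtain ⟨a, b, ha, -, e, -⟩ := B.special
  apply ha
  apply hunit
  simp only [zero_smul]
  rw [← e, ← Category.comp_id η[B.X], h]
  simp

variable [MonoidalPreadditive C] [MonoidalLinear k C]

theorem isMoritaEquivalent_of_reversal {A B : JandlAlgebra k C} (R : Reversal A B)
    (h : R.insert ≫ R.retract = 𝟙 _) : A.IsMoritaEquivalent B := by
  have h' : ∀ Z, op12 R.insert Z ≫ op21 R.retract Z = 𝟙 _ := fun Z => by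
    rw [← op11_comp_21, h, op11_id]
  refine ⟨bimodOfActions A.X B.X R.act R.rmul R.one_act R.mul_act R.rmul_one R.rmul_mul R.act_rmul,
    bimodOfActions B.X A.X R.lmul R.ract R.lmul_one R.lmul_mul R.ract_one R.ract_ract R.lmul_ract,
    ⟨R.insert, R.retract, ?_, ?_, ?_⟩, ⟨R.incl, R.proj, ?_, ?_, ?_⟩⟩
  · exact isTensorOver_of_op h' R.retract_insert
  · exact whisker_comp_eq_of_op21_left (R.act_retract _)
  · exact whisker_comp_eq_of_op21_right (R.ract_retract _)
  · exact isTensorOver_of_op R.incl_proj R.balance_eq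
  · exact whisker_comp_eq_of_op21_left (R.lmul_proj _)
  · exact whisker_comp_eq_of_op21_right (R.rmul_proj _)

end JandlAlgebra

end

/-! ### Balanced tensor products and their behaviour under the braiding. -/

section

open Strand Ribbon

variable {k : Type w₁} [Field k] {C : Type u₁} [Category.{v₁} C] [Preadditive C] [Linear k C]
  [MonoidalCategory C] [BraidedCategory C] [RightRigidCategory C] [RibbonCategory C]

namespace JandlAlgebra

section Balance

variable (A : JandlAlgebra k C) {M N : C} {r : M ⊗ A.X ⟶ M} {l : A.X ⊗ N ⟶ N}

/-- On a balanced `f`, both legs of `κ` can be moved to the right factor, where they multiply to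
`1`. -/
theorem balance_absorb
    (one_l : ∀ Z, op01 η[A.X] (N ⊗ Z) ≫ op21 l Z = 𝟙 _)
    (mul_l : ∀ Z, op21 μ[A.X] (N ⊗ Z) ≫ op21 l Z = A.X ◁ op21 l Z ≫ op21 l Z)
    {Z W : C} {f : M ⊗ N ⊗ Z ⟶ W}
    (hf : op21 r (N ⊗ Z) ≫ f = M ◁ op21 l Z ≫ f) :
    M ◁ op02 A.cup (N ⊗ Z) ≫ op21 r (A.X ⊗ N ⊗ Z) ≫ M ◁ op21 l Z ≫ f = f := by
  rw [at0_2_2 (op21_slide r (op21 l Z)).symm, hf, at1_2_2 (mul_l Z).symm, at1_2_1 (A.cup_mul _),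
    at1_2_0 (one_l Z)]

theorem balance_balanced
    (r_mul : ∀ Z, op21 r (A.X ⊗ Z) ≫ op21 r Z = M ◁ op21 μ[A.X] Z ≫ op21 r Z)
    (mul_l : ∀ Z, op21 μ[A.X] (N ⊗ Z) ≫ op21 l Z = A.X ◁ op21 l Z ≫ op21 l Z) (Z : C) :
    op21 r (N ⊗ Z) ≫ M ◁ op02 A.cup (N ⊗ Z) ≫ op21 r (A.X ⊗ N ⊗ Z) ≫ M ◁ op21 l Z =
      M ◁ op21 l Z ≫ M ◁ op02 A.cup (N ⊗ Z) ≫ op21 r (A.X ⊗ N ⊗ Z) ≫ M ◁ op21 l Z := by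
  apply hom_ext_of_comp
  intro W s
  simp only [Category.assoc]
  rw [at0_2_2 (op21_slide r (op02 A.cup (N ⊗ Z))).symm, at0_2_2 (r_mul _),
    at1_2_2 (A.cup_central _), at0_2_2 (op21_slide r (op21 μ[A.X] (N ⊗ Z))), at1_2_2 (mul_l Z),
    at1_2_2 (op02_slide A.cup (op21 l Z))]
  simp only [op21_slide0]

theorem exists_balance_splitting [IsIdempotentComplete C]
    (r_mul : ∀ Z, op21 r (A.X ⊗ Z) ≫ op21 r Z = M ◁ op21 μ[A.X] Z ≫ op21 r Z)
    (one_l : ∀ Z, op01 η[A.X] (N ⊗ Z) ≫ op21 l Z = 𝟙 _)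
    (mul_l : ∀ Z, op21 μ[A.X] (N ⊗ Z) ≫ op21 l Z = A.X ◁ op21 l Z ≫ op21 l Z) :
    ∃ (P : C) (e : P ⟶ M ⊗ N) (p : M ⊗ N ⟶ P), (∀ Z, op12 e Z ≫ op21 p Z = 𝟙 _) ∧
      ∀ Z, op21 p Z ≫ op12 e Z =
        M ◁ op02 A.cup (N ⊗ Z) ≫ op21 r (A.X ⊗ N ⊗ Z) ≫ M ◁ op21 l Z := by
  obtain ⟨P, e, p, h1, h2⟩ := IsIdempotentComplete.idempotents_split (M ⊗ N) (balance A.X r l) (by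
    apply op22_ext
    rw [op22_comp]
    simp only [op22_balance, Category.assoc]
    exact A.balance_absorb one_l mul_l (A.balance_balanced r_mul mul_l _))
  refine ⟨P, e, p, fun Z => ?_, fun Z => ?_⟩
  · rw [← op11_comp_21, h1, op11_id]
  · rw [← op22_comp_12, h2, op22_balance]
    rfl

end Balance

end JandlAlgebra

variable [MonoidalPreadditive C] [MonoidalLinear k C]

namespace Reversal

variable {A B D : JandlAlgebra k C} (R : Reversal A B) (S : Reversal B D)

theorem proj_balanced (Z : C) :
    op21 R.ract (R.M ⊗ Z) ≫ op21 R.proj Z = R.M ◁ op21 R.act Z ≫ op21 R.proj Z := by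
  apply R.incl_ext
  simp only [Category.assoc, R.balance_eq]
  exact A.balance_balanced R.ract_ract R.mul_act Z

theorem lmul_eq (Z : C) :
    op21 R.lmul Z = bra B.X R.M Z ≫ R.M ◁ op11 B.rev Z ≫ op21 R.rmul Z := by
  rw [R.rev_rmul, at0_2_0 (bra_ibra _ _ _)]

/-- Rewriting both actions through the opposite ones puts `σ` on each leg of `κ`. Since `σ` is
self-adjoint with `σ² = θ`, this is a single twist, absorbed by the symmetry of `κ`. -/
theorem balance_cross_over (Z : C) :
    S.M ◁ op02 B.cup (R.M ⊗ Z) ≫ op21 S.ract (B.X ⊗ R.M ⊗ Z) ≫ S.M ◁ op21 R.lmul Z ≫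
        bra S.M R.M Z =
      bra S.M R.M Z ≫ R.M ◁ op02 B.cup (S.M ⊗ Z) ≫ op21 R.rmul (B.X ⊗ S.M ⊗ Z) ≫
        R.M ◁ op21 S.act Z := by
  have h : ∀ Z, op02 B.cup Z ≫ op11 B.rev (B.X ⊗ Z) ≫ B.X ◁ op11 B.rev Z =
      op02 B.cup Z ≫ tw B.X (B.X ⊗ Z) := by
    intro Z
    rw [at0_2_2 (B.cup_rev Z), ← MonoidalCategory.whiskerLeft_comp, B.op11_rev_rev, op02_tw_left]
  apply hom_ext_of_comp
  intro W s
  simp only [op21_ract, lmul_eq, MonoidalCategory.whiskerLeft_comp, Category.assoc]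
  rw [at0_2_3 (bra_op21_left R.rmul S.M Z), at1_2_2 (bra_op11_right B.rev R.M Z).symm,
    at0_2_2 (op21_slide S.act (op11 B.rev (R.M ⊗ Z))).symm,
    at0_2_2 (op22_slide (β_ S.M B.X).hom (op11 B.rev (R.M ⊗ Z))).symm, at1_3_2 (h _),
    at0_2_2 (op21_slide S.act (bra B.X R.M Z)).symm, at0_2_3 (bra_op21_right S.act R.M _),
    at1_2_3 (bra_op21_right S.act B.X Z),
    at0_2_2 (op22_slide (β_ B.X R.M).hom (bra S.M B.X Z)).symm,
    at1_3_3 (bra_slide_bra S.M B.X R.M Z).symm, at0_3_3 (bra_slide_bra B.X B.X R.M (S.M ⊗ Z)).symm,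
    at0_2_2 (op22_slide (β_ B.X B.X).hom (bra S.M R.M Z)),
    at0_3_3 (bra_slide_bra S.M B.X B.X (R.M ⊗ Z)), at1_3_1 (B.cup_tw_bra _),
    at0_3_1 (bra_op02_left B.cup S.M _), at0_2_2 (op02_slide B.cup (bra S.M R.M Z)).symm,
    at0_3_1 (bra_op02_right B.cup R.M _)]
  simp only [op21_slide0]

end Reversal

end

/-! ### Composition of reversals. -/

section

open Strand Ribbon

variable {k : Type w₁} [Field k] {C : Type u₁} [Category.{v₁} C] [Preadditive C] [Linear k C]
  [MonoidalCategory C] [BraidedCategory C] [RightRigidCategory C] [RibbonCategory C]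

namespace Strand

theorem mixed_form_left {L M N : C} (b : L ⊗ M ⟶ 𝟙_ C) (Z : C) :
    L ◁ bra N M Z ≫ op20 b (N ⊗ Z) = ibra L N (M ⊗ Z) ≫ N ◁ op20 b Z := by
  rw [bra_op20_left b N Z, at0_2_0 (ibra_bra _ _ _)]

theorem mixed_form_right {L M N : C} (b : L ⊗ N ⟶ 𝟙_ C) (Z : C) :
    bra L M (N ⊗ Z) ≫ M ◁ op20 b Z = L ◁ ibra M N Z ≫ op20 b (M ⊗ Z) := by
  rw [bra_op20_right b M Z, at1_2_0 (ibra_bra _ _ _)]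

theorem bra_ibra_slide (X Y V Z : C) :
    Y ◁ bra X V Z ≫ bra Y V (X ⊗ Z) ≫ V ◁ ibra Y X Z ≫ ibra V X (Y ⊗ Z) =
      ibra Y X (V ⊗ Z) ≫ X ◁ bra Y V Z := by
  apply hom_ext_of_comp
  intro W s
  have h := ibra Y X (V ⊗ Z) ≫= bra_slide_bra X Y V Z =≫ (V ◁ ibra Y X Z ≫ ibra V X (Y ⊗ Z) ≫ s)
  simp only [Category.assoc] at h ⊢
  rw [at0_2_0 (ibra_bra _ _ _), at1_2_0 (bra_ibra _ _ _), at0_2_0 (bra_ibra _ _ _)] at h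
  exact h

section Form

variable [MonoidalPreadditive C] [MonoidalLinear k C] {ν : k} {M : C} {b : M ⊗ M ⟶ 𝟙_ C}

theorem IsSymm.bra_cap_smul (h : IsSymm ν b) {Z W : C} (t : Z ⟶ W) :
    bra M M Z ≫ op20 b Z ≫ (ν • t) = itw M (M ⊗ Z) ≫ op20 b Z ≫ t := by
  have e := congrArg (fun f => f ≫ t) (h.bra_cap Z)
  simpa using e

theorem IsSymm.bra_cap_smul_whisker (h : IsSymm ν b) (X : C) {Z W : C} (t : X ⊗ Z ⟶ W) :
    X ◁ bra M M Z ≫ X ◁ op20 b Z ≫ (ν • t) = X ◁ itw M (M ⊗ Z) ≫ X ◁ op20 b Z ≫ t := by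
  have e := congrArg (fun f => X ◁ f ≫ t) (h.bra_cap Z)
  simpa using e

theorem IsSymm.cup_smul_whisker (h : IsSymm ν b) {q : 𝟙_ C ⟶ M ⊗ M} (hz : Zigzag b q) (X : C)
    {Z W : C} (t : X ⊗ M ⊗ M ⊗ Z ⟶ W) :
    X ◁ op02 q Z ≫ X ◁ bra M M Z ≫ X ◁ tw M (M ⊗ Z) ≫ (ν • t) = X ◁ op02 q Z ≫ t := by
  have e := congrArg (fun f => X ◁ f ≫ t) (h.cup_eq hz Z)
  simpa using e.symm

end Form

end Strand

/-- A splitting `P` of the idempotent on `R.M ⊗ S.M` with image `R.M ⊗_B S.M`. -/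
structure Reversal.Composite {A B D : JandlAlgebra k C} (R : Reversal A B)
    (S : Reversal B D) where
  /-- the object -/
  X : C
  /-- the inclusion -/
  e : X ⟶ R.M ⊗ S.M
  /-- the projection -/
  r : R.M ⊗ S.M ⟶ X
  e_r (Z : C) : op12 e Z ≫ op21 r Z = 𝟙 _
  r_e (Z : C) : op21 r Z ≫ op12 e Z =
    R.M ◁ op02 B.cup (S.M ⊗ Z) ≫ op21 R.rmul (B.X ⊗ S.M ⊗ Z) ≫ R.M ◁ op21 S.act Z

namespace Reversal.Composite

variable [MonoidalPreadditive C] [MonoidalLinear k C]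
variable {A B D : JandlAlgebra k C} {R : Reversal A B} {S : Reversal B D} (P : R.Composite S)

/-- The inclusion into `S.M ⊗ R.M`. -/
def e' : P.X ⟶ S.M ⊗ R.M := P.e ≫ (β_ S.M R.M).inv

/-- The projection from `S.M ⊗ R.M`. -/
def r' : S.M ⊗ R.M ⟶ P.X := (β_ S.M R.M).hom ≫ P.r

theorem op12_e' (Z : C) : op12 P.e' Z = op12 P.e Z ≫ ibra R.M S.M Z := op12_comp _ _ _

theorem op21_r' (Z : C) : op21 P.r' Z = bra S.M R.M Z ≫ op21 P.r Z := op21_comp _ _ _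

theorem e'_r' (Z : C) : op12 P.e' Z ≫ op21 P.r' Z = 𝟙 _ := by
  rw [op12_e', op21_r', Category.assoc, at0_2_0 (ibra_bra _ _ _), P.e_r]

theorem r'_e' (Z : C) : op21 P.r' Z ≫ op12 P.e' Z =
    S.M ◁ op02 B.cup (R.M ⊗ Z) ≫ op21 S.ract (B.X ⊗ R.M ⊗ Z) ≫ S.M ◁ op21 R.lmul Z := by
  have h := R.balance_cross_over S Z =≫ ibra R.M S.M Z
  simp only [Category.assoc] at h
  rw [bra_ibra, Category.comp_id] at h
  rw [op12_e', op21_r', Category.assoc, at0_2_3 (P.r_e Z), h]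

theorem ext {X Y : C} {f g : X ⟶ P.X ⊗ Y} (h : f ≫ op12 P.e Y = g ≫ op12 P.e Y) : f = g := by
  have := h =≫ op21 P.r Y
  simpa only [Category.assoc, P.e_r, Category.comp_id] using this

theorem ext' {X Y : C} {f g : X ⟶ P.X ⊗ Y} (h : f ≫ op12 P.e' Y = g ≫ op12 P.e' Y) : f = g := by
  have := h =≫ op21 P.r' Y
  simpa only [Category.assoc, P.e'_r', Category.comp_id] using this

theorem r_balanced (Z : C) :
    op21 R.rmul (S.M ⊗ Z) ≫ op21 P.r Z = R.M ◁ op21 S.act Z ≫ op21 P.r Z := by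
  apply P.ext
  simp only [Category.assoc, P.r_e]
  exact B.balance_balanced R.rmul_mul S.mul_act Z

theorem r'_balanced (Z : C) :
    op21 S.ract (R.M ⊗ Z) ≫ op21 P.r' Z = S.M ◁ op21 R.lmul Z ≫ op21 P.r' Z := by
  apply P.ext'
  simp only [Category.assoc, P.r'_e']
  exact B.balance_balanced S.ract_ract R.lmul_mul Z

/-- The left action of `A`. -/
def act : A.X ⊗ P.X ⟶ P.X := A.X ◁ P.e ≫ (α_ A.X R.M S.M).inv ≫ R.act ▷ S.M ≫ P.r

theorem op21_act (Z : C) : op21 P.act Z =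
    A.X ◁ op12 P.e Z ≫ op21 R.act (S.M ⊗ Z) ≫ op21 P.r Z := by
  simp only [op21, op12, act]
  monoidal

theorem act_e (Z : C) : op21 P.act Z ≫ op12 P.e Z =
    A.X ◁ op12 P.e Z ≫ op21 R.act (S.M ⊗ Z) := by
  have h : op21 R.act (S.M ⊗ Z) ≫ op21 P.r Z ≫ op12 P.e Z =
      A.X ◁ op21 P.r Z ≫ A.X ◁ op12 P.e Z ≫ op21 R.act (S.M ⊗ Z) := by
    apply hom_ext_of_comp
    intro W s
    simp only [Category.assoc]
    rw [at0_2_3 (P.r_e Z), at1_2_3 (P.r_e Z), at0_2_2 (op21_slide R.act (op02 B.cup (S.M ⊗ Z))).symm,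
      at0_2_2 (R.act_rmul _)]
    simp only [op21_slide0]
  rw [op21_act, Category.assoc, Category.assoc, h, at1_2_0 (P.e_r Z)]

/-- The right action of `A`. -/
def ract : P.X ⊗ A.X ⟶ P.X := A.rightAct P.act

theorem op21_ract (Z : C) :
    op21 P.ract Z = P.X ◁ op11 A.rev Z ≫ bra P.X A.X Z ≫ op21 P.act Z :=
  A.op21_rightAct P.act Z

theorem ract_e' (Z : C) : op21 P.ract Z ≫ op12 P.e' Z =
    op12 P.e' (A.X ⊗ Z) ≫ S.M ◁ op21 R.ract Z := by
  rw [op12_e', op12_e', op21_ract, R.op21_ract]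
  simp only [Category.assoc, MonoidalCategory.whiskerLeft_comp]
  rw [at0_2_2 (P.act_e Z), ibra_op21_right R.act S.M Z, at0_2_3 (bra_op12_right P.e A.X Z).symm,
    at0_4_2 (bra_ibra_slide S.M R.M A.X Z)]
  simp only [op12_slide0, op22_slide0]

/-- The symmetric form. -/
def form : P.X ⊗ P.X ⟶ 𝟙_ C :=
  (P.e' ⊗ₘ P.e) ≫ (α_ S.M R.M (R.M ⊗ S.M)).hom ≫
    S.M ◁ ((α_ R.M R.M S.M).inv ≫ R.form ▷ S.M ≫ (λ_ S.M).hom) ≫ S.form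

theorem op20_form (Z : C) : op20 P.form Z = op12 P.e' (P.X ⊗ Z) ≫ S.M ◁ R.M ◁ op12 P.e Z ≫
    S.M ◁ op20 R.form (S.M ⊗ Z) ≫ op20 S.form Z := by
  simp only [op20, op12, form, MonoidalCategory.tensorHom_def]
  monoidal

/-- Moving the crossings hidden in `e'` past the caps lets either form be the inner one. -/
theorem op20_form' (Z : C) : op20 P.form Z = op12 P.e (P.X ⊗ Z) ≫ R.M ◁ S.M ◁ op12 P.e' Z ≫
    R.M ◁ op20 S.form (R.M ⊗ Z) ≫ op20 R.form Z := by
  rw [op20_form, op12_e', op12_e', Category.assoc,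
    at0_2_2 (op22_slide (β_ S.M R.M).inv (op12 P.e Z)).symm, at0_2_2 (mixed_form_left R.form _).symm,
    MonoidalCategory.whiskerLeft_comp, MonoidalCategory.whiskerLeft_comp, Category.assoc,
    at1_2_2 (mixed_form_right S.form Z).symm, op20_slide]

/-- The copairing of the form. -/
def coform : 𝟙_ C ⟶ P.X ⊗ P.X :=
  S.coform ≫ S.M ◁ ((λ_ S.M).inv ≫ R.coform ▷ S.M ≫ (α_ R.M R.M S.M).hom) ≫
    (α_ S.M R.M (R.M ⊗ S.M)).inv ≫ (P.r' ⊗ₘ P.r)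

theorem op02_coform (Z : C) : op02 P.coform Z = op02 S.coform Z ≫ S.M ◁ op02 R.coform (S.M ⊗ Z) ≫
    op21 P.r' (R.M ⊗ S.M ⊗ Z) ≫ P.X ◁ op21 P.r Z := by
  simp only [op02, op21, coform, MonoidalCategory.tensorHom_def]
  monoidal

/-- The inclusion of `D`. -/
def incl : D.X ⟶ P.X ⊗ P.X :=
  S.incl ≫ S.M ◁ ((λ_ S.M).inv ≫ R.coform ▷ S.M ≫ (α_ R.M R.M S.M).hom) ≫
    (α_ S.M R.M (R.M ⊗ S.M)).inv ≫ (P.r' ⊗ₘ P.r)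

theorem op12_incl (Z : C) : op12 P.incl Z = op12 S.incl Z ≫ S.M ◁ op02 R.coform (S.M ⊗ Z) ≫
    op21 P.r' (R.M ⊗ S.M ⊗ Z) ≫ P.X ◁ op21 P.r Z := by
  simp only [op12, op02, op21, incl, MonoidalCategory.tensorHom_def]
  monoidal

/-- The contraction of `S.M ⊗ R.M ⊗ R.M ⊗ S.M` to `D`. -/
def contract (R : Reversal A B) (S : Reversal B D) (Z : C) :
    S.M ⊗ R.M ⊗ R.M ⊗ S.M ⊗ Z ⟶ D.X ⊗ Z :=
  S.M ◁ op21 R.proj (S.M ⊗ Z) ≫ S.M ◁ op21 S.act Z ≫ op21 S.proj Z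

/-- The projection to `D`. -/
def proj : P.X ⊗ P.X ⟶ D.X :=
  (P.e' ⊗ₘ P.e) ≫ (α_ S.M R.M (R.M ⊗ S.M)).hom ≫
    S.M ◁ ((α_ R.M R.M S.M).inv ≫ R.proj ▷ S.M ≫ S.act) ≫ S.proj

theorem op21_proj (Z : C) : op21 P.proj Z = op12 P.e' (P.X ⊗ Z) ≫ S.M ◁ R.M ◁ op12 P.e Z ≫
    contract R S Z := by
  simp only [op21, op12, contract, proj, MonoidalCategory.tensorHom_def]
  monoidal

/-- An element of `B` between the two left strands moves through the projection of `R` as a left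
multiplication and then across the projection of `S`. The contraction is therefore balanced and
absorbs the idempotent. -/
theorem left_contract (Z : C) : op21 P.r' (R.M ⊗ S.M ⊗ Z) ≫ op12 P.e' (R.M ⊗ S.M ⊗ Z) ≫
    contract R S Z = contract R S Z := by
  have h := B.balance_absorb (r := S.ract) (l := R.lmul) (Z := R.M ⊗ S.M ⊗ Z) R.lmul_one R.lmul_mul
    (f := contract R S Z) (by
      simp only [contract]
      conv_rhs => rw [at1_2_2 (R.lmul_proj _), at1_2_2 (S.mul_act Z), ← S.proj_balanced]
      simp only [op21_slide0])
  rw [at0_2_3 (P.r'_e' _), h]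

theorem right_contract (Z : C) : S.M ◁ R.M ◁ op21 P.r Z ≫ S.M ◁ R.M ◁ op12 P.e Z ≫
    contract R S Z = contract R S Z := by
  simp only [contract]
  rw [at2_2_3 (P.r_e _), at1_2_2 (op21_slide R.proj (op21 S.act Z)), at1_2_2 (R.rmul_proj _),
    at1_2_2 (op21_slide μ[B.X] (op21 S.act Z)).symm, at1_2_2 (S.mul_act Z),
    at2_2_2 (S.mul_act Z).symm, at1_2_2 (op21_slide R.proj (op02 B.cup (S.M ⊗ Z))),
    at2_2_1 (B.cup_mul _), at2_2_0 (S.one_act Z)]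

theorem coform_contract (Z : C) :
    S.M ◁ op02 R.coform (S.M ⊗ Z) ≫ contract R S Z = op21 S.proj Z := by
  rw [contract, at1_2_1 (R.unit _).symm, at1_2_0 (S.one_act Z)]

theorem split_proj (Z : C) :
    op21 P.r' (R.M ⊗ S.M ⊗ Z) ≫ P.X ◁ op21 P.r Z ≫ op21 P.proj Z = contract R S Z := by
  rw [op21_proj, at0_2_2 (op12_slide P.e' (op21 P.r Z)), P.right_contract, P.left_contract]

theorem incl_proj (Z : C) : op12 P.incl Z ≫ op21 P.proj Z = 𝟙 _ := by
  rw [op12_incl, Category.assoc, Category.assoc, Category.assoc, P.split_proj, coform_contract,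
    S.incl_proj]

theorem unit (Z : C) : op01 η[D.X] Z = op02 P.coform Z ≫ op21 P.proj Z := by
  rw [op02_coform, Category.assoc, Category.assoc, Category.assoc, P.split_proj, coform_contract,
    S.unit]

/-- Beside an inserted copairing `q` of `R`, an element `β` of `B` acting on the strand of `S` moves
onto `q`, and `q₁ ⊗ q₂β` is the inclusion of `β`. The mirror statement `ract_coform_split` has the
same right side, so the insertion is balanced. -/
theorem act_coform_split (Z : C) : S.M ◁ op21 S.act Z ≫ S.M ◁ op02 R.coform (S.M ⊗ Z) ≫
    op21 P.r' (R.M ⊗ S.M ⊗ Z) ≫ P.X ◁ op21 P.r Z =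
      S.M ◁ op12 R.incl (S.M ⊗ Z) ≫ op21 P.r' (R.M ⊗ S.M ⊗ Z) ≫ P.X ◁ op21 P.r Z := by
  rw [at1_2_2 (op02_slide R.coform (op21 S.act Z)), op21_slide0,
    ← MonoidalCategory.whiskerLeft_comp P.X, ← P.r_balanced, R.incl_eq_right]
  simp only [MonoidalCategory.whiskerLeft_comp, Category.assoc, op21_slide0]

theorem ract_coform_split (Z : C) : op21 S.ract (S.M ⊗ Z) ≫ S.M ◁ op02 R.coform (S.M ⊗ Z) ≫
    op21 P.r' (R.M ⊗ S.M ⊗ Z) ≫ P.X ◁ op21 P.r Z =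
      S.M ◁ op12 R.incl (S.M ⊗ Z) ≫ op21 P.r' (R.M ⊗ S.M ⊗ Z) ≫ P.X ◁ op21 P.r Z := by
  rw [at0_2_2 (op21_slide S.ract (op02 R.coform (S.M ⊗ Z))).symm, at0_2_2 (P.r'_balanced _),
    at1_2_1 (R.incl_eq_left _).symm]

/-- In nested order the `A`-actions touch only the two inner strands `R.M`, where the balancing
idempotent factors through `B`. -/
theorem act_e_e (Z : C) : P.X ◁ op02 A.cup (P.X ⊗ Z) ≫ op21 P.ract (A.X ⊗ P.X ⊗ Z) ≫
    P.X ◁ op21 P.act Z = op12 P.e' (P.X ⊗ Z) ≫ S.M ◁ R.M ◁ op12 P.e Z ≫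
      S.M ◁ op21 R.proj (S.M ⊗ Z) ≫ S.M ◁ op12 R.incl (S.M ⊗ Z) ≫
      op21 P.r' (R.M ⊗ S.M ⊗ Z) ≫ P.X ◁ op21 P.r Z := by
  apply hom_ext_of_comp
  intro W s
  simp only [Category.assoc]
  have h : op12 P.e' (P.X ⊗ Z) ≫ S.M ◁ R.M ◁ op12 P.e Z ≫ op21 P.r' (R.M ⊗ S.M ⊗ Z) ≫
      P.X ◁ op21 P.r Z ≫ s = s := by
    rw [at0_2_2 (op21_slide P.r' (op12 P.e Z)), at1_2_0 (P.e_r Z), at0_2_0 (P.e'_r' _)]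
  conv_lhs => rw [← h]
  rw [at0_2_2 (op12_slide P.e' (op21 P.act Z)), at0_2_2 (P.ract_e' _), at2_2_2 (P.act_e Z),
    at0_2_2 (op12_slide P.e' (op02 A.cup (P.X ⊗ Z))),
    at1_2_2 (op21_slide R.ract (A.X ◁ op12 P.e Z)).symm,
    at2_2_2 (op02_slide A.cup (op12 P.e Z)).symm, at1_3_2 (R.balance_eq _).symm]

theorem proj_incl (Z : C) : op21 P.proj Z ≫ op12 P.incl Z =
    P.X ◁ op02 A.cup (P.X ⊗ Z) ≫ op21 P.ract (A.X ⊗ P.X ⊗ Z) ≫ P.X ◁ op21 P.act Z := by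
  have h := B.balance_absorb (r := S.ract) (l := S.act) (Z := Z) S.one_act S.mul_act
    ((P.ract_coform_split Z).trans (P.act_coform_split Z).symm)
  rw [act_e_e, op21_proj, op12_incl, contract]
  simp only [Category.assoc]
  rw [at0_2_3 (S.balance_eq Z), h, P.act_coform_split]

theorem balanced (Z : C) :
    op21 P.ract (P.X ⊗ Z) ≫ op20 P.form Z = P.X ◁ op21 P.act Z ≫ op20 P.form Z := by
  rw [op20_form, at0_2_2 (P.ract_e' _), at0_2_2 (op12_slide P.e' (op21 P.act Z)),
    at2_2_2 (P.act_e Z), at1_2_2 (R.form_balanced _).symm, op21_slide1]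

/-- The nested form on `(R.M ⊗ S.M) ⊗ (S.M ⊗ R.M)`. -/
def nest (R : Reversal A B) (S : Reversal B D) (Z : C) : R.M ⊗ S.M ⊗ S.M ⊗ R.M ⊗ Z ⟶ Z :=
  R.M ◁ op20 S.form (R.M ⊗ Z) ≫ op20 R.form Z

/-- The idempotent turns the inner form of `S` into its `B`-valued pairing. `nest_right` gives the
same result from the other factor, so one of the two idempotents always suffices. -/
theorem nest_left (Z : C) : op21 P.r (S.M ⊗ R.M ⊗ Z) ≫ op12 P.e (S.M ⊗ R.M ⊗ Z) ≫ nest R S Z =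
    R.M ◁ op21 S.pair (R.M ⊗ Z) ≫ op21 R.rmul (R.M ⊗ Z) ≫ op20 R.form Z := by
  rw [at0_2_3 (P.r_e _), nest, S.op21_pair]
  simp only [op21_slide0, MonoidalCategory.whiskerLeft_comp, Category.assoc]

theorem nest_right (Z : C) : R.M ◁ S.M ◁ op21 P.r' Z ≫ R.M ◁ S.M ◁ op12 P.e' Z ≫ nest R S Z =
    R.M ◁ op21 S.pair (R.M ⊗ Z) ≫ op21 R.rmul (R.M ⊗ Z) ≫ op20 R.form Z := by
  rw [at2_2_3 (P.r'_e' _), nest, S.op21_pair', R.rmul_form]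
  simp only [op20_slide1, MonoidalCategory.whiskerLeft_comp, Category.assoc]

theorem op20_form_nest (Z : C) : op20 P.form Z =
    op12 P.e (P.X ⊗ Z) ≫ R.M ◁ S.M ◁ op12 P.e' Z ≫ nest R S Z :=
  P.op20_form' Z

theorem split_form_right (Z : C) :
    P.X ◁ op21 P.r' Z ≫ op20 P.form Z = op12 P.e (S.M ⊗ R.M ⊗ Z) ≫ nest R S Z := by
  rw [op20_form_nest, op12_slide0, P.nest_right, ← P.nest_left, at0_2_0 (P.e_r _)]

theorem split_form_left (Z : C) :
    op21 P.r (P.X ⊗ Z) ≫ op20 P.form Z = R.M ◁ S.M ◁ op12 P.e' Z ≫ nest R S Z := by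
  rw [op20_form_nest, at0_2_2 (op12_slide P.e (op12 P.e' Z)).symm,
    at0_2_2 (op21_slide P.r (op12 P.e' Z)).symm, P.nest_left, ← P.nest_right,
    at2_2_0 (P.e'_r' Z)]

theorem split_form (Z : C) : op21 P.r (S.M ⊗ R.M ⊗ Z) ≫ P.X ◁ op21 P.r' Z ≫ op20 P.form Z =
    R.M ◁ op21 S.pair (R.M ⊗ Z) ≫ op21 R.rmul (R.M ⊗ Z) ≫ op20 R.form Z := by
  rw [split_form_right, nest_left]

/-- After one idempotent has been removed by `split_form_right` or `split_form_left`, the zigzags of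
`S` and of `R` straighten the strands in turn. -/
theorem zigzag : Zigzag P.form P.coform where
  left Z := by
    apply hom_ext_of_comp
    intro W s
    rw [op02_coform]
    simp only [MonoidalCategory.whiskerLeft_comp, Category.assoc]
    rw [at0_2_2 (op20_slide P.form (op21 P.r Z)), at0_2_2 (P.split_form_right _), nest]
    simp only [Category.assoc, op12_slide0]
    rw [at1_2_2 (op20_slide S.form (op02 R.coform (S.M ⊗ Z))), at1_2_0 (S.zigzag.left _),
      at0_2_0 (R.zigzag.left _), at0_2_0 (P.e_r Z), Category.id_comp]
  right Z := by
    apply hom_ext_of_comp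
    intro W s
    rw [op02_coform]
    simp only [Category.assoc]
    rw [at1_2_2 (P.split_form_left Z), nest]
    simp only [MonoidalCategory.whiskerLeft_comp, Category.assoc]
    rw [at0_2_2 (op21_slide P.r' (R.M ◁ S.M ◁ op12 P.e' Z)).symm,
      at1_2_2 (op02_slide R.coform (S.M ◁ op12 P.e' Z)).symm,
      at0_2_2 (op02_slide S.coform (op12 P.e' Z)).symm,
      at0_2_2 (op21_slide P.r' (R.M ◁ op20 S.form (R.M ⊗ Z))).symm,
      at1_2_2 (op02_slide R.coform (op20 S.form (R.M ⊗ Z))).symm, at0_2_0 (S.zigzag.right _),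
      at0_2_2 (op21_slide P.r' (op20 R.form Z)).symm, at1_2_0 (R.zigzag.right _),
      at0_2_0 (P.e'_r' _), Category.id_comp]

theorem mul (Z : C) : op21 μ[D.X] Z = op12 P.incl (D.X ⊗ Z) ≫ P.X ◁ P.X ◁ op12 P.incl Z ≫
    P.X ◁ op20 P.form (P.X ⊗ Z) ≫ op21 P.proj Z := by
  apply hom_ext_of_comp
  intro W s
  simp only [op12_incl, MonoidalCategory.whiskerLeft_comp, Category.assoc]
  rw [at1_2_2 (op20_slide P.form (op21 P.r Z)), at1_2_2 (op21_slide P.r (op12 S.incl Z)).symm,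
    at1_2_2 (op21_slide P.r (S.M ◁ op02 R.coform (S.M ⊗ Z))).symm, at1_3_3 (P.split_form _),
    at2_2_2 (op21_slide S.pair (op02 R.coform (S.M ⊗ Z))),
    at1_2_2 (op21_slide R.rmul (op02 R.coform (S.M ⊗ Z))), at1_2_0 (R.zigzag.left _),
    at1_2_2 (P.r_balanced Z), at2_3_1 (S.op21_rmul' Z).symm,
    at0_2_2 (op21_slide P.r' (R.M ◁ op21 S.rmul Z)).symm,
    at1_2_2 (op02_slide R.coform (op21 S.rmul Z)).symm, at0_3_1 (P.split_proj Z),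
    at0_2_1 (coform_contract Z), at0_2_2 (S.rmul_proj Z), at0_2_0 (S.incl_proj _)]

/-- Symmetry undoes the inner crossing of `R.M` first. The forms then change nesting order, and
symmetry undoes the crossing of `S.M`; each form contributes its own scalar. -/
theorem nest_flip (R : Reversal A B) (S : Reversal B D) (Z : C) :
    tw R.M (S.M ⊗ S.M ⊗ R.M ⊗ Z) ≫ R.M ◁ tw S.M (S.M ⊗ R.M ⊗ Z) ≫
      bra R.M S.M (S.M ⊗ R.M ⊗ Z) ≫ bra S.M R.M (S.M ⊗ R.M ⊗ Z) ≫
      R.M ◁ bra S.M S.M (R.M ⊗ Z) ≫ bra R.M S.M (S.M ⊗ R.M ⊗ Z) ≫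
      S.M ◁ R.M ◁ bra S.M R.M Z ≫ S.M ◁ bra R.M R.M (S.M ⊗ Z) ≫
      S.M ◁ op20 R.form (S.M ⊗ Z) ≫ (R.ν • S.ν • op20 S.form Z) = nest R S Z := by
  have e : S.M ◁ S.M ◁ op20 R.form Z ≫ (S.ν • op20 S.form Z) =
      op20 S.form (R.M ⊗ R.M ⊗ Z) ≫ (S.ν • op20 R.form Z) := by
    rw [Linear.comp_smul, Linear.comp_smul, op20_slide]
  rw [R.symm.bra_cap_smul_whisker, op11_slide1, at0_2_2 (bra_op11_right (θ R.M).inv S.M _).symm,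
    op11_slide0, at0_2_2 (bra_op11_left (θ R.M).inv S.M _).symm,
    at0_2_2 (bra_op11_right (θ R.M).inv S.M _).symm, op11_slide0, at0_2_0 (tw_itw _ _),
    at0_3_3 (bra_slide_bra S.M R.M S.M (R.M ⊗ Z)), at1_2_2 (mixed_form_left R.form Z),
    at1_2_0 (bra_ibra S.M R.M _), e, S.symm.bra_cap_smul, op11_slide0,
    at0_2_2 (bra_op11_left (θ S.M).inv R.M _).symm, at1_2_0 (tw_itw _ _),
    at0_3_1 (bra_op20_left S.form R.M _).symm, nest]

theorem symm : IsSymm (R.ν * S.ν) P.form := by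
  apply op20_ext
  rw [op20_smul, op20_comp, op20_comp, op22_whiskerRight]
  conv_lhs => rw [op20_form_nest, ← nest_flip]
  rw [op20_form, at0_2_3 (bra_op12_left P.e' P.X _).symm, at1_2_3 (bra_op12_right P.e R.M _).symm,
    at0_2_3 (bra_op12_right P.e S.M _).symm, at0_2_2 (op11_slide (θ P.X).hom (op12 P.e' _)).symm,
    at0_2_5 (op12_tw P.e _).symm, op12_slide0]
  simp only [Linear.comp_smul, mul_smul]

theorem rev (Z : C) : op11 D.rev Z = (R.ν * S.ν) •
    (op12 P.incl Z ≫ bra P.X P.X Z ≫ tw P.X (P.X ⊗ Z) ≫ op21 P.proj Z) := by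
  have h : op21 P.r (S.M ⊗ R.M ⊗ Z) ≫ P.X ◁ op21 P.r' Z ≫ op21 P.proj Z =
      R.M ◁ S.M ◁ bra S.M R.M Z ≫ ibra R.M S.M (R.M ⊗ S.M ⊗ Z) ≫ contract R S Z := by
    rw [← P.split_proj, op21_r', op21_r']
    simp only [MonoidalCategory.whiskerLeft_comp, Category.assoc]
    rw [at0_2_0 (ibra_bra _ _ _), op21_slide0]
  rw [op12_incl]
  simp only [Category.assoc]
  rw [at0_2_3 (bra_op21_left P.r P.X Z), at0_2_3 (bra_op21_right P.r' R.M _),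
    at1_2_3 (bra_op21_right P.r' S.M Z), at0_2_5 (op21_tw P.r _)]
  simp only [op11_slide0, op11_slide1, op22_slide0, op21_slide0]
  rw [h, at0_2_2 (op22_slide (β_ S.M R.M).hom (bra S.M R.M Z)).symm, at0_2_0 (bra_ibra _ _ _),
    at0_2_2 (bra_op11_left (θ R.M).hom S.M _).symm, mul_comm, mul_smul]
  rw [← Linear.comp_smul (r := R.ν), ← Linear.comp_smul (r := R.ν), ← Linear.comp_smul (r := R.ν),
    ← Linear.comp_smul (r := R.ν), R.symm.cup_smul_whisker R.zigzag]
  rw [at0_2_2 (bra_op11_left (θ S.M).hom R.M _),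
    at0_2_2 (op22_slide (β_ S.M R.M).hom (bra R.M S.M Z)).symm,
    at0_3_3 (bra_slide_bra S.M R.M S.M (R.M ⊗ Z)), at1_3_1 (bra_op02_right R.coform S.M Z)]
  simp only [op11_slide0, op22_slide0]
  rw [at1_3_1 (bra_op02_left R.coform S.M Z), coform_contract, S.rev]

/-- The composite of two reversals. -/
def reversal : Reversal A D where
  M := P.X
  act := P.act
  form := P.form
  coform := P.coform
  ν := R.ν * S.ν
  incl := P.incl
  proj := P.proj
  one_act Z := by
    rw [op21_act, ← at0_2_2 (op01_slide η[A.X] (op12 P.e Z)), at0_2_0 (R.one_act _), P.e_r]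
  mul_act Z := by
    apply P.ext
    rw [Category.assoc, Category.assoc, P.act_e, at1_2_2 (P.act_e Z), ← R.mul_act,
      at0_2_2 (op21_slide μ[A.X] (op12 P.e Z))]
  zigzag := P.zigzag
  symm := P.symm
  balanced := P.balanced
  incl_proj := P.incl_proj
  proj_incl := P.proj_incl
  unit := P.unit
  mul := P.mul
  rev := P.rev

end Reversal.Composite

end

/-! ### The regular module as a reversal. -/

section

open Strand Ribbon

variable {k : Type w₁} [Field k] {C : Type u₁} [Category.{v₁} C] [Preadditive C] [Linear k C]
  [MonoidalCategory C] [BraidedCategory C] [RightRigidCategory C] [RibbonCategory C]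
  [MonoidalPreadditive C] [MonoidalLinear k C]

namespace JandlAlgebra

variable (A : JandlAlgebra k C)

theorem comul_mul (Z : C) : op12 Δ[A.X] Z ≫ op21 μ[A.X] Z = 𝟙 _ := by
  rw [← op11_comp_21, A.normalized, op11_id]

theorem revInv_adjoint (Z : C) :
    op11 A.revInv (A.X ⊗ Z) ≫ op20 A.cap Z = A.X ◁ op11 A.revInv Z ≫ op20 A.cap Z := by
  conv_rhs => rw [← Category.id_comp (A.X ◁ _), ← A.op11_revInv_rev, Category.assoc, Category.assoc,
    ← at0_2_2 (op11_slide A.rev (op11 A.revInv Z)), A.rev_adjoint, at1_2_0 (A.op11_revInv_rev Z)]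

/-- The right action built from left multiplication is right multiplication conjugated by `σ`. This
accounts for the `σ⁻¹` in the form and projection of `regularReversal`, and for the `σ` in its
copairing and inclusion. -/
theorem op21_rightAct_mul (Z : C) : op21 (A.rightAct μ[A.X]) Z =
    op11 A.revInv (A.X ⊗ Z) ≫ op21 μ[A.X] Z ≫ op11 A.rev Z := by
  rw [A.op21_mul_rev, at0_2_0 (A.op11_revInv_rev _), A.op21_rightAct]

/-- A Jandl algebra, with its regular module, as a reversal from itself to itself. -/
def regularReversal : Reversal A A where
  M := A.X
  act := μ[A.X]
  form := A.revInv ▷ A.X ≫ A.cap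
  coform := A.cup ≫ A.rev ▷ A.X
  ν := 1
  incl := Δ[A.X] ≫ A.rev ▷ A.X
  proj := A.revInv ▷ A.X ≫ μ[A.X]
  one_act := A.one_mul
  mul_act := A.mul_assoc
  zigzag := by
    constructor
    · intro Z
      rw [op20_comp, op02_comp, op22_whiskerRight, op22_whiskerRight,
        MonoidalCategory.whiskerLeft_comp, Category.assoc, op11_slide0, op11_slide0,
        ← A.rev_adjoint, op11_slide0, at0_2_0 (A.op11_revInv_rev _), A.zigzag.left]
    · intro Z
      rw [op20_comp, op02_comp, op22_whiskerRight, op22_whiskerRight,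
        MonoidalCategory.whiskerLeft_comp, Category.assoc, at0_2_2 (A.cup_rev _),
        at1_2_0 (A.op11_rev_revInv _), A.zigzag.right]
  symm := by
    apply op20_ext
    rw [one_smul]
    simp only [op20_comp, op22_whiskerRight]
    rw [← at0_2_2 (bra_op11_left A.revInv A.X (𝟙_ C)),
      ← at0_2_2 (op11_slide (θ A.X).hom (op11 A.revInv (𝟙_ C))), A.bra_cap', A.revInv_adjoint]
  balanced Z := by
    rw [op20_comp, op22_whiskerRight, op21_rightAct_mul, Category.assoc, Category.assoc,
      at0_2_0 (A.op11_rev_revInv _), A.cap_assoc, op11_slide0]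
  incl_proj Z := by
    rw [op12_comp, op21_comp, op22_whiskerRight, op22_whiskerRight, Category.assoc,
      at0_2_0 (A.op11_rev_revInv _), A.comul_mul]
  proj_incl Z := by
    rw [op12_comp, op21_comp, op22_whiskerRight, op22_whiskerRight, op21_rightAct_mul,
      Category.assoc, Category.assoc, Category.assoc, op11_slide0, at0_2_1 (A.cup_mul_right _),
      (op11_slide A.rev (op21 μ[A.X] Z)).symm, at0_2_2 (A.comul_mul_left _)]
  unit Z := by
    rw [op02_comp, op21_comp, op22_whiskerRight, op22_whiskerRight, Category.assoc,
      at0_2_0 (A.op11_rev_revInv _), A.cup_mul]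
  mul Z := by
    rw [op12_comp, op21_comp, op20_comp, op12_comp]
    simp only [op22_whiskerRight, MonoidalCategory.whiskerLeft_comp, Category.assoc, op11_slide0,
      op11_slide1]
    rw [at0_2_0 (A.op11_rev_revInv _)]
    rw [at1_2_2 (A.rev_adjoint _).symm, op11_slide1, at1_2_0 (A.op11_revInv_rev _),
      op20_cap, MonoidalCategory.whiskerLeft_comp, Category.assoc, at1_2_2 (A.comul_mul_right Z),
      at1_2_0 (A.counit_left Z), at0_2_2 (A.comul_mul_left Z), A.comul_mul, Category.comp_id]
  rev Z := by
    have h : tw A.X (A.X ⊗ Z) ≫ op11 A.revInv (A.X ⊗ Z) = op11 A.rev (A.X ⊗ Z) := by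
      rw [← A.op11_rev_rev, Category.assoc, A.op11_rev_revInv, Category.comp_id]
    rw [one_smul, op12_comp, op21_comp, op22_whiskerRight, op22_whiskerRight, Category.assoc,
      at0_2_1 h, ← at0_2_2 (bra_op11_left A.rev A.X Z), ← A.op21_mul_rev, at0_2_0 (A.comul_mul _)]

end JandlAlgebra

end

/-! ### Isomorphisms to the dual as forms. -/

section

open Strand Ribbon

variable {k : Type w₁} [Field k] {C : Type u₁} [Category.{v₁} C] [Preadditive C] [Linear k C]
  [MonoidalCategory C] [BraidedCategory C] [RightRigidCategory C] [RibbonCategory C]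

namespace Strand

theorem op11_bidual (M Z : C) : op11 (bidual M) Z = tw M Z ≫
    op02 (η_ (Mᘁ) ((Mᘁ)ᘁ)) (M ⊗ Z) ≫ bra (Mᘁ) ((Mᘁ)ᘁ) (M ⊗ Z) ≫ (Mᘁ)ᘁ ◁ op20 (ε_ M (Mᘁ)) Z := by
  simp only [op11, op02, op22, op20, bidual, MonoidalCategory.tensorHom_def']
  monoidal

/-- `δ` is the map for which evaluation on `Mᘁ` becomes the second evaluation on `M`; this turns the
equation for `g` into a symmetry of its form. -/
theorem bidual_evaluation (M Z : C) :
    op11 (bidual M) (Mᘁ ⊗ Z) ≫ op20 (ε_ (Mᘁ) ((Mᘁ)ᘁ)) Z = op20 (evalR M) Z := by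
  apply hom_ext_of_comp
  intro W s
  rw [op11_bidual, op20_evalR]
  simp only [Category.assoc]
  rw [at0_2_2 (mixed_form_right (ε_ M (Mᘁ)) _), at0_2_2 (op20_slide (ε_ M (Mᘁ)) _).symm,
    at1_2_2 (mixed_form_left (ε_ (Mᘁ) ((Mᘁ)ᘁ)) Z).symm,
    at0_2_2 (op02_slide (η_ (Mᘁ) ((Mᘁ)ᘁ)) (bra M (Mᘁ) Z)).symm,
    at0_2_0 ((zigzag_of_exactPairing (Mᘁ) ((Mᘁ)ᘁ)).right _)]

theorem eq_of_evaluation {X M : C} {f g : X ⟶ Mᘁ}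
    (h : ∀ Z, op11 f (M ⊗ Z) ≫ op20 (ε_ M (Mᘁ)) Z = op11 g (M ⊗ Z) ≫ op20 (ε_ M (Mᘁ)) Z) :
    f = g := by
  have key : ∀ f : X ⟶ Mᘁ, op11 f (𝟙_ C) = X ◁ op02 (η_ M (Mᘁ)) (𝟙_ C) ≫
      op11 f (M ⊗ Mᘁ ⊗ 𝟙_ C) ≫ op20 (ε_ M (Mᘁ)) (Mᘁ ⊗ 𝟙_ C) := by
    intro f
    rw [at0_2_2 (op11_slide f (op02 (η_ M (Mᘁ)) (𝟙_ C))),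
      (zigzag_of_exactPairing M (Mᘁ)).left, Category.comp_id]
  apply op11_ext
  rw [key f, key g, h]

theorem eq_of_evaluation_op21 {X Y M : C} {f g : X ⊗ Y ⟶ Mᘁ}
    (h : ∀ Z, op21 f (M ⊗ Z) ≫ op20 (ε_ M (Mᘁ)) Z = op21 g (M ⊗ Z) ≫ op20 (ε_ M (Mᘁ)) Z) :
    f = g := by
  have key : ∀ f : X ⊗ Y ⟶ Mᘁ, op21 f (𝟙_ C) = X ◁ Y ◁ op02 (η_ M (Mᘁ)) (𝟙_ C) ≫
      op21 f (M ⊗ Mᘁ ⊗ 𝟙_ C) ≫ op20 (ε_ M (Mᘁ)) (Mᘁ ⊗ 𝟙_ C) := by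
    intro f
    rw [at0_2_2 (op21_slide f (op02 (η_ M (Mᘁ)) (𝟙_ C))),
      (zigzag_of_exactPairing M (Mᘁ)).left, Category.comp_id]
  apply op21_ext
  rw [key f, key g, h]

end Strand

namespace JandlAlgebra

section Module

variable (A : JandlAlgebra k C) (M : C) [ModObj A.X M]

/-- The action of a module, as a morphism from the tensor product. -/
abbrev smul : A.X ⊗ M ⟶ M := γ[A.X, M]

theorem one_smul_op (Z : C) : op01 η[A.X] (M ⊗ Z) ≫ op21 (A.smul M) Z = 𝟙 _ := by
  have h : η[A.X] ▷ M ≫ A.smul M = (λ_ M).hom := ModObj.one_smul (M := A.X) M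
  have h2 := congrArg (fun t => (λ_ (M ⊗ Z)).inv ≫ (α_ (𝟙_ C) M Z).inv ≫ t ▷ Z) h
  simp only [op01, op21]
  calc _ = _ := by monoidal
    _ = _ := h2
    _ = _ := by monoidal

theorem mul_smul_op (Z : C) : op21 μ[A.X] (M ⊗ Z) ≫ op21 (A.smul M) Z =
    A.X ◁ op21 (A.smul M) Z ≫ op21 (A.smul M) Z := by
  have h : μ[A.X] ▷ M ≫ A.smul M = (α_ A.X A.X M).hom ≫ A.X ◁ A.smul M ≫ A.smul M :=
    ModObj.mul_smul (M := A.X) M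
  have h2 := congrArg (fun t => (α_ A.X A.X (M ⊗ Z)).inv ≫ (α_ (A.X ⊗ A.X) M Z).inv ≫ t ▷ Z) h
  simp only [op21]
  calc _ = _ := by monoidal
    _ = _ := h2
    _ = _ := by monoidal

theorem op21_conjAct (Z : C) : op21 (A.conjAct M) Z = op02 (coevR M) (A.X ⊗ Mᘁ ⊗ Z) ≫
    Mᘁ ◁ op21 (A.rightAct (A.smul M)) (Mᘁ ⊗ Z) ≫ Mᘁ ◁ op20 (evalR M) Z := by
  simp only [op21, op02, op20, conjAct, rightAct, smul]
  monoidal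

theorem op21_dualAct (Z : C) : op21 (A.dualAct M) Z = Mᘁ ◁ A.X ◁ op02 (η_ M (Mᘁ)) Z ≫
    Mᘁ ◁ op21 (A.smul M) (Mᘁ ⊗ Z) ≫ op20 (ε_ M (Mᘁ)) (Mᘁ ⊗ Z) := by
  simp only [op21, op02, op20, dualAct, smul]
  monoidal

theorem dualAct_evaluation (Z : C) : op21 (A.dualAct M) (M ⊗ Z) ≫ op20 (ε_ M (Mᘁ)) Z =
    Mᘁ ◁ op21 (A.smul M) Z ≫ op20 (ε_ M (Mᘁ)) Z := by
  apply hom_ext_of_comp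
  intro W s
  rw [op21_dualAct]
  simp only [Category.assoc]
  rw [at0_2_2 (op20_slide (ε_ M (Mᘁ)) (op20 (ε_ M (Mᘁ)) Z)).symm,
    at1_2_2 (op21_slide (A.smul M) (op20 (ε_ M (Mᘁ)) Z)).symm,
    at2_2_0 ((zigzag_of_exactPairing M (Mᘁ)).right Z)]

theorem conjAct_evalR (Z : C) : M ◁ op21 (A.conjAct M) Z ≫ op20 (evalR M) Z =
    op21 (A.rightAct (A.smul M)) (Mᘁ ⊗ Z) ≫ op20 (evalR M) Z := by
  apply hom_ext_of_comp
  intro W s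
  rw [op21_conjAct]
  simp only [Category.assoc, MonoidalCategory.whiskerLeft_comp]
  simp only [op20_slide0]
  rw [at0_2_0 ((zigzag_right M).left _)]

end Module

section ReversalForm

variable {M : C} (g : M ≅ Mᘁ)

/-- The form on `M` that corresponds to an isomorphism from `M` to its dual. -/
def formOfIso : M ⊗ M ⟶ 𝟙_ C := M ◁ g.hom ≫ evalR M

/-- The copairing that corresponds to an isomorphism from `M` to its dual. -/
def coformOfIso : 𝟙_ C ⟶ M ⊗ M := coevR M ≫ g.inv ▷ M

theorem op20_formOfIso (Z : C) :
    op20 (formOfIso g) Z = M ◁ op11 g.hom Z ≫ op20 (evalR M) Z := by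
  rw [formOfIso, op20_comp, op22_whiskerLeft]

theorem op02_coformOfIso (Z : C) :
    op02 (coformOfIso g) Z = op02 (coevR M) Z ≫ op11 g.inv (M ⊗ Z) := by
  rw [coformOfIso, op02_comp, op22_whiskerRight]

theorem op11_hom_inv (Z : C) : op11 g.hom Z ≫ op11 g.inv Z = 𝟙 _ := by
  rw [← op11_comp, Iso.hom_inv_id, op11_id]

theorem op11_inv_hom (Z : C) : op11 g.inv Z ≫ op11 g.hom Z = 𝟙 _ := by
  rw [← op11_comp, Iso.inv_hom_id, op11_id]

theorem zigzag_ofIso : Zigzag (formOfIso g) (coformOfIso g) where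
  left Z := by
    rw [op20_formOfIso, op02_coformOfIso, MonoidalCategory.whiskerLeft_comp, Category.assoc,
      at1_2_0 (op11_inv_hom g _), (zigzag_right M).left]
  right Z := by
    rw [op20_formOfIso, op02_coformOfIso, MonoidalCategory.whiskerLeft_comp, Category.assoc,
      ← at0_2_2 (op11_slide g.inv (M ◁ op11 g.hom Z)), ← at0_2_2 (op02_slide (coevR M) (op11 g.hom Z)),
      ← op11_slide, at0_2_0 ((zigzag_right M).right _), op11_hom_inv]

theorem formOfIso_eq (Z : C) : op20 (formOfIso g) Z =
    tw M (M ⊗ Z) ≫ bra M M Z ≫ op11 g.hom (M ⊗ Z) ≫ op20 (ε_ M (Mᘁ)) Z := by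
  rw [op20_formOfIso, op20_evalR, at0_2_2 (op11_slide (θ M).hom (op11 g.hom Z)),
    at0_2_2 (bra_op11_left g.hom M Z)]

theorem bidual_mate_evaluation (Z : C) :
    op11 (bidual M ≫ (g.hom)ᘁ) (M ⊗ Z) ≫ op20 (ε_ M (Mᘁ)) Z = op20 (formOfIso g) Z := by
  have h := congrArg (fun t => op20 t Z) (rightAdjointMate_comp_evaluation g.hom)
  simp only [op20_comp, op22_whiskerRight, op22_whiskerLeft] at h
  rw [op11_comp, Category.assoc, h, ← at0_2_2 (op11_slide (bidual M) (op11 g.hom Z)),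
    bidual_evaluation, op20_formOfIso]

variable [MonoidalPreadditive C] [MonoidalLinear k C]

theorem hom_evaluation_of_symm {ν : k} (h : g.hom = ν • (bidual M ≫ (g.hom)ᘁ)) (Z : C) :
    op11 g.hom (M ⊗ Z) ≫ op20 (ε_ M (Mᘁ)) Z = ν • op20 (formOfIso g) Z := by
  conv_lhs => rw [h]
  rw [op11_smul, Linear.smul_comp, bidual_mate_evaluation]

theorem isSymm_formOfIso {ν : k} (h : g.hom = ν • (bidual M ≫ (g.hom)ᘁ)) :
    IsSymm ν (formOfIso g) := by
  apply op20_ext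
  conv_lhs => rw [formOfIso_eq, hom_evaluation_of_symm g h]
  rw [op20_smul, op20_comp, op20_comp, op22_whiskerRight, Linear.comp_smul, Linear.comp_smul]

theorem hom_evaluation_of_isSymm {ν : k} (h : IsSymm ν (formOfIso g)) (Z : C) :
    op11 g.hom (M ⊗ Z) ≫ op20 (ε_ M (Mᘁ)) Z = ν • op20 (formOfIso g) Z := by
  have h2 := (ibra M M Z ≫ itw M (M ⊗ Z)) ≫= (formOfIso_eq g Z).symm.trans (h.op20_eq Z)
  simp only [Category.assoc, Linear.comp_smul] at h2
  rw [at0_2_0 (itw_tw _ _), at0_2_0 (ibra_bra _ _ _), at0_2_0 (itw_tw _ _),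
    at0_2_0 (ibra_bra _ _ _)] at h2
  exact h2

theorem eq_smul_of_isSymm {ν : k} (h : IsSymm ν (formOfIso g)) :
    g.hom = ν • (bidual M ≫ (g.hom)ᘁ) := by
  apply eq_of_evaluation
  intro Z
  rw [hom_evaluation_of_isSymm g h, op11_smul, Linear.smul_comp, bidual_mate_evaluation]

variable (A : JandlAlgebra k C) [ModObj A.X M]

/-- `conjAct` is the transpose of the right action under the second evaluation, which is
nondegenerate. -/
theorem isModHom_iff : (A.smul M ≫ g.hom = A.X ◁ g.hom ≫ A.conjAct M) ↔
    ∀ Z, op21 (A.rightAct (A.smul M)) (M ⊗ Z) ≫ op20 (formOfIso g) Z =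
      M ◁ op21 (A.smul M) Z ≫ op20 (formOfIso g) Z := by
  have e : ∀ Z, op21 (A.rightAct (A.smul M)) (M ⊗ Z) ≫ op20 (formOfIso g) Z =
      M ◁ op21 (A.X ◁ g.hom ≫ A.conjAct M) Z ≫ op20 (evalR M) Z := by
    intro Z
    rw [op20_formOfIso, op21_comp, op22_whiskerLeft, MonoidalCategory.whiskerLeft_comp,
      Category.assoc, conjAct_evalR, op21_slide0]
  have e' : ∀ Z, M ◁ op21 (A.smul M) Z ≫ op20 (formOfIso g) Z =
      M ◁ op21 (A.smul M ≫ g.hom) Z ≫ op20 (evalR M) Z := by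
    intro Z
    rw [op20_formOfIso, op21_comp_11, MonoidalCategory.whiskerLeft_comp, Category.assoc]
  constructor
  · intro h Z
    rw [e, e', h]
  · intro h
    apply op21_ext
    apply (zigzag_right M).ext_left
    rw [← e, ← e', h]

/-- By symmetry, evaluating `g` in the first duality also gives the form up to `ν`. Balancedness
then makes `g` right linear as well, so it carries `M ⊗_A M` to `Mᘁ ⊗_A M`. -/
theorem hom_dualAct {ν : k} (h : g.hom = ν • (bidual M ≫ (g.hom)ᘁ))
    (hb : ∀ Z, op21 (A.rightAct (A.smul M)) (M ⊗ Z) ≫ op20 (formOfIso g) Z =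
      M ◁ op21 (A.smul M) Z ≫ op20 (formOfIso g) Z) (Z : C) :
    op11 g.hom (A.X ⊗ Z) ≫ op21 (A.dualAct M) Z =
      op21 (A.rightAct (A.smul M)) Z ≫ op11 g.hom Z := by
  have e : g.hom ▷ A.X ≫ A.dualAct M = A.rightAct (A.smul M) ≫ g.hom := by
    apply eq_of_evaluation_op21
    intro Z
    rw [op21_comp, op22_whiskerRight, op21_comp_11, Category.assoc, Category.assoc,
      dualAct_evaluation, ← op11_slide0, hom_evaluation_of_symm g h, Linear.comp_smul,
      Linear.comp_smul, hb]
  rw [← op21_comp_11, ← e, op21_comp, op22_whiskerRight]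

end ReversalForm

end JandlAlgebra

end

/-! ### Equivalences and reversals carry the same information. -/

section

open Strand Ribbon

variable {k : Type w₁} [Field k] {C : Type u₁} [Category.{v₁} C] [Preadditive C] [Linear k C]
  [MonoidalCategory C] [BraidedCategory C] [RightRigidCategory C] [RibbonCategory C]
  [MonoidalPreadditive C] [MonoidalLinear k C]

namespace JandlAlgebra

/-- An equivalence, with the module and the form, as a reversal. -/
theorem IsEquivalent.nonempty_reversal {A B : JandlAlgebra k C} (h : A.IsEquivalent B) :
    Nonempty (Reversal A B) := by
  obtain ⟨M, hM, g, ν, Q, e, r, ⟨hg, hs⟩, ⟨⟨hT, hT'⟩, hu, hm, hr⟩, φ, hφ, -, hφr⟩ := h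
  have hb := (isModHom_iff g A).1 hg
  have er : ∀ Z, op12 e Z ≫ op21 r Z = 𝟙 _ := fun Z => by rw [← op11_comp_21, hT, op11_id]
  have re : ∀ Z, op21 r Z ≫ op12 e Z = Mᘁ ◁ op02 A.cup (M ⊗ Z) ≫
      op21 (A.dualAct M) (A.X ⊗ M ⊗ Z) ≫ Mᘁ ◁ op21 (A.smul M) Z := fun Z => by
    rw [← op22_comp_12, hT', op22_balance]
    rfl
  have hφ' : ∀ Z, op11 φ.hom Z ≫ op11 φ.inv Z = 𝟙 _ := fun Z => by
    rw [← op11_comp, Iso.hom_inv_id, op11_id]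
  have hφ'' : ∀ Z, op11 φ.inv Z ≫ op11 φ.hom Z = 𝟙 _ := fun Z => by
    rw [← op11_comp, Iso.inv_hom_id, op11_id]
  have mulQ : ∀ Z, op21 μ[Q.X] Z = op12 e (Q.X ⊗ Z) ≫ Mᘁ ◁ M ◁ op12 e Z ≫
      Mᘁ ◁ op20 (evalR M) (M ⊗ Z) ≫ op21 r Z := fun Z => by
    rw [hm]
    simp only [op21, op12, op20, MonoidalCategory.tensorHom_def]
    monoidal
  have mulB : ∀ Z, op21 μ[B.X] Z = op11 φ.inv (B.X ⊗ Z) ≫ Q.X ◁ op11 φ.inv Z ≫ op21 μ[Q.X] Z ≫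
      op11 φ.hom Z := fun Z => by
    rw [← op21_comp_11, IsMonHom.mul_hom, op21_comp, op22_tensorHom, Category.assoc,
      at0_2_2 (op11_slide φ.hom (op11 φ.inv Z)), at0_2_0 (hφ'' _), at1_2_0 (hφ'' _)]
  have hi : ∀ Z, op12 (φ.inv ≫ e ≫ g.inv ▷ M) Z = op11 φ.inv Z ≫ op12 e Z ≫ op11 g.inv (M ⊗ Z) :=
    fun Z => by rw [op12_comp_11, op12_comp, op22_whiskerRight]
  have hp : ∀ Z, op21 (g.hom ▷ M ≫ r ≫ φ.hom) Z = op11 g.hom (M ⊗ Z) ≫ op21 r Z ≫ op11 φ.hom Z :=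
    fun Z => by rw [op21_comp, op22_whiskerRight, op21_comp_11]
  -- The first factor `Mᘁ` of the ambient tensor product is replaced by `M` through `g`, and `Q` by
  -- `B` through `φ`.
  refine ⟨{
    M := M
    act := A.smul M
    form := formOfIso g
    coform := coformOfIso g
    ν := ν
    incl := φ.inv ≫ e ≫ g.inv ▷ M
    proj := g.hom ▷ M ≫ r ≫ φ.hom
    one_act := A.one_smul_op M
    mul_act := A.mul_smul_op M
    zigzag := zigzag_ofIso g
    symm := isSymm_formOfIso g hs
    balanced := hb
    incl_proj := ?_
    proj_incl := ?_
    unit := ?_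
    mul := ?_
    rev := ?_ }⟩
  · intro Z
    rw [hi, hp, Category.assoc, Category.assoc, at0_2_0 (op11_inv_hom g _), at0_2_0 (er Z), hφ'']
  · intro Z
    rw [hi, hp, Category.assoc, Category.assoc, at0_2_0 (hφ' _), at0_2_3 (re Z),
      at0_2_2 (op11_slide g.hom (op02 A.cup (M ⊗ Z))).symm, at0_2_2 (hom_dualAct g A hs hb _),
      at0_2_2 (op11_slide g.hom (op21 (A.smul M) Z)).symm, op11_hom_inv, Category.comp_id]
  · intro Z
    rw [hp, op02_coformOfIso, Category.assoc, at0_2_0 (op11_inv_hom g _), ← IsMonHom.one_hom φ.hom, op01_comp, hu, op01_comp_21,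
      Category.assoc]
  · intro Z
    rw [hi, hi, hp, op20_formOfIso, mulB, mulQ]
    simp only [MonoidalCategory.whiskerLeft_comp, Category.assoc]
    rw [at2_2_0 (op11_inv_hom g _)]
    simp only [op11_slide0, op12_slide0]
    rw [at0_2_0 (op11_inv_hom g _)]
  · intro Z
    have hQ : B.rev = φ.inv ≫ Q.rev ≫ φ.hom := by rw [hφr, Iso.inv_hom_id_assoc]
    rw [hi, hp, hQ, hr, op11_comp, op11_comp, op11_smul, op11_comp_21, op21_comp, op21_comp,
      op21_comp, op22_whiskerRight, op22_tensorHom]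
    simp only [Category.assoc, Linear.comp_smul, Linear.smul_comp]
    rw [at0_2_2 (bra_op11_right g.inv M Z), at0_2_2 (op11_slide (θ M).hom (op11 g.inv Z)),
      at0_2_2 (op11_slide g.hom (op11 g.inv Z))]

end JandlAlgebra

namespace Reversal

variable {A B : JandlAlgebra k C} (R : Reversal A B)

/-- The module structure on `M`. -/
abbrev modObj : ModObj A.X R.M where
  smul := R.act
  one_smul := (bimodOfActions A.X B.X R.act R.rmul R.one_act R.mul_act R.rmul_one R.rmul_mul
    R.act_rmul).one_actLeft
  mul_smul := (bimodOfActions A.X B.X R.act R.rmul R.one_act R.mul_act R.rmul_one R.rmul_mul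
    R.act_rmul).left_assoc

/-- The morphism from `M` to its dual that corresponds to the form. -/
def toDual : R.M ⟶ R.Mᘁ :=
  (λ_ R.M).inv ≫ coevR R.M ▷ R.M ≫ (α_ (R.Mᘁ) R.M R.M).hom ≫ R.Mᘁ ◁ R.form ≫ (ρ_ (R.Mᘁ)).hom

/-- The morphism to `M` from its dual that corresponds to the copairing. -/
def ofDual : R.Mᘁ ⟶ R.M :=
  (λ_ (R.Mᘁ)).inv ≫ R.coform ▷ R.Mᘁ ≫ (α_ R.M R.M (R.Mᘁ)).hom ≫ R.M ◁ evalR R.M ≫ (ρ_ R.M).hom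

theorem op11_toDual (Z : C) :
    op11 R.toDual Z = op02 (coevR R.M) (R.M ⊗ Z) ≫ R.Mᘁ ◁ op20 R.form Z := by
  simp only [op11, op02, op20, toDual]
  monoidal

theorem op11_ofDual (Z : C) :
    op11 R.ofDual Z = op02 R.coform (R.Mᘁ ⊗ Z) ≫ R.M ◁ op20 (evalR R.M) Z := by
  simp only [op11, op02, op20, ofDual]
  monoidal

theorem toDual_evalR (Z : C) : R.M ◁ op11 R.toDual Z ≫ op20 (evalR R.M) Z = op20 R.form Z := by
  rw [op11_toDual, MonoidalCategory.whiskerLeft_comp, Category.assoc, op20_slide,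
    at0_2_0 ((zigzag_right R.M).left _)]

theorem ofDual_form (Z : C) : R.M ◁ op11 R.ofDual Z ≫ op20 R.form Z = op20 (evalR R.M) Z := by
  rw [op11_ofDual, MonoidalCategory.whiskerLeft_comp, Category.assoc, op20_slide,
    at0_2_0 (R.zigzag.left _)]

/-- The isomorphism from `M` to its dual that corresponds to the form. -/
def dualIso : R.M ≅ R.Mᘁ where
  hom := R.toDual
  inv := R.ofDual
  hom_inv_id := by
    apply op11_ext
    apply R.zigzag.ext_left
    rw [op11_comp, MonoidalCategory.whiskerLeft_comp, Category.assoc, ofDual_form, toDual_evalR,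
      op11_id, MonoidalCategory.whiskerLeft_id, Category.id_comp]
  inv_hom_id := by
    apply op11_ext
    apply (zigzag_right R.M).ext_left
    rw [op11_comp, MonoidalCategory.whiskerLeft_comp, Category.assoc, toDual_evalR, ofDual_form,
      op11_id, MonoidalCategory.whiskerLeft_id, Category.id_comp]

theorem formOfIso_dualIso : JandlAlgebra.formOfIso R.dualIso = R.form := by
  apply op20_ext
  rw [JandlAlgebra.op20_formOfIso]
  exact R.toDual_evalR _

theorem coevR_ofDual (Z : C) :
    op02 (coevR R.M) Z ≫ op11 R.ofDual (R.M ⊗ Z) = op02 R.coform Z := by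
  rw [op11_ofDual, at0_2_2 (op02_slide R.coform (op02 (coevR R.M) Z)),
    ← MonoidalCategory.whiskerLeft_comp, (zigzag_right R.M).left, MonoidalCategory.whiskerLeft_id,
    Category.comp_id]

theorem isEquivalent (R : Reversal A B) : A.IsEquivalent B := by
  let := R.modObj
  have hs := JandlAlgebra.eq_smul_of_isSymm R.dualIso (R.formOfIso_dualIso ▸ R.symm)
  have hb : ∀ Z, op21 (A.rightAct (A.smul R.M)) (R.M ⊗ Z) ≫
      op20 (JandlAlgebra.formOfIso R.dualIso) Z =
      R.M ◁ op21 (A.smul R.M) Z ≫ op20 (JandlAlgebra.formOfIso R.dualIso) Z := by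
    rw [R.formOfIso_dualIso]
    exact R.balanced
  have hd : ∀ Z, op11 R.toDual (A.X ⊗ Z) ≫ op21 (A.dualAct R.M) Z =
      op21 (A.rightAct (A.smul R.M)) Z ≫ op11 R.toDual Z :=
    JandlAlgebra.hom_dualAct R.dualIso A hs hb
  have hi : ∀ Z, op12 (R.incl ≫ R.toDual ▷ R.M) Z = op12 R.incl Z ≫ op11 R.toDual (R.M ⊗ Z) :=
    fun Z => by rw [op12_comp, op22_whiskerRight]
  have hp : ∀ Z, op21 (R.ofDual ▷ R.M ≫ R.proj) Z = op11 R.ofDual (R.M ⊗ Z) ≫ op21 R.proj Z :=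
    fun Z => by rw [op21_comp, op22_whiskerRight]
  have h1 : ∀ Z, op11 R.toDual Z ≫ op11 R.ofDual Z = 𝟙 _ := JandlAlgebra.op11_hom_inv R.dualIso
  have h2 : ∀ Z, op11 R.ofDual Z ≫ op11 R.toDual Z = 𝟙 _ := JandlAlgebra.op11_inv_hom R.dualIso
  -- `B` itself serves as the model of `Mᘁ ⊗_A M`, so the comparison isomorphism is the identity.
  refine ⟨R.M, R.modObj, R.dualIso, R.ν, B, R.incl ≫ R.toDual ▷ R.M, R.ofDual ▷ R.M ≫ R.proj,
    ⟨(JandlAlgebra.isModHom_iff R.dualIso A).2 hb, hs⟩, ⟨?_, ?_, ?_, ?_⟩,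
    Iso.refl _, ?_, ?_, ?_⟩
  · apply isTensorOver_of_op
    · intro Z
      rw [hi, hp, Category.assoc, at0_2_0 (h1 _), R.incl_proj]
    · intro Z
      rw [hi, hp, Category.assoc, at0_2_3 (R.balance_eq Z)]
      change op11 R.ofDual (R.M ⊗ Z) ≫ R.M ◁ op02 A.cup (R.M ⊗ Z) ≫
        op21 (A.rightAct (A.smul R.M)) _ ≫ R.M ◁ op21 R.act Z ≫ op11 R.toDual (R.M ⊗ Z) =
        R.Mᘁ ◁ op02 A.cup (R.M ⊗ Z) ≫ op21 (A.dualAct R.M) _ ≫ R.Mᘁ ◁ op21 R.act Z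
      rw [op11_slide, at0_2_2 (hd _).symm, at0_2_2 (op11_slide R.toDual (op02 A.cup (R.M ⊗ Z))),
        at0_2_0 (h2 _)]
  · apply op01_ext
    rw [op01_comp_21, hp, at0_2_1 (R.coevR_ofDual _), R.unit]
  · apply op21_ext
    have key : ∀ (e : B.X ⟶ R.Mᘁ ⊗ R.M) (r : R.Mᘁ ⊗ R.M ⟶ B.X) (Z : C),
        op21 ((e ⊗ₘ e) ≫ (α_ (R.Mᘁ) R.M (R.Mᘁ ⊗ R.M)).hom ≫
          R.Mᘁ ◁ ((α_ R.M (R.Mᘁ) R.M).inv ≫ evalR R.M ▷ R.M ≫ (λ_ R.M).hom) ≫ r) Z =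
        op12 e (B.X ⊗ Z) ≫ R.Mᘁ ◁ R.M ◁ op12 e Z ≫ R.Mᘁ ◁ op20 (evalR R.M) (R.M ⊗ Z) ≫
          op21 r Z := by
      intro e r Z
      simp only [op21, op12, op20, MonoidalCategory.tensorHom_def]
      monoidal
    rw [key, hi, hi, hp, R.mul, ← R.toDual_evalR]
    simp only [MonoidalCategory.whiskerLeft_comp, Category.assoc]
    simp only [op11_slide0]
    rw [at0_2_0 (h1 _)]
  · apply op11_ext
    rw [R.rev, op11_smul, op11_comp_21, hi, op21_comp, op21_comp, op21_comp, op22_whiskerRight,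
      op22_tensorHom, hp]
    simp only [Category.assoc]
    change _ = R.ν • (op12 R.incl _ ≫ op11 R.toDual _ ≫ bra _ _ _ ≫ tw _ _ ≫ op11 R.toDual _ ≫
      R.Mᘁ ◁ op11 R.ofDual _ ≫ op11 R.ofDual _ ≫ op21 R.proj _)
    rw [at0_2_2 (bra_op11_right R.toDual R.M (𝟙_ C)),
      at0_2_2 (op11_slide (θ R.M).hom (op11 R.toDual (𝟙_ C))),
      at0_2_2 (op11_slide R.toDual (op11 R.toDual (𝟙_ C))), at1_2_0 (h1 _), at0_2_0 (h1 _)]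
  · exact inferInstanceAs (IsMonHom (𝟙 B.X))
  · exact inferInstanceAs (IsComonHom (𝟙 B.X))
  · simp

end Reversal

end

/-! ### The main theorem. -/

theorem lemma14 {k : Type w} [Field k] {C : Type u} [Category.{v} C] [Preadditive C] [Linear k C]
    [HasFiniteBiproducts C] [IsIdempotentComplete C] [MonoidalCategory C] [MonoidalPreadditive C]
    [MonoidalLinear k C] [BraidedCategory C] [RightRigidCategory C] [RibbonCategory C]
    (hunit : Function.Bijective fun a : k => a • 𝟙 (𝟙_ C)) :
    Equivalence (fun A B : {A : JandlAlgebra k C // A.IsSimple} => A.1.IsEquivalent B.1) ∧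
      ∀ A B : {A : JandlAlgebra k C // A.IsSimple},
        A.1.IsEquivalent B.1 → A.1.IsMoritaEquivalent B.1 := by
  have key : ∀ {A B : {A : JandlAlgebra k C // A.IsSimple}} (R : Reversal A.1 B.1),
      R.insert ≫ R.retract = 𝟙 _ := fun {A B} R =>
    R.insert_retract_of_simple A.2 (JandlAlgebra.id_ne_zero hunit.1 B.1)
  refine ⟨⟨fun A => A.1.regularReversal.isEquivalent, fun {A B} h => ?_, fun {A B D} h h' => ?_⟩,
    fun A B h => ?_⟩
  · obtain ⟨R⟩ := h.nonempty_reversal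
    exact (R.inverse (key R)).isEquivalent
  · obtain ⟨R⟩ := h.nonempty_reversal
    obtain ⟨S⟩ := h'.nonempty_reversal
    -- Idempotent completeness supplies the object `R.M ⊗_B S.M` on which the composite reversal
    -- lives.
    obtain ⟨P, e, p, h1, h2⟩ := B.1.exists_balance_splitting R.rmul_mul S.one_act S.mul_act
    let T : R.Composite S := ⟨P, e, p, h1, h2⟩
    exact T.reversal.isEquivalent
  · obtain ⟨R⟩ := h.nonempty_reversal
    exact JandlAlgebra.isMoritaEquivalent_of_reversal R (key R)
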